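/- **Theorem (relative-error quantiles sketch).** For an item $y$ of a totally ordered universe $\mathcal U$, let $R(y)$ be the number of items $x\le y$ in the input, a multiset of $n\ge 1$ items. Write $L=\max\{1,\log_2(\varepsilon n)\}$ (so $L=\log_2(\varepsilon n)$ as soon as $\varepsilon n\ge 2$). There is a universal constant $C$ such that for all parameters $0<\delta\le 1/2$ and $0<\varepsilon\le 1$ there is a randomized, comparison-based, one-pass, mergeable sketch, namely the relative-compactor sketch with integer parameters (stage bounds $N_0<N_1<\dots$ on the input size, even section sizes $k_i$ and buffer capacities $B_i=2k_im_i$) that depend only on $\varepsilon$ and $\delta$ and not on $n$, on $\mathcal U$ or on the input, with the following properties. Let $S$ be the sketch of an input of $n$ items obtained by an arbitrary (fixed) sequence of pairwise merge operations starting from single items; processing a stream of $n$ items in one pass is the special case in which every merge inserts the next item. All compactions use independent fair coins. Assume that $\varepsilon\,(2\log_2 n)^{1/4}\le 4$, that is, $\varepsilon\le 4/\sqrt[4]{2\log_2 n}$ if $n\ge 2$. 1. From $S$ one derives for every $y\in\mathcal U$ an estimate $\hat R(y)$ such that, for every fixed $y$ with $R(y)\ge 1$, $$\Pr\big[\,|\hat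 R(y)-R(y)|\ge \varepsilon R(y)\,\big]<\delta ,$$ where the probability is over the coins; and if $R(y)=0$ then always $\hat R(y)=0$. 2. If $\varepsilon\le 4\sqrt{\ln(1/\delta)/L}$, then $S$ always takes at most $C\,\varepsilon^{-1}L^{1.5}\sqrt{\ln(1/\delta)}$ memory words; otherwise it always takes at most $C\,L^2$ memory words. Here a word holds one stored item, one counter, or the state of the compaction schedule of one level; the input size that $S$ stores is exactly $n$ and every state is at most $n$. 3. The sketch is comparison-based: it stores only items of the input, and for every strictly increasing map $f$ of universes the sketch of the input renamed by $f$ is, for the same coins, the sketch $S$ with its items renamed by $f$. The relative-compactor sketch consists of levels $h=0,1,2,\dots$, each with a buffer of items and a state (a natural number, initially $0$). The sketch of one item has that item in level $0$, and $\hat R(y)$ is the sum of $2^h$ over the stored items $x\le y$, where $h$ is the level of $x$. A sketch of $n$ items is in stage $i$, the least $i$ with $n\le N_i$. A *compaction* of a level keeps its $s$ smallest items, sorts the others, moves either those at odd or those at even positions (decided by a fair coin) to the next level, discards the rest, and adds $1$ to the state. To merge two sketches, let $i$ be the stage for the combined size. First, in each of the two sketches whose stage $j$ is smaller than $i$, every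 level below the topmost one that holds more than $B_j/2$ items is compacted with $s=B_j/2$, from the bottom up. Then, level by level, the buffers are united and the states are combined by bitwise OR. Finally, from the bottom up, each level with at least $B_i$ items is compacted once with $s=B_i-(z+1)k_i$, where $z$ is the number of trailing ones in the binary representation of its state; new levels are opened as needed. -/

import Mathlib

universe u

/-- The integer parameters of a relative-compactor sketch, indexed by the stage `i`:
`N i` is the upper bound on the input size that is valid during stage `i`, `k i` is the size of a
section of a buffer (a positive even number), and each half of a buffer has `m i` sections.
Nothing here depends on the input or on its size. -/
structure RCSchedule where
  N : ℕ → ℕ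
  k : ℕ → ℕ
  m : ℕ → ℕ
  strictMono_N : StrictMono N
  k_pos : ∀ i, 0 < k i
  k_even : ∀ i, Even (k i)
  m_pos : ∀ i, 0 < m i

namespace RCSchedule

/-- The capacity `B = 2 k m` of a buffer in stage `i`. -/
def B (P : RCSchedule) (i : ℕ) : ℕ := 2 * P.k i * P.m i

theorem four_le_B (P : RCSchedule) (i : ℕ) : 4 ≤ P.B i := by
  obtain ⟨a, ha⟩ := P.k_even i
  have h1 := P.k_pos i
  have h2 := P.m_pos i
  have h3 : 2 ≤ P.k i := by omega
  unfold B
  nlinarith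

theorem exists_le_N (P : RCSchedule) (n : ℕ) : ∃ i, n ≤ P.N i :=
  ⟨n, P.strictMono_N.id_le n⟩

/-- The stage of a sketch that summarizes `n` items: the first one whose bound is at least `n`. -/
def stage (P : RCSchedule) (n : ℕ) : ℕ := Nat.find (P.exists_le_N n)

end RCSchedule

/-- A relative-compactor: a buffer of items and the state of its compaction schedule. -/
@[ext]
structure RelCompactor (U : Type u) where
  buf : Multiset U
  state : ℕ

/-- A sketch: the number `n` of items summarized so far, and the list of its relative-compactors,
starting with level `0`. -/
@[ext]
structure RCSketch (U : Type u) where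
  n : ℕ
  levels : List (RelCompactor U)

theorem exists_testBit_eq_false (s : ℕ) : ∃ j, s.testBit j = false :=
  ⟨s, Nat.testBit_lt_two_pow Nat.lt_two_pow_self⟩

/-- The number of trailing ones in the binary representation of `s`. -/
def trailingOnes (s : ℕ) : ℕ := Nat.find (exists_testBit_eq_false s)

/-- The 1st, 3rd, 5th, ... entry of a list. -/
def oddIndexed {U : Type u} : List U → List U
  | [] => []
  | [x] => [x]
  | x :: _ :: l => x :: oddIndexed l

/-- The odd or the even indexed entries of a list, depending on a coin. -/
def everyOther {U : Type u} (coin : Bool) (l : List U) : List U :=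
  if coin then oddIndexed l else oddIndexed l.tail

/-- What a compaction that protects the `s` smallest items leaves in the buffer. -/
def compactKeep {U : Type u} [LinearOrder U] (s : ℕ) (b : Multiset U) : Multiset U :=
  ((b.sort (· ≤ ·)).take s : List U)

/-- The output of a compaction that protects the `s` smallest items. -/
def compactOut {U : Type u} [LinearOrder U] (coin : Bool) (s : ℕ) (b : Multiset U) : Multiset U :=
  (everyOther coin ((b.sort (· ≤ ·)).drop s) : List U)

theorem length_oddIndexed_le {U : Type u} :
    ∀ l : List U, 2 * (oddIndexed l).length ≤ l.length + 1
  | [] => by simp [oddIndexed]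
  | [x] => by simp [oddIndexed]
  | x :: y :: l => by
    have := length_oddIndexed_le l
    simp only [oddIndexed, List.length_cons]
    omega

theorem card_compactOut_le {U : Type u} [LinearOrder U] (coin : Bool) (s : ℕ) (b : Multiset U) :
    2 * (compactOut coin s b).card ≤ b.card + 1 := by
  have h1 := length_oddIndexed_le ((b.sort (· ≤ ·)).drop s)
  have h2 := length_oddIndexed_le ((b.sort (· ≤ ·)).drop s).tail
  simp only [List.length_drop, List.length_tail, Multiset.length_sort] at h1 h2
  unfold compactOut everyOther
  split_ifs <;> simp only [Multiset.coe_card] <;> omega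

namespace RCSketch

/-- Special compactions: from the bottom up, every level below the topmost one whose buffer holds
more than `B / 2` items keeps its `B / 2` smallest items and compacts the others into the next
level. The coin of level `h` is `coin h`; `carry` is what arrives from the level below. -/
def specialCompactions {U : Type u} [LinearOrder U] (P : RCSchedule) (i : ℕ) (coin : ℕ → Bool) :
    ℕ → Multiset U → List (RelCompactor U) → List (RelCompactor U)
  | _, _, [] => []
  | _, carry, [c] => [⟨c.buf + carry, c.state⟩]
  | h, carry, c :: d :: cs =>
    if P.B i / 2 < (c.buf + carry).card then
      ⟨compactKeep (P.B i / 2) (c.buf + carry), c.state + 1⟩ ::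
        specialCompactions P i coin (h + 1)
          (compactOut (coin h) (P.B i / 2) (c.buf + carry)) (d :: cs)
    else
      ⟨c.buf + carry, c.state⟩ :: specialCompactions P i coin (h + 1) 0 (d :: cs)

/-- Combining two sketches level by level: the buffers are united, the states are combined by a
bitwise OR. -/
def combine {U : Type u} : List (RelCompactor U) → List (RelCompactor U) → List (RelCompactor U)
  | [], ds => ds
  | c :: cs, [] => c :: cs
  | c :: cs, d :: ds => ⟨c.buf + d.buf, c.state ||| d.state⟩ :: combine cs ds

/-- The number of smallest items that a scheduled compaction in state `s` protects: of the `B`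
smallest items of the buffer, `trailingOnes s + 1` sections are compacted. -/
def protect (P : RCSchedule) (i s : ℕ) : ℕ := P.B i - (trailingOnes s + 1) * P.k i

/-- Opening new levels `h`, `h + 1`, ... for the items `carry` compacted out of the topmost
level. -/
def openLevels {U : Type u} [LinearOrder U] (P : RCSchedule) (i : ℕ) (coin : ℕ → Bool)
    (h : ℕ) (carry : Multiset U) : List (RelCompactor U) :=
  if carry.card = 0 then []
  else if P.B i ≤ carry.card then
    ⟨compactKeep (protect P i 0) carry, 1⟩ ::
      openLevels P i coin (h + 1) (compactOut (coin h) (protect P i 0) carry)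
  else [⟨carry, 0⟩]
termination_by carry.card
decreasing_by
  have h1 := P.four_le_B i
  have h2 := card_compactOut_le (coin h) (protect P i 0) carry
  omega

/-- Scheduled compactions: from the bottom up, one compaction at every level whose buffer holds at
least `B` items. -/
def scheduledCompactions {U : Type u} [LinearOrder U] (P : RCSchedule) (i : ℕ) (coin : ℕ → Bool) :
    ℕ → Multiset U → List (RelCompactor U) → List (RelCompactor U)
  | h, carry, [] => openLevels P i coin h carry
  | h, carry, c :: cs =>
    if P.B i ≤ (c.buf + carry).card then
      ⟨compactKeep (protect P i c.state) (c.buf + carry), c.state + 1⟩ ::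
        scheduledCompactions P i coin (h + 1)
          (compactOut (coin h) (protect P i c.state) (c.buf + carry)) cs
    else
      ⟨c.buf + carry, c.state⟩ :: scheduledCompactions P i coin (h + 1) 0 cs

/-- The levels of `S`, after special compactions if `S` has to move up to stage `i`. -/
def prepare {U : Type u} [LinearOrder U] (P : RCSchedule) (i : ℕ) (coin : ℕ → Bool)
    (S : RCSketch U) : List (RelCompactor U) :=
  if P.stage S.n < i then specialCompactions P (P.stage S.n) coin 0 0 S.levels else S.levels

/-- The merge operation. The coins `coin 0` are used for the special compactions of the first
sketch, `coin 1` for those of the second one, and `coin 2` for the scheduled compactions. -/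
def merge {U : Type u} [LinearOrder U] (P : RCSchedule) (coin : Fin 3 → ℕ → Bool)
    (S T : RCSketch U) : RCSketch U where
  n := S.n + T.n
  levels := scheduledCompactions P (P.stage (S.n + T.n)) (coin 2) 0 0
    (combine (prepare P (P.stage (S.n + T.n)) (coin 0) S)
      (prepare P (P.stage (S.n + T.n)) (coin 1) T))

/-- The sketch of a single item. -/
def single {U : Type u} (x : U) : RCSketch U := ⟨1, [⟨{x}, 0⟩]⟩

/-- The estimated rank of `y`: an item stored at level `h` has weight `2 ^ h`. -/
def estimate {U : Type u} [LinearOrder U] (S : RCSketch U) (y : U) : ℕ :=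
  (S.levels.mapIdx fun h c => 2 ^ h * c.buf.countP (· ≤ y)).sum

/-- The number of memory words of a sketch: one for each stored item, two for each level (the state
of the schedule and the number of stored items), and two for the input size and the number of
levels. -/
def size {U : Type u} (S : RCSketch U) : ℕ := 2 + (S.levels.map fun c => c.buf.card + 2).sum

/-- Renaming the stored items. -/
def map {U V : Type u} (f : U → V) (S : RCSketch U) : RCSketch V :=
  ⟨S.n, S.levels.map fun c => ⟨c.buf.map f, c.state⟩⟩

end RCSketch

/-- An arbitrary sequence of pairwise merge operations on single items. The insertion of an item
into a sketch is the merge with the sketch of that item, so reading a stream `x₁, x₂, ..., xₙ` in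
one pass is the tree `node (... (node (node (leaf x₁) (leaf x₂)) (leaf x₃)) ...) (leaf xₙ)`. -/
inductive MergeTree (U : Type u) where
  | leaf (x : U) : MergeTree U
  | node (l r : MergeTree U) : MergeTree U

namespace MergeTree

/-- The summarized input. -/
def items {U : Type u} : MergeTree U → List U
  | leaf x => [x]
  | node l r => l.items ++ r.items

/-- The size of the summarized input. -/
def size {U : Type u} (t : MergeTree U) : ℕ := t.items.length

/-- The rank of `y` in the summarized input. -/
def rank {U : Type u} [LinearOrder U] (t : MergeTree U) (y : U) : ℕ := t.items.countP (· ≤ y)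

/-- Renaming the input items. -/
def map {U V : Type u} (f : U → V) : MergeTree U → MergeTree V
  | leaf x => leaf (f x)
  | node l r => node (l.map f) (r.map f)

end MergeTree

/-- A coin is named by the place of the merge operation in the tree (the path to the root), the
kind of compaction, and the level. -/
abbrev Coin : Type := List Bool × Fin 3 × ℕ

/-- Independent fair coins. -/
noncomputable def coinMeasure : MeasureTheory.Measure (Coin → Bool) :=
  MeasureTheory.Measure.infinitePi fun _ => (PMF.uniformOfFintype Bool).toMeasure

/-- The sketch that the merge operations in the tree `t` produce with the outcomes `ω` of the coins,
where `p` is the path from `t` to the root of the tree in which it is a subtree. -/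
def RCSketch.build {U : Type u} [LinearOrder U] (P : RCSchedule) (ω : Coin → Bool) :
    List Bool → MergeTree U → RCSketch U
  | _, .leaf x => RCSketch.single x
  | p, .node l r =>
    RCSketch.merge P (fun a h => ω (p, a, h))
      (RCSketch.build P ω (false :: p) l) (RCSketch.build P ω (true :: p) r)

/-- `log₂ (ε n)`, rounded up to `1` when `ε n < 2`. -/
noncomputable def logEps (ε : ℝ) (n : ℕ) : ℝ := max 1 (Real.logb 2 (ε * n))

/-!
The proof follows the error of the rank of a fixed `y` through the levels. A compaction moves every
second one of the items that it removes up one level, where an item weighs twice as much. So it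
changes the estimate only if it removes an odd number of items at most `y`, and then by plus or
minus the weight of one item of its level, as the coin decides. The error is therefore a sum of
signed weights, one for each such rounding (`RCSketch.estimate_eq`). Write `R` for the rank of `y`.

*Few roundings.* A compaction in a state with `z` trailing ones takes `z + 1` sections, clears these
ones and sets bit `z`. A bit that is set thus remembers a compaction of its size that has not been
followed by a larger one. If that compaction removed items at most `y`, then the next larger one
removes a section of such items for every bit that it clears (`card_marked_compact`); so, in the
long run, there is one rounding for `k` removed items at most `y`. Two sketches to be merged can
have the same bit set, and one of the two bits is then lost by the bitwise OR, but in this case the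
united buffer has more than `B` items at most `y`, and the excess pays (`card_marked_add_le`). All
of this is put into one invariant with a credit for each item that decreases as the item moves up
and as the capacity grows with the stage; a compaction of level `h` that removes items at most `y`
is charged `k 2 ^ h B` (`RCSketch.credit_invariant`). When the invariants of the levels are added
with the weights `2 ^ h`, the credits telescope up to the roundings. The result is that the sum of
the squared weights of the roundings is at most `32 R (R + M) / K`, where `K` is a lower bound for
`k B`, and where `M` is another sum of signed weights, now with factors between `0` and `1`
(`RCSketch.sum_roundings_le`).

*Lower coins decide.* What happens at a level depends only on the coins of the levels below it
(`RCSketch.nodePass_agree`). In the order of the levels, the sums of signed weights are therefore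
martingales, with exponential tails in terms of the sum of the squared weights
(`lintegral_exp_sum_le_one`). They are stopped at the first level that receives more than twice the
items that it should, because the bound on the roundings needs this control. Three exponential
tails, one for `M` and two for the error, show that the probability of a relative error `ε` is at
most `3 exp (-ε² K / 128)` (`RCSketch.measure_error_le`); a sketch whose stopped error is small has
not been stopped at all.

*Few compactions.* A scheduled compaction removes at least one section, and the special ones are
rare because the capacity at least doubles from stage to stage. So the states are at most the number
of items and have so few bits that there are enough sections for all trailing ones
(`RCSketch.state_le_size`, `RCSketch.compactions_lt_two_pow`). Moreover, the number of items that
arrive at a level decreases geometrically with the level, which bounds the number of levels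
(`RCSketch.length_levels_le`).

The parameters (`RCSchedule.geometric`) make `k B` at least of the order of `ε⁻² log (1 / δ)` in all
stages. The bound on the input size, in units of `ε⁻¹`, is raised to the fourth power from one stage
to the next, so that `4 ^ i` is at most of the order of `L` in the stage `i` of the input. There the
capacity is of the order of `2 ^ i ε⁻¹ √(log (1 / δ)) + 4 ^ i`, and there are at most `5 L` levels.
-/

/-! ### One compaction, seen through the number of items at most `y` -/

theorem mem_of_mem_oddIndexed {U : Type u} {x : U} :
    ∀ {l : List U}, x ∈ oddIndexed l → x ∈ l
  | [], h => by simp [oddIndexed] at h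
  | [a], h => by simpa [oddIndexed] using h
  | a :: b :: l, h => by
    simp only [oddIndexed, List.mem_cons] at h ⊢
    rcases h with h | h
    · exact Or.inl h
    · exact Or.inr (Or.inr (mem_of_mem_oddIndexed h))

theorem mem_of_mem_everyOther {U : Type u} {x : U} {coin : Bool} {l : List U}
    (h : x ∈ everyOther coin l) : x ∈ l := by
  unfold everyOther at h
  split_ifs at h
  · exact mem_of_mem_oddIndexed h
  · exact List.mem_of_mem_tail (mem_of_mem_oddIndexed h)

theorem mem_of_mem_compactKeep {U : Type u} [LinearOrder U] {x : U} {s : ℕ} {b : Multiset U}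
    (h : x ∈ compactKeep s b) : x ∈ b := by
  unfold compactKeep at h
  exact (Multiset.mem_sort _).1 (List.mem_of_mem_take (Multiset.mem_coe.1 h))

theorem mem_of_mem_compactOut {U : Type u} [LinearOrder U] {x : U} {coin : Bool} {s : ℕ}
    {b : Multiset U} (h : x ∈ compactOut coin s b) : x ∈ b := by
  unfold compactOut at h
  exact (Multiset.mem_sort _).1
    (List.mem_of_mem_drop (mem_of_mem_everyOther (Multiset.mem_coe.1 h)))

theorem le_length_oddIndexed {U : Type u} :
    ∀ l : List U, l.length ≤ 2 * (oddIndexed l).length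
  | [] => by simp [oddIndexed]
  | [x] => by simp [oddIndexed]
  | x :: y :: l => by
    have := le_length_oddIndexed l
    simp only [oddIndexed, List.length_cons]
    omega

section counting

variable {U : Type u} [LinearOrder U]

theorem countP_le_eq_zero_of_lt {y x : U} {l : List U} (h : (x :: l).Pairwise (· ≤ ·))
    (hx : y < x) : l.countP (· ≤ y) = 0 := by
  rw [List.countP_eq_zero]
  intro a ha
  have := List.rel_of_pairwise_cons h ha
  simpa using hx.trans_le this

theorem countP_drop_of_sorted (y : U) :
    ∀ (s : ℕ) (l : List U), l.Pairwise (· ≤ ·) →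
      (l.drop s).countP (· ≤ y) = l.countP (· ≤ y) - s
  | 0, l, _ => by simp
  | s + 1, [], _ => by simp
  | s + 1, x :: l, h => by
    have ih := countP_drop_of_sorted y s l h.of_cons
    rw [List.drop_succ_cons, ih]
    by_cases hx : x ≤ y
    · rw [List.countP_cons_of_pos (by simpa using hx)]
      omega
    · have h0 := countP_le_eq_zero_of_lt h (not_le.1 hx)
      rw [List.countP_cons_of_neg (by simpa using hx)]
      omega

theorem countP_oddIndexed_of_sorted (y : U) :
    ∀ l : List U, l.Pairwise (· ≤ ·) →
      (oddIndexed l).countP (· ≤ y) = (l.countP (· ≤ y) + 1) / 2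
  | [], _ => by simp [oddIndexed]
  | [x], _ => by
    by_cases hx : x ≤ y <;> simp [oddIndexed, hx]
  | x :: x' :: l, h => by
    have ih := countP_oddIndexed_of_sorted y l h.of_cons.of_cons
    by_cases hx : x ≤ y
    · by_cases hx' : x' ≤ y
      · simp only [oddIndexed, List.countP_cons, ih, hx, hx', decide_true, if_true]
        omega
      · have h0 := countP_le_eq_zero_of_lt h.of_cons (not_le.1 hx')
        simp only [oddIndexed, List.countP_cons, ih, hx, hx', decide_true, if_true, h0]
        simp
    · have h0 := countP_le_eq_zero_of_lt h (not_le.1 hx)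
      have h1 : l.countP (· ≤ y) = 0 := by
        rw [List.countP_cons] at h0
        omega
      simp only [oddIndexed, List.countP_cons_of_neg (p := fun z => decide (z ≤ y))
        (a := x) (l := oddIndexed l) (by simpa using hx),
        List.countP_cons_of_neg (p := fun z => decide (z ≤ y))
        (a := x) (l := x' :: l) (by simpa using hx), h0, ih, h1]

theorem countP_oddIndexed_tail_of_sorted (y : U) :
    ∀ l : List U, l.Pairwise (· ≤ ·) →
      (oddIndexed l.tail).countP (· ≤ y) = l.countP (· ≤ y) / 2
  | [], _ => by simp [oddIndexed]
  | x :: l, h => by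
    rw [List.tail_cons, countP_oddIndexed_of_sorted y l h.of_cons]
    by_cases hx : x ≤ y
    · rw [List.countP_cons_of_pos (by simpa using hx)]
    · rw [List.countP_cons_of_neg (by simpa using hx),
        countP_le_eq_zero_of_lt h (not_le.1 hx)]

/-- The number of items at most `y` in a multiset. -/
def cnt (y : U) (b : Multiset U) : ℕ := b.countP (· ≤ y)

theorem cnt_zero (y : U) : cnt y (0 : Multiset U) = 0 := by simp [cnt]

theorem cnt_add (y : U) (a b : Multiset U) : cnt y (a + b) = cnt y a + cnt y b := by
  simp [cnt]

theorem cnt_le_card (y : U) (b : Multiset U) : cnt y b ≤ b.card := Multiset.countP_le_card _ _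

theorem cnt_eq_card {y : U} {b : Multiset U} (h : ∀ x ∈ b, x ≤ y) : cnt y b = b.card :=
  Multiset.countP_eq_card.2 h

theorem cnt_sort (y : U) (b : Multiset U) :
    (b.sort (· ≤ ·)).countP (· ≤ y) = cnt y b := by
  have := congrArg (cnt y) (Multiset.sort_eq b (· ≤ ·))
  simpa only [cnt, Multiset.coe_countP] using this

theorem cnt_compactKeep (y : U) (s : ℕ) (b : Multiset U) :
    cnt y (compactKeep s b) = min s (cnt y b) := by
  have hs := Multiset.pairwise_sort b (· ≤ ·)
  have h1 := countP_drop_of_sorted y s _ hs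
  have h2 : ((b.sort (· ≤ ·)).take s ++ (b.sort (· ≤ ·)).drop s).countP (· ≤ y)
      = (b.sort (· ≤ ·)).countP (· ≤ y) := by rw [List.take_append_drop]
  rw [List.countP_append, h1, cnt_sort] at h2
  have h3 : cnt y (compactKeep s b) = ((b.sort (· ≤ ·)).take s).countP (· ≤ y) := by
    simp [cnt, compactKeep]
  have h4 := List.countP_le_length (p := fun x => decide (x ≤ y)) (l := (b.sort (· ≤ ·)).take s)
  rw [List.length_take] at h4
  omega

/-- Every other one of the `cnt y b - s` compacted items that are at most `y` moves up. If their
number is odd, the coin decides whether it is rounded up or down. -/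
theorem cnt_compactOut (y : U) (coin : Bool) (s : ℕ) (b : Multiset U) :
    cnt y (compactOut coin s b) =
      if coin then (cnt y b - s + 1) / 2 else (cnt y b - s) / 2 := by
  have hs := Multiset.pairwise_sort b (· ≤ ·)
  have hd : ((b.sort (· ≤ ·)).drop s).Pairwise (· ≤ ·) := hs.sublist (List.drop_sublist _ _)
  have h1 := countP_drop_of_sorted y s _ hs
  rw [cnt_sort] at h1
  unfold compactOut everyOther
  split_ifs
  · rw [← h1, ← countP_oddIndexed_of_sorted y _ hd]
    simp [cnt]
  · rw [← h1, ← countP_oddIndexed_tail_of_sorted y _ hd]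
    simp [cnt]

theorem card_compactKeep (s : ℕ) (b : Multiset U) :
    (compactKeep s b).card = min s b.card := by
  simp [compactKeep]

theorem card_compactOut_pos (coin : Bool) {s : ℕ} {b : Multiset U} (h : s + 2 ≤ b.card) :
    0 < (compactOut coin s b).card := by
  have h1 := le_length_oddIndexed ((b.sort (· ≤ ·)).drop s)
  have h2 := le_length_oddIndexed ((b.sort (· ≤ ·)).drop s).tail
  simp only [List.length_drop, List.length_tail, Multiset.length_sort] at h1 h2
  unfold compactOut everyOther
  split_ifs <;> simp only [Multiset.coe_card] <;> omega

end counting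

/-! ### A pass over the levels -/

/-- One pass of compactions over the levels of a sketch, from the bottom up. The levels are indexed
by all natural numbers, those that do not exist being empty. The rule says whether the compactor
of a level, after what comes from the level below has arrived, is compacted, and how many of its
smallest items are protected in this case. -/
structure Pass (U : Type u) where
  rule : ℕ → RelCompactor U → Option ℕ
  coin : ℕ → Bool
  levels : ℕ → RelCompactor U

namespace Pass

variable {U : Type u} [LinearOrder U]

/-- What a compactor sends to the next level: nothing, or the output of a compaction that protects
`s` items. -/
def output (b : Bool) (c : RelCompactor U) : Option ℕ → Multiset U
  | none => 0
  | some s => compactOut b s c.buf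

/-- What is left of a compactor, depending on the number of its protected items. -/
def rest (c : RelCompactor U) : Option ℕ → RelCompactor U
  | none => c
  | some s => ⟨compactKeep s c.buf, c.state + 1⟩

/-- Adding items to a compactor. -/
def push (c : RelCompactor U) (b : Multiset U) : RelCompactor U := ⟨c.buf + b, c.state⟩

/-- The items that arrive at level `h`, if `c₀` arrives at level `0`. -/
def carryFrom (q : Pass U) (c₀ : Multiset U) : ℕ → Multiset U
  | 0 => c₀
  | h + 1 => output (q.coin h) (push (q.levels h) (q.carryFrom c₀ h))
      (q.rule h (push (q.levels h) (q.carryFrom c₀ h)))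

/-- The compactor of level `h` after the arrivals and before its compaction. -/
def midFrom (q : Pass U) (c₀ : Multiset U) (h : ℕ) : RelCompactor U :=
  push (q.levels h) (q.carryFrom c₀ h)

/-- The compactor of level `h` after the pass. -/
def postFrom (q : Pass U) (c₀ : Multiset U) (h : ℕ) : RelCompactor U :=
  rest (q.midFrom c₀ h) (q.rule h (q.midFrom c₀ h))

/-- The part of a pass above level `0`. -/
def shift (q : Pass U) : Pass U :=
  ⟨fun h => q.rule (h + 1), fun h => q.coin (h + 1), fun h => q.levels (h + 1)⟩

theorem carryFrom_succ (q : Pass U) (c₀ : Multiset U) (h : ℕ) :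
    q.carryFrom c₀ (h + 1) = output (q.coin h) (q.midFrom c₀ h) (q.rule h (q.midFrom c₀ h)) := rfl

theorem carryFrom_shift (q : Pass U) (c₀ : Multiset U) :
    ∀ h, q.shift.carryFrom (q.carryFrom c₀ 1) h = q.carryFrom c₀ (h + 1)
  | 0 => rfl
  | h + 1 => by
    rw [carryFrom, carryFrom_shift q c₀ h]
    rfl

theorem midFrom_shift (q : Pass U) (c₀ : Multiset U) (h : ℕ) :
    q.shift.midFrom (q.carryFrom c₀ 1) h = q.midFrom c₀ (h + 1) := by
  rw [midFrom, carryFrom_shift]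
  rfl

theorem postFrom_shift (q : Pass U) (c₀ : Multiset U) (h : ℕ) :
    q.shift.postFrom (q.carryFrom c₀ 1) h = q.postFrom c₀ (h + 1) := by
  rw [postFrom, midFrom_shift]
  rfl

end Pass

namespace RCSketch

/-- The compactor of level `h` in a list of compactors, empty if there is no such level. -/
def nth {U : Type u} (L : List (RelCompactor U)) (h : ℕ) : RelCompactor U := L.getD h ⟨0, 0⟩

section passes

variable {U : Type u}

theorem nth_nil (h : ℕ) : nth ([] : List (RelCompactor U)) h = ⟨0, 0⟩ := by simp [nth]

theorem nth_cons_zero (c : RelCompactor U) (L : List (RelCompactor U)) : nth (c :: L) 0 = c := by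
  simp [nth]

theorem nth_cons_succ (c : RelCompactor U) (L : List (RelCompactor U)) (h : ℕ) :
    nth (c :: L) (h + 1) = nth L h := by
  simp [nth]

theorem nth_of_length_le {L : List (RelCompactor U)} {h : ℕ} (hh : L.length ≤ h) :
    nth L h = ⟨0, 0⟩ := by
  simp [nth, hh]

theorem nth_combine : ∀ (a b : List (RelCompactor U)) (h : ℕ),
    nth (combine a b) h = ⟨(nth a h).buf + (nth b h).buf, (nth a h).state ||| (nth b h).state⟩
  | [], b, h => by simp [combine, nth_nil]
  | c :: cs, [], h => by simp [combine, nth_nil]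
  | c :: cs, d :: ds, 0 => by simp [combine, nth_cons_zero]
  | c :: cs, d :: ds, h + 1 => by
    simp only [combine, nth_cons_succ]
    exact nth_combine cs ds h

theorem length_combine : ∀ (a b : List (RelCompactor U)),
    (combine a b).length = max a.length b.length
  | [], b => by simp [combine]
  | c :: cs, [] => by simp [combine]
  | c :: cs, d :: ds => by
    simp only [combine, List.length_cons, length_combine cs ds]
    omega

/-- The rule of the special compactions of a sketch with `len` levels in stage `i`. -/
def specialRule (P : RCSchedule) (i len : ℕ) (h : ℕ) (c : RelCompactor U) : Option ℕ :=
  if h + 1 < len ∧ P.B i / 2 < c.buf.card then some (P.B i / 2) else none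

/-- The rule of the scheduled compactions in stage `i`. -/
def scheduledRule (P : RCSchedule) (i : ℕ) (_ : ℕ) (c : RelCompactor U) : Option ℕ :=
  if P.B i ≤ c.buf.card then some (protect P i c.state) else none

theorem shift_scheduled (P : RCSchedule) (i h₀ : ℕ) (coin : ℕ → Bool)
    (L L' : ℕ → RelCompactor U) (hL : ∀ h, L (h + 1) = L' h) :
    Pass.shift ⟨scheduledRule P i, fun g => coin (h₀ + g), L⟩ =
      ⟨scheduledRule P i, fun g => coin (h₀ + 1 + g), L'⟩ := by
  simp only [Pass.shift, Pass.mk.injEq]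
  refine ⟨rfl, ?_, funext hL⟩
  funext g
  congr 1
  omega

variable [LinearOrder U]

theorem length_specialCompactions (P : RCSchedule) (i : ℕ) (coin : ℕ → Bool) :
    ∀ (L : List (RelCompactor U)) (h : ℕ) (b : Multiset U),
      (specialCompactions P i coin h b L).length = L.length
  | [], h, b => by simp [specialCompactions]
  | [c], h, b => by simp [specialCompactions]
  | c :: d :: L, h, b => by
    have ih := length_specialCompactions P i coin (d :: L)
    rw [specialCompactions]
    split_ifs <;> simp [ih]

theorem nth_specialCompactions (P : RCSchedule) (i : ℕ) (coin : ℕ → Bool) :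
    ∀ (L : List (RelCompactor U)) (h₀ : ℕ) (b : Multiset U), (L = [] → b = 0) → ∀ h,
      nth (specialCompactions P i coin h₀ b L) h =
        Pass.postFrom ⟨specialRule P i L.length, fun g => coin (h₀ + g), nth L⟩ b h
  | [], h₀, b, hb, h => by
    have key : ∀ g, Pass.carryFrom ⟨specialRule P i ([] : List (RelCompactor U)).length,
        fun g => coin (h₀ + g), nth []⟩ b g = 0 := by
      intro g
      cases g with
      | zero => exact hb rfl
      | succ g => simp [Pass.carryFrom, specialRule, Pass.output]
    rw [Pass.postFrom, Pass.midFrom, key]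
    simp [specialCompactions, nth_nil, specialRule, Pass.rest, Pass.push]
  | [c], h₀, b, _, h => by
    have key : ∀ g, Pass.carryFrom ⟨specialRule P i [c].length,
        fun g => coin (h₀ + g), nth [c]⟩ b (g + 1) = 0 := by
      intro g
      simp [Pass.carryFrom, specialRule, Pass.output]
    cases h with
    | zero =>
      simp [specialCompactions, nth_cons_zero, Pass.postFrom, Pass.midFrom, Pass.carryFrom,
        specialRule, Pass.rest, Pass.push]
    | succ h =>
      rw [Pass.postFrom, Pass.midFrom, key]
      simp [specialCompactions, nth_cons_succ, nth_nil, specialRule, Pass.rest, Pass.push]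
  | c :: d :: L, h₀, b, _, h => by
    set q : Pass U := ⟨specialRule P i (c :: d :: L).length, fun g => coin (h₀ + g),
      nth (c :: d :: L)⟩ with hq
    have hshift : q.shift = ⟨specialRule P i (d :: L).length, fun g => coin (h₀ + 1 + g),
        nth (d :: L)⟩ := by
      rw [hq]
      simp only [Pass.shift, Pass.mk.injEq]
      refine ⟨?_, ?_, ?_⟩
      · funext g e
        simp [specialRule]
      · funext g
        congr 1
        omega
      · funext g
        exact nth_cons_succ _ _ _
    have hmid : q.midFrom b 0 = ⟨c.buf + b, c.state⟩ := rfl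
    have hcoin : q.coin 0 = coin h₀ := rfl
    rw [specialCompactions]
    by_cases hc : P.B i / 2 < (c.buf + b).card
    · have hr : q.rule 0 ⟨c.buf + b, c.state⟩ = some (P.B i / 2) := by
        simp only [hq, specialRule, List.length_cons]
        rw [if_pos ⟨by omega, hc⟩]
      rw [if_pos hc]
      cases h with
      | zero => rw [nth_cons_zero, Pass.postFrom, hmid, hr]; rfl
      | succ h =>
        rw [nth_cons_succ, nth_specialCompactions P i coin (d :: L) (h₀ + 1) _ (by simp) h,
          ← hshift, ← Pass.postFrom_shift, Pass.carryFrom_succ, hmid, hr, hcoin]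
        rfl
    · have hr : q.rule 0 ⟨c.buf + b, c.state⟩ = none := by
        simp only [hq, specialRule, List.length_cons]
        rw [if_neg (fun h => hc h.2)]
      rw [if_neg hc]
      cases h with
      | zero => rw [nth_cons_zero, Pass.postFrom, hmid, hr]; rfl
      | succ h =>
        rw [nth_cons_succ, nth_specialCompactions P i coin (d :: L) (h₀ + 1) _ (by simp) h,
          ← hshift, ← Pass.postFrom_shift, Pass.carryFrom_succ, hmid, hr]
        rfl

theorem protect_add_two_le (P : RCSchedule) (i s : ℕ) : protect P i s + 2 ≤ P.B i := by
  have h1 := P.four_le_B i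
  have h2 : 2 ≤ P.k i := by
    obtain ⟨a, ha⟩ := P.k_even i
    have := P.k_pos i
    omega
  have h3 : P.k i ≤ (trailingOnes s + 1) * P.k i := Nat.le_mul_of_pos_left _ (Nat.succ_pos _)
  unfold protect
  omega

theorem openLevels_spec (P : RCSchedule) (i : ℕ) (coin : ℕ → Bool) :
    ∀ (n h₀ : ℕ) (b : Multiset U), b.card = n → ∀ h,
      nth (openLevels P i coin h₀ b) h =
        Pass.postFrom ⟨scheduledRule P i, fun g => coin (h₀ + g), nth []⟩ b h ∧
      (h + 1 < (openLevels P i coin h₀ b).length ↔ P.B i ≤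
        (Pass.midFrom ⟨scheduledRule P i, fun g => coin (h₀ + g), nth []⟩ b h).buf.card) := by
  intro n
  induction n using Nat.strong_induction_on with
  | _ n ih =>
    intro h₀ b hb h
    have h4 := P.four_le_B i
    set q : Pass U := ⟨scheduledRule P i, fun g => coin (h₀ + g), nth []⟩ with hq
    have hmid : q.midFrom b 0 = ⟨b, 0⟩ := by
      simp [Pass.midFrom, hq, Pass.push, nth_nil, Pass.carryFrom]
    have hlev : ∀ g, q.levels g = ⟨0, 0⟩ := fun g => nth_nil g
    have hempty : ∀ g, q.carryFrom b g = 0 → q.midFrom b g = ⟨0, 0⟩ := by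
      intro g hg
      simp [Pass.midFrom, hg, hlev, Pass.push]
    have hrule0 : ∀ g, q.rule g ⟨0, 0⟩ = none := by
      intro g
      simp only [hq, scheduledRule]
      rw [if_neg (by rw [Multiset.card_zero]; omega)]
    have hhalt : q.rule 0 ⟨b, 0⟩ = none → ∀ g, q.carryFrom b (g + 1) = 0 := by
      intro h0 g
      induction g with
      | zero => rw [Pass.carryFrom_succ, hmid, h0]; rfl
      | succ g ihg => rw [Pass.carryFrom_succ, hempty _ ihg, hrule0]; rfl
    rw [openLevels]
    by_cases hc0 : b.card = 0
    · have hb0 : b = 0 := Multiset.card_eq_zero.1 hc0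
      have hr : q.rule 0 ⟨b, 0⟩ = none := by rw [hb0]; exact hrule0 0
      have hall : q.carryFrom b h = 0 := by
        cases h with
        | zero => exact hb0
        | succ h => exact hhalt hr h
      rw [if_pos hc0, nth_nil, Pass.postFrom, hempty _ hall, hrule0]
      refine ⟨rfl, ?_⟩
      simp only [List.length_nil, Multiset.card_zero]
      omega
    · rw [if_neg hc0]
      by_cases hc : P.B i ≤ b.card
      · have hr : q.rule 0 ⟨b, 0⟩ = some (protect P i 0) := by
          simp only [hq, scheduledRule]
          rw [if_pos hc]
        have hlt := card_compactOut_le (coin h₀) (protect P i 0) b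
        have hpos : 0 < (compactOut (coin h₀) (protect P i 0) b).card := by
          apply card_compactOut_pos
          have := protect_add_two_le P i 0
          omega
        have hrec := ih _ (by omega) (h₀ + 1) (compactOut (coin h₀) (protect P i 0) b) rfl
        have hsh : q.shift = ⟨scheduledRule P i, fun g => coin (h₀ + 1 + g), nth []⟩ :=
          shift_scheduled P i h₀ coin _ _ (fun h => by rw [nth_nil, nth_nil])
        have hcar : q.carryFrom b 1 = compactOut (coin h₀) (protect P i 0) b := by
          rw [Pass.carryFrom_succ, hmid, hr]; rfl
        rw [if_pos hc]
        cases h with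
        | zero =>
          refine ⟨?_, ?_⟩
          · rw [nth_cons_zero, Pass.postFrom, hmid, hr]
            rfl
          · rw [hmid, List.length_cons]
            refine ⟨fun _ => hc, fun _ => ?_⟩
            rw [openLevels, if_neg (by omega)]
            split_ifs <;> simp
        | succ h =>
          obtain ⟨r1, r2⟩ := hrec h
          rw [← hsh, ← hcar] at r1 r2
          rw [Pass.postFrom_shift] at r1
          rw [Pass.midFrom_shift] at r2
          refine ⟨?_, ?_⟩
          · rw [nth_cons_succ, ← hcar, r1]
          · rw [List.length_cons, ← hcar, ← r2]
            omega
      · have hr : q.rule 0 ⟨b, 0⟩ = none := by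
          simp only [hq, scheduledRule]
          rw [if_neg hc]
        rw [if_neg hc]
        cases h with
        | zero =>
          refine ⟨?_, ?_⟩
          · rw [nth_cons_zero, Pass.postFrom, hmid, hr]
            rfl
          · rw [hmid, List.length_singleton]
            constructor
            · intro h'; omega
            · intro h'; exact absurd h' hc
        | succ h =>
          have hall := hempty _ (hhalt hr h)
          rw [Pass.postFrom, hall, hrule0, nth_cons_succ, nth_nil]
          refine ⟨rfl, ?_⟩
          simp only [List.length_singleton, Multiset.card_zero]
          omega

theorem scheduledCompactions_spec (P : RCSchedule) (i : ℕ) (coin : ℕ → Bool) :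
    ∀ (L : List (RelCompactor U)) (h₀ : ℕ) (b : Multiset U) (h : ℕ),
      nth (scheduledCompactions P i coin h₀ b L) h =
        Pass.postFrom ⟨scheduledRule P i, fun g => coin (h₀ + g), nth L⟩ b h ∧
      (h + 1 < (scheduledCompactions P i coin h₀ b L).length ↔ h + 1 < L.length ∨ P.B i ≤
        (Pass.midFrom ⟨scheduledRule P i, fun g => coin (h₀ + g), nth L⟩ b h).buf.card)
  | [], h₀, b, h => by
    rw [scheduledCompactions]
    simpa using openLevels_spec P i coin b.card h₀ b rfl h
  | c :: L, h₀, b, h => by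
    set q : Pass U := ⟨scheduledRule P i, fun g => coin (h₀ + g), nth (c :: L)⟩ with hq
    have hmid : q.midFrom b 0 = ⟨c.buf + b, c.state⟩ := rfl
    have hsh : q.shift = ⟨scheduledRule P i, fun g => coin (h₀ + 1 + g), nth L⟩ :=
      shift_scheduled P i h₀ coin _ _ (fun h => nth_cons_succ c L h)
    -- the list of the remaining levels is empty only if there is nothing left to store
    have hlen : ∀ b', 0 < (scheduledCompactions P i coin (h₀ + 1) b' L).length ↔
        0 < L.length ∨ 0 < b'.card := by
      intro b'
      cases L with
      | nil =>
        rw [scheduledCompactions, openLevels]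
        split_ifs with h1 <;> simp [h1]
        all_goals exact Nat.pos_of_ne_zero (by simpa using h1)
      | cons d L =>
        rw [scheduledCompactions]
        split_ifs <;> simp
    have hrec := scheduledCompactions_spec P i coin L (h₀ + 1) (q.carryFrom b 1)
    rw [← hsh] at hrec
    rw [scheduledCompactions]
    by_cases hc : P.B i ≤ (c.buf + b).card
    · have hr : q.rule 0 ⟨c.buf + b, c.state⟩ = some (protect P i c.state) := by
        simp only [hq, scheduledRule]
        rw [if_pos hc]
      have hcar : q.carryFrom b 1 = compactOut (coin h₀) (protect P i c.state) (c.buf + b) := by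
        rw [Pass.carryFrom_succ, hmid, hr]; rfl
      have hpos : 0 < (q.carryFrom b 1).card := by
        rw [hcar]
        apply card_compactOut_pos
        have := protect_add_two_le P i c.state
        omega
      rw [if_pos hc, ← hcar]
      cases h with
      | zero =>
        refine ⟨?_, ?_⟩
        · rw [nth_cons_zero, Pass.postFrom, hmid, hr]
          rfl
        · have h1 := (hlen (q.carryFrom b 1)).2 (Or.inr hpos)
          rw [hmid, List.length_cons]
          exact ⟨fun _ => Or.inr hc, fun _ => by omega⟩
      | succ h =>
        obtain ⟨r1, r2⟩ := hrec h
        rw [Pass.postFrom_shift] at r1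
        rw [Pass.midFrom_shift] at r2
        refine ⟨by rw [nth_cons_succ, r1], ?_⟩
        simp only [List.length_cons]
        rw [Nat.add_lt_add_iff_right, Nat.add_lt_add_iff_right]
        exact r2
    · have hr : q.rule 0 ⟨c.buf + b, c.state⟩ = none := by
        simp only [hq, scheduledRule]
        rw [if_neg hc]
      have hcar : q.carryFrom b 1 = 0 := by
        rw [Pass.carryFrom_succ, hmid, hr]; rfl
      rw [if_neg hc]
      cases h with
      | zero =>
        refine ⟨?_, ?_⟩
        · rw [nth_cons_zero, Pass.postFrom, hmid, hr]
          rfl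
        · have h1 := hlen 0
          simp only [Multiset.card_zero, lt_irrefl, or_false] at h1
          rw [hmid]
          simp only [List.length_cons]
          rw [Nat.add_lt_add_iff_right, Nat.add_lt_add_iff_right, h1]
          exact ⟨Or.inl, fun h => h.resolve_right hc⟩
      | succ h =>
        obtain ⟨r1, r2⟩ := hrec h
        rw [Pass.postFrom_shift, hcar] at r1
        rw [Pass.midFrom_shift, hcar] at r2
        refine ⟨by rw [nth_cons_succ, r1], ?_⟩
        simp only [List.length_cons]
        rw [Nat.add_lt_add_iff_right, Nat.add_lt_add_iff_right]
        exact r2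

end passes

end RCSketch

namespace Pass

variable {U : Type u} [LinearOrder U]

/-- The items that arrive at level `h` from the level below. -/
abbrev carry (q : Pass U) (h : ℕ) : Multiset U := q.carryFrom 0 h

/-- The compactor of level `h` after the arrivals and before its compaction. -/
abbrev mid (q : Pass U) (h : ℕ) : RelCompactor U := q.midFrom 0 h

/-- The compactor of level `h` after the pass. -/
abbrev post (q : Pass U) (h : ℕ) : RelCompactor U := q.postFrom 0 h

/-- The number of items at most `y` that a pass removes from level `h`. -/
def removed (q : Pass U) (y : U) (h : ℕ) : ℕ :=
  match q.rule h (q.mid h) with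
  | none => 0
  | some s => cnt y (q.mid h).buf - s

/-- The number of items at most `y` that arrive at level `h` from the level below. -/
def arrivals (q : Pass U) (y : U) (h : ℕ) : ℕ := cnt y (q.carry h)

theorem arrivals_zero (q : Pass U) (y : U) : q.arrivals y 0 = 0 := cnt_zero y

theorem cnt_mid (q : Pass U) (y : U) (h : ℕ) :
    cnt y (q.mid h).buf = cnt y (q.levels h).buf + q.arrivals y h := cnt_add _ _ _

theorem cnt_post_add_removed (q : Pass U) (y : U) (h : ℕ) :
    cnt y (q.post h).buf + q.removed y h = cnt y (q.mid h).buf := by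
  unfold removed
  rw [post, postFrom]
  rcases hr : q.rule h (q.mid h) with _ | s
  · rfl
  · change cnt y (compactKeep s (q.mid h).buf) + (cnt y (q.mid h).buf - s) = _
    rw [cnt_compactKeep]
    omega

theorem arrivals_succ (q : Pass U) (y : U) (h : ℕ) :
    q.arrivals y (h + 1) =
      if q.coin h then (q.removed y h + 1) / 2 else q.removed y h / 2 := by
  unfold arrivals removed
  rw [carry, carryFrom_succ]
  rcases hr : q.rule h (q.mid h) with _ | s
  · simp [output, cnt_zero]
  · exact cnt_compactOut _ _ _ _

theorem mem_carry {q : Pass U} {p : U → Prop} (hp : ∀ h, ∀ x ∈ (q.levels h).buf, p x) :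
    ∀ h, ∀ x ∈ q.carry h, p x
  | 0, x, hx => by simp [carry, carryFrom] at hx
  | h + 1, x, hx => by
    rw [carry, carryFrom_succ] at hx
    rcases hr : q.rule h (q.midFrom 0 h) with _ | s
    · rw [hr] at hx
      simp [output] at hx
    · rw [hr] at hx
      have h1 : x ∈ (q.levels h).buf + q.carry h := mem_of_mem_compactOut hx
      rcases Multiset.mem_add.1 h1 with h1 | h1
      · exact hp h x h1
      · exact mem_carry hp h x h1

theorem mem_mid {q : Pass U} {p : U → Prop} (hp : ∀ h, ∀ x ∈ (q.levels h).buf, p x)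
    (h : ℕ) : ∀ x ∈ (q.mid h).buf, p x := by
  intro x hx
  rcases Multiset.mem_add.1 hx with h1 | h1
  · exact hp h x h1
  · exact mem_carry hp h x h1

theorem mem_post {q : Pass U} {p : U → Prop} (hp : ∀ h, ∀ x ∈ (q.levels h).buf, p x)
    (h : ℕ) : ∀ x ∈ (q.post h).buf, p x := by
  intro x hx
  apply mem_mid hp h x
  rw [post, postFrom] at hx
  rcases hr : q.rule h (q.midFrom 0 h) with _ | s
  · rwa [hr] at hx
  · rw [hr] at hx
    exact mem_of_mem_compactKeep hx

/-- Two passes agree up to level `h` if they start from the same compactors and use the same rule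
at the levels at most `h`, and use the same coins below level `h`. -/
def AgreeUpTo (h : ℕ) (q q' : Pass U) : Prop :=
  (∀ g ≤ h, q.rule g = q'.rule g) ∧ (∀ g < h, q.coin g = q'.coin g) ∧
    ∀ g ≤ h, q.levels g = q'.levels g

theorem AgreeUpTo.carry_eq {h : ℕ} {q q' : Pass U} (hq : AgreeUpTo h q q') :
    ∀ g ≤ h, q.carry g = q'.carry g
  | 0, _ => rfl
  | g + 1, hg => by
    have ih := hq.carry_eq g (by omega)
    have hm : q.midFrom 0 g = q'.midFrom 0 g := by
      rw [midFrom, midFrom, hq.2.2 g (by omega)]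
      exact congrArg _ ih
    rw [carry, carry, carryFrom_succ, carryFrom_succ, hm, hq.1 g (by omega), hq.2.1 g (by omega)]

theorem AgreeUpTo.mid_eq {h : ℕ} {q q' : Pass U} (hq : AgreeUpTo h q q') {g : ℕ} (hg : g ≤ h) :
    q.mid g = q'.mid g := by
  rw [mid, mid, midFrom, midFrom, hq.2.2 g hg]
  exact congrArg _ (hq.carry_eq g hg)

theorem AgreeUpTo.post_eq {h : ℕ} {q q' : Pass U} (hq : AgreeUpTo h q q') {g : ℕ} (hg : g ≤ h) :
    q.post g = q'.post g := by
  have hm : q.midFrom 0 g = q'.midFrom 0 g := hq.mid_eq hg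
  rw [post, post, postFrom, postFrom, hm, hq.1 g hg]

theorem AgreeUpTo.removed_eq {h : ℕ} {q q' : Pass U} (hq : AgreeUpTo h q q') {g : ℕ}
    (hg : g ≤ h) (y : U) : q.removed y g = q'.removed y g := by
  unfold removed
  rw [hq.mid_eq hg, hq.1 g hg]

theorem AgreeUpTo.arrivals_eq {h : ℕ} {q q' : Pass U} (hq : AgreeUpTo h q q') {g : ℕ}
    (hg : g ≤ h) (y : U) : q.arrivals y g = q'.arrivals y g := by
  unfold arrivals
  rw [hq.carry_eq g hg]

end Pass

/-- A merge operation of a tree: the path from its result to the root, and its two arguments. -/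
structure MergeNode (U : Type u) where
  path : List Bool
  left : MergeTree U
  right : MergeTree U

namespace MergeTree

variable {U : Type u}

/-- The merge operations of a tree whose path to the root is `p`. -/
def nodes : List Bool → MergeTree U → List (MergeNode U)
  | _, leaf _ => []
  | p, node l r => ⟨p, l, r⟩ :: (nodes (false :: p) l ++ nodes (true :: p) r)

theorem suffix_of_mem_nodes : ∀ {t : MergeTree U} {p : List Bool} {ν : MergeNode U},
    ν ∈ nodes p t → p <:+ ν.path
  | leaf x, p, ν, h => by simp [nodes] at h
  | node l r, p, ν, h => by
    simp only [nodes, List.mem_cons, List.mem_append] at h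
    rcases h with h | h | h
    · rw [h]
    · exact (List.suffix_cons _ _).trans (suffix_of_mem_nodes h)
    · exact (List.suffix_cons _ _).trans (suffix_of_mem_nodes h)

theorem nodup_paths : ∀ (t : MergeTree U) (p : List Bool),
    ((nodes p t).map MergeNode.path).Nodup
  | leaf x, p => by simp [nodes]
  | node l r, p => by
    have hl := nodup_paths l (false :: p)
    have hr := nodup_paths r (true :: p)
    have hne : ∀ (b : Bool) (t : MergeTree U), p ∉ (nodes (b :: p) t).map MergeNode.path := by
      intro b t h
      obtain ⟨ν, hν, h1⟩ := List.mem_map.1 h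
      have := (suffix_of_mem_nodes hν).length_le
      rw [h1, List.length_cons] at this
      omega
    simp only [nodes, List.map_cons, List.map_append, List.nodup_cons, List.mem_append]
    refine ⟨fun h => h.elim (hne _ _) (hne _ _), ?_⟩
    rw [List.nodup_append]
    refine ⟨hl, hr, ?_⟩
    intro a ha b hb hab
    obtain ⟨ν, hν, rfl⟩ := List.mem_map.1 ha
    obtain ⟨ν', hν', h1⟩ := List.mem_map.1 hb
    have h2 := suffix_of_mem_nodes hν
    have h3 := suffix_of_mem_nodes hν'
    rw [h1, ← hab] at h3
    have := (List.suffix_of_suffix_length_le h2 h3 (by simp)).eq_of_length (by simp)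
    simp at this

theorem nodes_subset {t : MergeTree U} {p : List Bool} {ν : MergeNode U} (hν : ν ∈ t.nodes p) :
    t.nodes p ⊇ ν.left.nodes (false :: ν.path) ∧ t.nodes p ⊇ ν.right.nodes (true :: ν.path) := by
  induction t generalizing p with
  | leaf x => simp [nodes] at hν
  | node l r ihl ihr =>
    simp only [nodes, List.mem_cons, List.mem_append] at hν
    simp only [nodes]
    rcases hν with rfl | hν | hν
    · constructor <;> intro ν' hν' <;> simp [hν']
    · obtain ⟨h1, h2⟩ := ihl hν
      constructor <;> intro ν' hν'
      · simp [h1 hν']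
      · simp [h2 hν']
    · obtain ⟨h1, h2⟩ := ihr hν
      constructor <;> intro ν' hν'
      · simp [h1 hν']
      · simp [h2 hν']

theorem size_node (l r : MergeTree U) : (node l r).size = l.size + r.size := by
  simp [size, items]

theorem rank_node [LinearOrder U] (l r : MergeTree U) (y : U) :
    (node l r).rank y = l.rank y + r.rank y := by
  simp [rank, items]

theorem rank_le_size [LinearOrder U] (t : MergeTree U) (y : U) : t.rank y ≤ t.size :=
  List.countP_le_length

end MergeTree

namespace RCSchedule

theorem le_N_stage (P : RCSchedule) (n : ℕ) : n ≤ P.N (P.stage n) :=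
  Nat.find_spec (P.exists_le_N n)

theorem stage_mono (P : RCSchedule) {a b : ℕ} (h : a ≤ b) : P.stage a ≤ P.stage b :=
  Nat.find_min' _ (h.trans (P.le_N_stage b))

theorem lt_of_lt_stage (P : RCSchedule) {n i : ℕ} (h : i < P.stage n) : P.N i < n :=
  not_le.1 (Nat.find_min (P.exists_le_N n) h)

end RCSchedule

namespace RCSketch

variable {U : Type u} [LinearOrder U]

/-- The rule of the pass that prepares the sketch `S` for a merge in stage `i`. -/
def prepareRule (P : RCSchedule) (i : ℕ) (S : RCSketch U) : ℕ → RelCompactor U → Option ℕ :=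
  if P.stage S.n < i then specialRule P (P.stage S.n) S.levels.length else fun _ _ => none

/-- The pass that prepares the sketch `S` for a merge in stage `i`. -/
def preparePass (P : RCSchedule) (i : ℕ) (coin : ℕ → Bool) (S : RCSketch U) : Pass U :=
  ⟨prepareRule P i S, coin, nth S.levels⟩

theorem nth_prepare (P : RCSchedule) (i : ℕ) (coin : ℕ → Bool) (S : RCSketch U) (h : ℕ) :
    nth (prepare P i coin S) h = (preparePass P i coin S).post h := by
  unfold prepare preparePass prepareRule
  split_ifs with hi
  · rw [nth_specialCompactions P _ _ _ _ _ (fun _ => rfl)]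
    simp only [Nat.zero_add]
  · have key : ∀ g, Pass.carryFrom (⟨fun _ _ => none, coin, nth S.levels⟩ : Pass U) 0 g = 0 := by
      intro g
      cases g <;> rfl
    rw [Pass.post, Pass.postFrom, Pass.midFrom, key]
    simp [Pass.rest, Pass.push]

theorem length_prepare (P : RCSchedule) (i : ℕ) (coin : ℕ → Bool) (S : RCSketch U) :
    (prepare P i coin S).length = S.levels.length := by
  unfold prepare
  split_ifs
  · exact length_specialCompactions _ _ _ _ _ _
  · rfl

/-- The three passes of a merge operation: one on each of the two sketches if it has to move up to
a new stage, and the scheduled compactions of the combined sketch. -/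
def mergePass (P : RCSchedule) (coin : Fin 3 → ℕ → Bool) (S T : RCSketch U) : Fin 3 → Pass U
  | 0 => preparePass P (P.stage (S.n + T.n)) (coin 0) S
  | 1 => preparePass P (P.stage (S.n + T.n)) (coin 1) T
  | 2 => ⟨scheduledRule P (P.stage (S.n + T.n)), coin 2, fun h =>
      ⟨((preparePass P (P.stage (S.n + T.n)) (coin 0) S).post h).buf +
        ((preparePass P (P.stage (S.n + T.n)) (coin 1) T).post h).buf,
      ((preparePass P (P.stage (S.n + T.n)) (coin 0) S).post h).state |||
        ((preparePass P (P.stage (S.n + T.n)) (coin 1) T).post h).state⟩⟩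

theorem mergePass_two (P : RCSchedule) (coin : Fin 3 → ℕ → Bool) (S T : RCSketch U) :
    mergePass P coin S T 2 = ⟨scheduledRule P (P.stage (S.n + T.n)), coin 2,
      nth (combine (prepare P (P.stage (S.n + T.n)) (coin 0) S)
        (prepare P (P.stage (S.n + T.n)) (coin 1) T))⟩ := by
  rw [mergePass, Pass.mk.injEq]
  refine ⟨rfl, rfl, ?_⟩
  funext h
  rw [nth_combine, nth_prepare, nth_prepare]

theorem nth_merge (P : RCSchedule) (coin : Fin 3 → ℕ → Bool) (S T : RCSketch U) (h : ℕ) :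
    nth (merge P coin S T).levels h = (mergePass P coin S T 2).post h := by
  rw [mergePass_two, merge, (scheduledCompactions_spec P _ _ _ _ _ _).1]
  simp only [Nat.zero_add]

theorem lt_length_merge (P : RCSchedule) (coin : Fin 3 → ℕ → Bool) (S T : RCSketch U) (h : ℕ) :
    h + 1 < (merge P coin S T).levels.length ↔
      (h + 1 < S.levels.length ∨ h + 1 < T.levels.length) ∨
        P.B (P.stage (S.n + T.n)) ≤ ((mergePass P coin S T 2).mid h).buf.card := by
  rw [mergePass_two, merge, (scheduledCompactions_spec P _ _ _ _ _ _).2, length_combine,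
    length_prepare, length_prepare, lt_max_iff]
  simp only [Nat.zero_add]

theorem build_n (P : RCSchedule) (ω : Coin → Bool) :
    ∀ (t : MergeTree U) (p : List Bool), (build P ω p t).n = t.size
  | .leaf x, p => rfl
  | .node l r, p => by
    rw [MergeTree.size_node, ← build_n P ω l (false :: p), ← build_n P ω r (true :: p)]
    rfl

/-- The three passes of a merge operation in a tree. -/
def nodePass (P : RCSchedule) (ω : Coin → Bool) (ν : MergeNode U) (a : Fin 3) : Pass U :=
  mergePass P (fun a h => ω (ν.path, a, h)) (build P ω (false :: ν.path) ν.left)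
    (build P ω (true :: ν.path) ν.right) a

/-- The stage whose parameters are used in the three passes of a merge operation. -/
def nodeStage (P : RCSchedule) (ν : MergeNode U) : Fin 3 → ℕ
  | 0 => P.stage ν.left.size
  | 1 => P.stage ν.right.size
  | 2 => P.stage (ν.left.size + ν.right.size)

theorem nodePass_coin (P : RCSchedule) (ω : Coin → Bool) (ν : MergeNode U) (a : Fin 3) (h : ℕ) :
    (nodePass P ω ν a).coin h = ω (ν.path, a, h) := by
  fin_cases a <;> rfl

theorem nth_build_node (P : RCSchedule) (ω : Coin → Bool) (p : List Bool) (l r : MergeTree U)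
    (h : ℕ) : nth (build P ω p (.node l r)).levels h = (nodePass P ω ⟨p, l, r⟩ 2).post h :=
  nth_merge _ _ _ _ _

theorem nth_build_leaf_zero (P : RCSchedule) (ω : Coin → Bool) (p : List Bool) (x : U) :
    nth (build P ω p (.leaf x)).levels 0 = ⟨{x}, 0⟩ := nth_cons_zero _ _

theorem nth_build_leaf_succ (P : RCSchedule) (ω : Coin → Bool) (p : List Bool) (x : U) (h : ℕ) :
    nth (build P ω p (.leaf x)).levels (h + 1) = ⟨0, 0⟩ :=
  (nth_cons_succ _ _ _).trans (nth_nil h)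

/-! ### The levels up to `h` depend only on the coins below level `h` -/

theorem preparePass_agree {U : Type u} (P : RCSchedule) (i h : ℕ)
    {coin coin' : ℕ → Bool} {S S' : RCSketch U}
    (hn : S.n = S'.n) (hc : ∀ g < h, coin g = coin' g)
    (hS : ∀ g ≤ h, nth S.levels g = nth S'.levels g ∧
      (g + 1 < S.levels.length ↔ g + 1 < S'.levels.length)) :
    (preparePass P i coin S).AgreeUpTo h (preparePass P i coin' S') := by
  refine ⟨fun g hg => ?_, hc, fun g hg => (hS g hg).1⟩
  funext c
  simp only [preparePass, prepareRule, hn]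
  split_ifs
  · simp only [specialRule, (hS g hg).2]
  · rfl

theorem mergePass_agree (P : RCSchedule) (h : ℕ) {coin coin' : Fin 3 → ℕ → Bool}
    {S S' T T' : RCSketch U} (hSn : S.n = S'.n) (hTn : T.n = T'.n)
    (hc : ∀ a, ∀ g < h, coin a g = coin' a g)
    (hS : ∀ g ≤ h, nth S.levels g = nth S'.levels g ∧
      (g + 1 < S.levels.length ↔ g + 1 < S'.levels.length))
    (hT : ∀ g ≤ h, nth T.levels g = nth T'.levels g ∧
      (g + 1 < T.levels.length ↔ g + 1 < T'.levels.length)) (a : Fin 3) :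
    (mergePass P coin S T a).AgreeUpTo h (mergePass P coin' S' T' a) := by
  have h0 := preparePass_agree P (P.stage (S'.n + T'.n)) h hSn (hc 0) hS
  have h1 := preparePass_agree P (P.stage (S'.n + T'.n)) h hTn (hc 1) hT
  match a with
  | 0 => simpa only [mergePass, hSn, hTn] using h0
  | 1 => simpa only [mergePass, hSn, hTn] using h1
  | 2 =>
    refine ⟨fun g hg => ?_, hc 2, fun g hg => ?_⟩
    · simp only [mergePass, hSn, hTn]
    · simp only [mergePass, hSn, hTn]
      rw [h0.post_eq hg, h1.post_eq hg]

theorem build_agree (P : RCSchedule) (h : ℕ) {ω ω' : Coin → Bool} :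
    ∀ (t : MergeTree U) (p : List Bool),
      (∀ ν ∈ t.nodes p, ∀ a, ∀ g < h, ω (ν.path, a, g) = ω' (ν.path, a, g)) →
      ∀ g ≤ h, nth (build P ω p t).levels g = nth (build P ω' p t).levels g ∧
        (g + 1 < (build P ω p t).levels.length ↔ g + 1 < (build P ω' p t).levels.length)
  | .leaf x, p, _, g, _ => ⟨rfl, Iff.rfl⟩
  | .node l r, p, hω, g, hg => by
    have hl := build_agree P h l (false :: p) (fun ν hν => hω ν (by simp [MergeTree.nodes, hν]))
    have hr := build_agree P h r (true :: p) (fun ν hν => hω ν (by simp [MergeTree.nodes, hν]))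
    have h2 := mergePass_agree P h (coin := fun a g => ω (p, a, g))
      (coin' := fun a g => ω' (p, a, g)) (by rw [build_n, build_n]) (by rw [build_n, build_n])
      (fun a g hg => hω ⟨p, l, r⟩ (by simp [MergeTree.nodes]) a g hg) hl hr 2
    refine ⟨?_, ?_⟩
    · rw [build, build, nth_merge, nth_merge]
      exact h2.post_eq hg
    · rw [build, build, lt_length_merge, lt_length_merge, (hl g hg).2, (hr g hg).2,
        h2.mid_eq hg]
      simp only [build_n]

/-- What happens at level `h` is determined by the coins of the lower levels: a coin of level `h`
only decides what goes up to level `h + 1`. -/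
theorem nodePass_agree (P : RCSchedule) (h : ℕ) {ω ω' : Coin → Bool} {t : MergeTree U}
    {p : List Bool}
    (hω : ∀ ν ∈ t.nodes p, ∀ a, ∀ g < h, ω (ν.path, a, g) = ω' (ν.path, a, g))
    {ν : MergeNode U} (hν : ν ∈ t.nodes p) (a : Fin 3) :
    (nodePass P ω ν a).AgreeUpTo h (nodePass P ω' ν a) := by
  obtain ⟨h1, h2⟩ := MergeTree.nodes_subset hν
  exact mergePass_agree P h (by rw [build_n, build_n]) (by rw [build_n, build_n])
    (fun a g hg => hω ν hν a g hg) (build_agree P h _ _ fun ν' hν' => hω ν' (h1 hν'))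
    (build_agree P h _ _ fun ν' hν' => hω ν' (h2 hν')) a

/-! ### Only input items are stored -/

theorem mem_mergePass {p : U → Prop} (P : RCSchedule) (coin : Fin 3 → ℕ → Bool) {S T : RCSketch U}
    (hS : ∀ h, ∀ x ∈ (nth S.levels h).buf, p x) (hT : ∀ h, ∀ x ∈ (nth T.levels h).buf, p x)
    (a : Fin 3) (h : ℕ) : ∀ x ∈ ((mergePass P coin S T a).levels h).buf, p x := by
  match a with
  | 0 => exact hS h
  | 1 => exact hT h
  | 2 =>
    intro x hx
    rcases Multiset.mem_add.1 hx with hx | hx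
    · exact Pass.mem_post (q := preparePass P _ _ S) hS h x hx
    · exact Pass.mem_post (q := preparePass P _ _ T) hT h x hx

theorem mem_build (P : RCSchedule) (ω : Coin → Bool) :
    ∀ (t : MergeTree U) (p : List Bool) (h : ℕ),
      ∀ x ∈ (nth (build P ω p t).levels h).buf, x ∈ t.items
  | .leaf x, p, 0 => by simp [nth_build_leaf_zero, MergeTree.items]
  | .leaf x, p, h + 1 => by simp [nth_build_leaf_succ]
  | .node l r, p, h => by
    rw [nth_build_node]
    apply Pass.mem_post
    apply mem_mergePass
    · intro h x hx
      exact List.mem_append_left _ (mem_build P ω l _ h x hx)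
    · intro h x hx
      exact List.mem_append_right _ (mem_build P ω r _ h x hx)

theorem mem_mid_nodePass (P : RCSchedule) (ω : Coin → Bool) (ν : MergeNode U) (a : Fin 3) (h : ℕ) :
    ∀ x ∈ ((nodePass P ω ν a).mid h).buf, x ∈ ν.left.items ++ ν.right.items := by
  apply Pass.mem_mid
  apply mem_mergePass
  · intro h x hx
    exact List.mem_append_left _ (mem_build P ω _ _ h x hx)
  · intro h x hx
    exact List.mem_append_right _ (mem_build P ω _ _ h x hx)

theorem exists_nth_of_mem {U : Type u} {L : List (RelCompactor U)} {c : RelCompactor U}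
    (hc : c ∈ L) :
    ∃ h < L.length, nth L h = c := by
  obtain ⟨h, hh, rfl⟩ := List.mem_iff_getElem.1 hc
  exact ⟨h, hh, by simp [nth, hh]⟩

theorem estimate_eq_sum (S : RCSketch U) (y : U) {H : ℕ} (hH : S.levels.length ≤ H) :
    S.estimate y = ∑ h ∈ Finset.range H, 2 ^ h * cnt y (nth S.levels h).buf := by
  have key : ∀ (L : List (RelCompactor U)) (k : ℕ),
      (L.mapIdx fun h c => 2 ^ (h + k) * c.buf.countP (· ≤ y)).sum =
        ∑ h ∈ Finset.range L.length, 2 ^ (h + k) * cnt y (nth L h).buf := by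
    intro L
    induction L with
    | nil => intro k; simp
    | cons c L ih =>
      intro k
      rw [List.mapIdx_cons, List.sum_cons, List.length_cons, Finset.sum_range_succ', add_comm]
      have := ih (k + 1)
      simp only [nth_cons_succ, nth_cons_zero, add_right_comm _ 1 k]
      simp only [← add_assoc] at this
      rw [this]
      rfl
  have h1 := key S.levels 0
  simp only [add_zero] at h1
  rw [estimate, h1]
  apply Finset.sum_subset (Finset.range_mono hH)
  intro h _ hh
  rw [nth_of_length_le (by simpa using hh), cnt_zero, mul_zero]

end RCSketch

/-! ### Renaming the items -/

section Renaming

variable {U V : Type u}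

theorem oddIndexed_map (f : U → V) : ∀ l : List U, oddIndexed (l.map f) = (oddIndexed l).map f
  | [] => rfl
  | [x] => rfl
  | x :: y :: l => by simp [oddIndexed, oddIndexed_map f l]

theorem everyOther_map (f : U → V) (b : Bool) (l : List U) :
    everyOther b (l.map f) = (everyOther b l).map f := by
  unfold everyOther
  rw [← List.map_tail, oddIndexed_map, oddIndexed_map]
  split_ifs <;> rfl

/-- Renaming the items of a list of compactors. -/
def mapLevels (f : U → V) (L : List (RelCompactor U)) : List (RelCompactor V) :=
  L.map fun c => ⟨c.buf.map f, c.state⟩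

theorem combine_map (f : U → V) : ∀ a b : List (RelCompactor U),
    RCSketch.combine (mapLevels f a) (mapLevels f b) = mapLevels f (RCSketch.combine a b)
  | [], b => by simp [mapLevels, RCSketch.combine]
  | c :: cs, [] => by simp [mapLevels, RCSketch.combine]
  | c :: cs, d :: ds => by
    have ih := combine_map f cs ds
    simp only [mapLevels] at ih ⊢
    simp [RCSketch.combine, ih]

variable [LinearOrder U] [LinearOrder V] {f : U → V}

theorem sort_map_of_strictMono (hf : StrictMono f) (b : Multiset U) :
    (b.map f).sort (· ≤ ·) = (b.sort (· ≤ ·)).map f :=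
  (Multiset.map_sort (f := f) b (· ≤ ·) (· ≤ ·) fun _ _ _ _ => hf.le_iff_le.symm).symm

theorem compactKeep_map (hf : StrictMono f) (s : ℕ) (b : Multiset U) :
    compactKeep s (b.map f) = (compactKeep s b).map f := by
  simp [compactKeep, sort_map_of_strictMono hf, List.map_take]

theorem compactOut_map (hf : StrictMono f) (coin : Bool) (s : ℕ) (b : Multiset U) :
    compactOut coin s (b.map f) = (compactOut coin s b).map f := by
  rw [compactOut, sort_map_of_strictMono hf, ← List.map_drop, everyOther_map]
  rfl

theorem specialCompactions_map (hf : StrictMono f) (P : RCSchedule) (i : ℕ) (coin : ℕ → Bool) :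
    ∀ (L : List (RelCompactor U)) (h : ℕ) (b : Multiset U),
      RCSketch.specialCompactions P i coin h (b.map f) (mapLevels f L) =
        mapLevels f (RCSketch.specialCompactions P i coin h b L)
  | [], h, b => rfl
  | [c], h, b => by simp [mapLevels, RCSketch.specialCompactions]
  | c :: d :: L, h, b => by
    have ih := specialCompactions_map hf P i coin (d :: L) (h + 1)
    have ih0 := ih 0
    rw [Multiset.map_zero] at ih0
    simp only [mapLevels, List.map_cons] at ih ih0 ⊢
    rw [RCSketch.specialCompactions, RCSketch.specialCompactions]
    simp only [← Multiset.map_add, Multiset.card_map, compactKeep_map hf, compactOut_map hf, ih,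
      ih0]
    split_ifs <;> simp

theorem openLevels_map (hf : StrictMono f) (P : RCSchedule) (i : ℕ) (coin : ℕ → Bool) :
    ∀ (n h : ℕ) (b : Multiset U), b.card = n →
      RCSketch.openLevels P i coin h (b.map f) =
        mapLevels f (RCSketch.openLevels P i coin h b) := by
  intro n
  induction n using Nat.strong_induction_on with
  | _ n ih =>
    intro h b hb
    have h4 := P.four_le_B i
    have hlt := card_compactOut_le (coin h) (RCSketch.protect P i 0) b
    rw [RCSketch.openLevels.eq_1 P i coin h (b.map f), RCSketch.openLevels.eq_1 P i coin h b]
    simp only [Multiset.card_map, compactKeep_map hf, compactOut_map hf]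
    split_ifs with h1 h2
    · rfl
    · rw [ih _ (by omega) (h + 1) _ rfl]
      rfl
    · rfl

theorem scheduledCompactions_map (hf : StrictMono f) (P : RCSchedule) (i : ℕ) (coin : ℕ → Bool) :
    ∀ (L : List (RelCompactor U)) (h : ℕ) (b : Multiset U),
      RCSketch.scheduledCompactions P i coin h (b.map f) (mapLevels f L) =
        mapLevels f (RCSketch.scheduledCompactions P i coin h b L)
  | [], h, b => by
    rw [RCSketch.scheduledCompactions]
    exact openLevels_map hf P i coin _ h b rfl
  | c :: L, h, b => by
    have ih := scheduledCompactions_map hf P i coin L (h + 1)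
    have ih0 := ih 0
    rw [Multiset.map_zero] at ih0
    simp only [mapLevels, List.map_cons] at ih ih0 ⊢
    rw [RCSketch.scheduledCompactions, RCSketch.scheduledCompactions]
    simp only [← Multiset.map_add, Multiset.card_map, compactKeep_map hf, compactOut_map hf, ih,
      ih0]
    split_ifs <;> simp

theorem prepare_map (hf : StrictMono f) (P : RCSchedule) (i : ℕ) (coin : ℕ → Bool)
    (S : RCSketch U) :
    RCSketch.prepare P i coin (S.map f) = mapLevels f (RCSketch.prepare P i coin S) := by
  unfold RCSketch.prepare
  have := specialCompactions_map hf P (P.stage S.n) coin S.levels 0 0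
  rw [Multiset.map_zero] at this
  split_ifs with h1 h2 h2
  · exact this
  · exact absurd h1 h2
  · exact absurd h2 h1
  · rfl

theorem merge_map (hf : StrictMono f) (P : RCSchedule) (coin : Fin 3 → ℕ → Bool)
    (S T : RCSketch U) :
    RCSketch.merge P coin (S.map f) (T.map f) = (RCSketch.merge P coin S T).map f := by
  unfold RCSketch.merge
  have := scheduledCompactions_map hf P (P.stage (S.n + T.n)) (coin 2)
    (RCSketch.combine (RCSketch.prepare P (P.stage (S.n + T.n)) (coin 0) S)
        (RCSketch.prepare P (P.stage (S.n + T.n)) (coin 1) T)) 0 0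
  rw [Multiset.map_zero, ← combine_map, ← prepare_map hf, ← prepare_map hf] at this
  ext1
  · rfl
  · exact this

theorem build_map (hf : StrictMono f) (P : RCSchedule) (ω : Coin → Bool) :
    ∀ (t : MergeTree U) (p : List Bool),
    RCSketch.build P ω p (t.map f) = (RCSketch.build P ω p t).map f
  | .leaf x, p => by simp [MergeTree.map, RCSketch.build, RCSketch.single, RCSketch.map]
  | .node l r, p => by
    rw [MergeTree.map, RCSketch.build, RCSketch.build, build_map hf P ω l, build_map hf P ω r,
      merge_map hf]

end Renaming

/-! ### Sums over all passes -/

namespace MergeTree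

variable {U : Type u}

/-- The sum of a quantity over all passes of all merge operations of a tree. -/
def passSum (t : MergeTree U) (p : List Bool) (f : MergeNode U → Fin 3 → ℝ) : ℝ :=
  ((t.nodes p).map fun ν => ∑ a, f ν a).sum

theorem passSum_leaf (x : U) (p : List Bool) (f : MergeNode U → Fin 3 → ℝ) :
    (leaf x).passSum p f = 0 := by simp [passSum, nodes]

theorem passSum_node (l r : MergeTree U) (p : List Bool) (f : MergeNode U → Fin 3 → ℝ) :
    (node l r).passSum p f = f ⟨p, l, r⟩ 0 + f ⟨p, l, r⟩ 1 + f ⟨p, l, r⟩ 2 +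
      l.passSum (false :: p) f + r.passSum (true :: p) f := by
  simp only [passSum, nodes, List.map_cons, List.map_append, List.sum_cons, List.sum_append,
    Fin.sum_univ_three]
  ring

open scoped Classical in
theorem passSum_eq_sum (t : MergeTree U) (p : List Bool) (f : MergeNode U → Fin 3 → ℝ) :
    t.passSum p f = ∑ x ∈ (t.nodes p).toFinset, ∑ a, f x a := by
  rw [List.sum_toFinset]
  · rfl
  · exact (t.nodup_paths p).of_map _

theorem passSum_congr {t : MergeTree U} {p : List Bool} {f g : MergeNode U → Fin 3 → ℝ}
    (h : ∀ ν ∈ t.nodes p, ∀ a, f ν a = g ν a) : t.passSum p f = t.passSum p g := by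
  unfold passSum
  congr 1
  exact List.map_congr_left fun ν hν => Finset.sum_congr rfl fun a _ => h ν hν a

theorem passSum_le {t : MergeTree U} {p : List Bool} {f g : MergeNode U → Fin 3 → ℝ}
    (h : ∀ ν ∈ t.nodes p, ∀ a, f ν a ≤ g ν a) : t.passSum p f ≤ t.passSum p g :=
  List.sum_le_sum fun ν hν => Finset.sum_le_sum fun a _ => h ν hν a

theorem passSum_nonneg {t : MergeTree U} {p : List Bool} {f : MergeNode U → Fin 3 → ℝ}
    (h : ∀ ν ∈ t.nodes p, ∀ a, 0 ≤ f ν a) : 0 ≤ t.passSum p f := by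
  refine List.sum_nonneg fun x hx => ?_
  obtain ⟨ν, hν, rfl⟩ := List.mem_map.1 hx
  exact Finset.sum_nonneg fun a _ => h ν hν a

theorem passSum_add (t : MergeTree U) (p : List Bool) (f g : MergeNode U → Fin 3 → ℝ) :
    t.passSum p (fun ν a => f ν a + g ν a) = t.passSum p f + t.passSum p g := by
  simp only [passSum_eq_sum, Finset.sum_add_distrib]

theorem passSum_mul_left (t : MergeTree U) (p : List Bool) (c : ℝ)
    (f : MergeNode U → Fin 3 → ℝ) :
    t.passSum p (fun ν a => c * f ν a) = c * t.passSum p f := by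
  simp only [passSum_eq_sum, Finset.mul_sum]

end MergeTree

/-- The sign of the rounding error that a coin makes. -/
def sgn (b : Bool) : ℝ := if b then 1 else -1

/-- `1` for odd numbers and `0` for even numbers. -/
def oddInd (r : ℕ) : ℝ := if Odd r then 1 else 0

theorem Pass.two_mul_arrivals_succ {U : Type u} [LinearOrder U] (q : Pass U) (y : U) (h : ℕ) :
    2 * (q.arrivals y (h + 1) : ℝ) = q.removed y h + sgn (q.coin h) * oddInd (q.removed y h) := by
  rw [q.arrivals_succ]
  unfold sgn oddInd
  rcases Nat.even_or_odd (q.removed y h) with ho | ho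
  · have h0 : ¬ Odd (q.removed y h) := Nat.not_odd_iff_even.2 ho
    obtain ⟨a, ha⟩ := ho
    have h1 : (q.removed y h + 1) / 2 = a := by omega
    have h2 : q.removed y h / 2 = a := by omega
    rw [h1, h2, ite_self, if_neg h0, ha]
    push_cast
    ring
  · rw [if_pos ho]
    obtain ⟨a, ha⟩ := ho
    have h1 : (q.removed y h + 1) / 2 = a + 1 := by omega
    have h2 : q.removed y h / 2 = a := by omega
    rw [h1, h2, ha]
    split_ifs <;> push_cast <;> ring

theorem Pass.arrivals_succ_le {U : Type u} [LinearOrder U] (q : Pass U) (y : U) (h : ℕ) :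
    q.arrivals y (h + 1) ≤ q.removed y h := by
  rw [q.arrivals_succ]
  split_ifs <;> omega

namespace RCSketch

variable {U : Type u} [LinearOrder U]

/-- The number of items at most `y` that are stored at level `h` in the end. -/
def stored (P : RCSchedule) (ω : Coin → Bool) (p : List Bool) (t : MergeTree U) (y : U) (h : ℕ) :
    ℕ := cnt y (nth (build P ω p t).levels h).buf

/-- The number of items at most `y` that ever arrive at level `h`. -/
def arrived (P : RCSchedule) (ω : Coin → Bool) (p : List Bool) (t : MergeTree U) (y : U) (h : ℕ) :
    ℝ := (if h = 0 then (t.rank y : ℝ) else 0) +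
      t.passSum p fun ν a => (nodePass P ω ν a).arrivals y h

/-- The number of items at most `y` that are ever removed from level `h`. -/
def removedTotal (P : RCSchedule) (ω : Coin → Bool) (p : List Bool) (t : MergeTree U) (y : U)
    (h : ℕ) : ℝ := t.passSum p fun ν a => (nodePass P ω ν a).removed y h

/-- The sum of the rounding errors that are made when items at most `y` leave level `h`. -/
def noise (P : RCSchedule) (ω : Coin → Bool) (p : List Bool) (t : MergeTree U) (y : U) (h : ℕ) :
    ℝ := t.passSum p fun ν a =>
      sgn (ω (ν.path, a, h)) * oddInd ((nodePass P ω ν a).removed y h)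

variable (P : RCSchedule) (ω : Coin → Bool) (y : U) (h : ℕ)

theorem removedTotal_nonneg (p : List Bool) (t : MergeTree U) : 0 ≤ removedTotal P ω p t y h :=
  MergeTree.passSum_nonneg fun _ _ _ => Nat.cast_nonneg _

theorem cnt_prepared_left (p : List Bool) (l r : MergeTree U) :
    (cnt y ((nodePass P ω ⟨p, l, r⟩ 0).post h).buf : ℝ) + (nodePass P ω ⟨p, l, r⟩ 0).removed y h =
      stored P ω (false :: p) l y h + (nodePass P ω ⟨p, l, r⟩ 0).arrivals y h := by
  have h1 := (nodePass P ω ⟨p, l, r⟩ 0).cnt_post_add_removed y h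
  rw [Pass.cnt_mid] at h1
  exact_mod_cast h1

theorem cnt_prepared_right (p : List Bool) (l r : MergeTree U) :
    (cnt y ((nodePass P ω ⟨p, l, r⟩ 1).post h).buf : ℝ) + (nodePass P ω ⟨p, l, r⟩ 1).removed y h =
      stored P ω (true :: p) r y h + (nodePass P ω ⟨p, l, r⟩ 1).arrivals y h := by
  have h1 := (nodePass P ω ⟨p, l, r⟩ 1).cnt_post_add_removed y h
  rw [Pass.cnt_mid] at h1
  exact_mod_cast h1

theorem cnt_mid_merged (p : List Bool) (l r : MergeTree U) :
    cnt y ((nodePass P ω ⟨p, l, r⟩ 2).mid h).buf =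
      cnt y ((nodePass P ω ⟨p, l, r⟩ 0).post h).buf +
      cnt y ((nodePass P ω ⟨p, l, r⟩ 1).post h).buf +
        (nodePass P ω ⟨p, l, r⟩ 2).arrivals y h := by
  rw [Pass.cnt_mid]
  congr 1
  exact cnt_add _ _ _

theorem stored_node (p : List Bool) (l r : MergeTree U) :
    (stored P ω p (.node l r) y h : ℝ) + (nodePass P ω ⟨p, l, r⟩ 2).removed y h =
      cnt y ((nodePass P ω ⟨p, l, r⟩ 2).mid h).buf := by
  have h1 := (nodePass P ω ⟨p, l, r⟩ 2).cnt_post_add_removed y h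
  rw [stored, nth_build_node]
  exact_mod_cast h1

theorem arrived_leaf (p : List Bool) (x : U) :
    arrived P ω p (.leaf x) y h = if h = 0 then ((MergeTree.leaf x).rank y : ℝ) else 0 := by
  rw [arrived, MergeTree.passSum_leaf, add_zero]

theorem arrived_node (p : List Bool) (l r : MergeTree U) :
    arrived P ω p (.node l r) y h = arrived P ω (false :: p) l y h +
      arrived P ω (true :: p) r y h + (nodePass P ω ⟨p, l, r⟩ 0).arrivals y h +
      (nodePass P ω ⟨p, l, r⟩ 1).arrivals y h + (nodePass P ω ⟨p, l, r⟩ 2).arrivals y h := by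
  simp only [arrived, MergeTree.passSum_node, MergeTree.rank_node]
  push_cast
  split_ifs <;> ring

theorem stored_leaf (p : List Bool) (x : U) :
    (stored P ω p (.leaf x) y h : ℝ) = if h = 0 then ((MergeTree.leaf x).rank y : ℝ) else 0 := by
  cases h with
  | zero =>
    rw [stored, nth_build_leaf_zero, if_pos rfl]
    by_cases hx : x ≤ y <;>
      simp [cnt, MergeTree.rank, MergeTree.items, hx, ← Multiset.cons_zero]
  | succ h =>
    rw [stored, nth_build_leaf_succ, cnt_zero]
    simp

/-- What has arrived at a level has been removed or is still there. -/
theorem arrived_eq (t : MergeTree U) (p : List Bool) :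
    arrived P ω p t y h = stored P ω p t y h + removedTotal P ω p t y h := by
  induction t generalizing p with
  | leaf x => rw [arrived_leaf, stored_leaf, removedTotal, MergeTree.passSum_leaf, add_zero]
  | node l r ihl ihr =>
    have h0 := cnt_prepared_left P ω y h p l r
    have h1 := cnt_prepared_right P ω y h p l r
    have h2 := stored_node P ω y h p l r
    rw [cnt_mid_merged] at h2
    push_cast at h2
    rw [arrived_node, removedTotal, MergeTree.passSum_node]
    have e1 := ihl (false :: p)
    have e2 := ihr (true :: p)
    rw [removedTotal] at e1 e2
    linarith

theorem arrived_nonneg (t : MergeTree U) (p : List Bool) : 0 ≤ arrived P ω p t y h := by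
  rw [arrived_eq]
  have := removedTotal_nonneg P ω y h p t
  positivity

theorem arrived_le_node (p : List Bool) (l r : MergeTree U) :
    arrived P ω (false :: p) l y h ≤ arrived P ω p (.node l r) y h ∧
      arrived P ω (true :: p) r y h ≤ arrived P ω p (.node l r) y h := by
  rw [arrived_node]
  have h1 := arrived_nonneg P ω y h l (false :: p)
  have h2 := arrived_nonneg P ω y h r (true :: p)
  constructor <;> linarith [Nat.cast_nonneg (α := ℝ) ((nodePass P ω ⟨p, l, r⟩ 0).arrivals y h),
    Nat.cast_nonneg (α := ℝ) ((nodePass P ω ⟨p, l, r⟩ 1).arrivals y h),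
    Nat.cast_nonneg (α := ℝ) ((nodePass P ω ⟨p, l, r⟩ 2).arrivals y h)]

/-- Half of what is removed from a level arrives at the next one, up to the rounding errors. -/
theorem two_mul_arrived_succ (t : MergeTree U) (p : List Bool) :
    2 * arrived P ω p t y (h + 1) = removedTotal P ω p t y h + noise P ω p t y h := by
  rw [arrived, if_neg (Nat.succ_ne_zero h), zero_add, ← MergeTree.passSum_mul_left, removedTotal,
    noise, ← MergeTree.passSum_add]
  refine MergeTree.passSum_congr fun ν _ a => ?_
  rw [Pass.two_mul_arrivals_succ, nodePass_coin]

theorem arrived_succ_le (t : MergeTree U) (p : List Bool) :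
    arrived P ω p t y (h + 1) ≤ arrived P ω p t y h := by
  have h1 : arrived P ω p t y (h + 1) ≤ removedTotal P ω p t y h := by
    rw [arrived, if_neg (Nat.succ_ne_zero h), zero_add, removedTotal]
    exact MergeTree.passSum_le fun ν _ a => Nat.cast_le.2 (Pass.arrivals_succ_le _ _ _)
  have h2 := arrived_eq P ω y h t p
  have h3 : (0 : ℝ) ≤ stored P ω p t y h := Nat.cast_nonneg _
  linarith

theorem arrived_antitone (t : MergeTree U) (p : List Bool) :
    Antitone (arrived P ω p t y) :=
  antitone_nat_of_succ_le fun h => arrived_succ_le P ω y h t p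

theorem arrived_zero (t : MergeTree U) (p : List Bool) : arrived P ω p t y 0 = t.rank y := by
  rw [arrived, if_pos rfl, add_eq_left]
  exact (MergeTree.passSum_congr fun ν _ a => by rw [Pass.arrivals_zero, Nat.cast_zero]).trans
    (by simp [MergeTree.passSum])

theorem sum_stored_add (t : MergeTree U) (p : List Bool) (H : ℕ) :
    ∑ h ∈ Finset.range H, (2 : ℝ) ^ h * stored P ω p t y h + 2 ^ H * arrived P ω p t y H =
      t.rank y + ∑ h ∈ Finset.range H, (2 : ℝ) ^ h * noise P ω p t y h := by
  induction H with
  | zero => simp [arrived_zero]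
  | succ H ih =>
    rw [Finset.sum_range_succ, Finset.sum_range_succ]
    have h1 := two_mul_arrived_succ P ω y H t p
    have h2 := arrived_eq P ω y H t p
    have h3 : (2 : ℝ) ^ (H + 1) * arrived P ω p t y (H + 1) =
        2 ^ H * (arrived P ω p t y H - stored P ω p t y H + noise P ω p t y H) := by
      rw [pow_succ, mul_assoc, h1, h2]
      ring
    rw [h3]
    linarith

/-- If no item at most `y` reaches level `H`, then the error of the estimated rank is the sum of
the rounding errors, weighted with the weight of an item of their level. -/
theorem estimate_eq (t : MergeTree U) (p : List Bool) {H : ℕ} (hH : arrived P ω p t y H ≤ 0) :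
    ((build P ω p t).estimate y : ℝ) =
      t.rank y + ∑ h ∈ Finset.range H, (2 : ℝ) ^ h * noise P ω p t y h := by
  have h0 : ∀ h, H ≤ h → (stored P ω p t y h : ℝ) = 0 := by
    intro h hh
    have h1 := arrived_antitone P ω y t p hh
    have h2 := arrived_eq P ω y h t p
    have h3 := removedTotal_nonneg P ω y h p t
    have h4 : (0 : ℝ) ≤ stored P ω p t y h := Nat.cast_nonneg _
    linarith
  rw [estimate_eq_sum _ y (le_max_left _ H), ← sum_stored_add,
    le_antisymm hH (arrived_nonneg P ω y H t p), mul_zero, add_zero]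
  push_cast
  symm
  apply Finset.sum_subset (Finset.range_mono (le_max_right _ _))
  intro h _ hh
  rw [h0 h (by simpa using hh), mul_zero]

theorem estimate_eq_zero (t : MergeTree U) (p : List Bool) (hy : t.rank y = 0) :
    (build P ω p t).estimate y = 0 := by
  have h1 := estimate_eq P ω y t p (H := 0) (by rw [arrived_zero, hy, Nat.cast_zero])
  rw [hy, Finset.range_zero, Finset.sum_empty, Nat.cast_zero, add_zero] at h1
  exact_mod_cast h1

end RCSketch

/-! ### Counting compactions -/

/-- What the analysis needs to know about the parameters. The number `J i` bounds the number of
bits of the states in stage `i`. -/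
structure RCSchedule.Adequate (P : RCSchedule) (J : ℕ → ℕ) : Prop where
  antitone_k : Antitone P.k
  two_mul_B_le : ∀ i, 2 * P.B i ≤ P.B (i + 1)
  sixteen_le_m : 16 ≤ P.m 0
  four_mul_J_le : ∀ i, 4 * (J i + 1) ≤ P.m i
  N_lt : ∀ i, 9 * P.N i < 8 * P.k i * 2 ^ J i

namespace RCSchedule

theorem two_le_k (P : RCSchedule) (i : ℕ) : 2 ≤ P.k i := by
  obtain ⟨a, ha⟩ := P.k_even i
  have := P.k_pos i
  omega

theorem B_pos (P : RCSchedule) (i : ℕ) : (0 : ℝ) < P.B i := by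
  have := P.four_le_B i
  exact_mod_cast (by omega : 0 < P.B i)

theorem half_B (P : RCSchedule) (i : ℕ) : P.B i / 2 = P.k i * P.m i := by
  unfold B
  rw [mul_assoc, Nat.mul_div_cancel_left _ (by norm_num)]

theorem half_B_real (P : RCSchedule) (i : ℕ) : ((P.B i / 2 : ℕ) : ℝ) = P.B i / 2 := by
  rw [half_B, B]
  push_cast
  ring

/-- A bound for the number of special compactions per arriving item before stage `i`. -/
noncomputable def specialRate (P : RCSchedule) (i : ℕ) : ℝ :=
  ∑ j ∈ Finset.range i, 2 / (P.B j : ℝ)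

theorem specialRate_nonneg (P : RCSchedule) (i : ℕ) : 0 ≤ P.specialRate i :=
  Finset.sum_nonneg fun j _ => by positivity

theorem specialRate_add_le (P : RCSchedule) {i j : ℕ} (h : j < i) :
    P.specialRate j + 2 / P.B j ≤ P.specialRate i := by
  rw [specialRate, ← Finset.sum_range_succ (fun j => 2 / (P.B j : ℝ))]
  exact Finset.sum_le_sum_of_subset_of_nonneg (Finset.range_mono h) fun j _ _ => by positivity

theorem specialRate_mono (P : RCSchedule) : Monotone P.specialRate := fun _ _ h =>
  Finset.sum_le_sum_of_subset_of_nonneg (Finset.range_mono h) fun j _ _ => by positivity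

variable {P : RCSchedule} {J : ℕ → ℕ}

theorem Adequate.strictMono_B (hP : P.Adequate J) : StrictMono P.B :=
  strictMono_nat_of_lt_succ fun i => by
    have := hP.two_mul_B_le i
    have := P.four_le_B i
    omega

theorem Adequate.two_mul_B_le_of_lt (hP : P.Adequate J) {i j : ℕ} (h : j < i) :
    2 * P.B j ≤ P.B i :=
  (hP.two_mul_B_le j).trans (hP.strictMono_B.monotone h)

theorem Adequate.specialRate_le (hP : P.Adequate J) (i : ℕ) :
    P.specialRate i ≤ 1 / (8 * P.k i) := by
  have key : P.specialRate i ≤ 4 / P.B 0 - 4 / P.B i := by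
    induction i with
    | zero => simp [specialRate]
    | succ i ih =>
      rw [specialRate, Finset.sum_range_succ, ← specialRate]
      have h1 := P.B_pos i
      have h2 := P.B_pos (i + 1)
      have h3 : (4 : ℝ) / P.B (i + 1) ≤ 2 / P.B i := by
        rw [div_le_div_iff₀ h2 h1]
        have : (2 * P.B i : ℝ) ≤ P.B (i + 1) := by exact_mod_cast hP.two_mul_B_le i
        linarith
      have h4 : (4 : ℝ) / P.B i = 2 / P.B i + 2 / P.B i := by ring
      linarith
  have h1 : (0 : ℝ) < P.k i := by exact_mod_cast P.k_pos i
  have h2 : (P.k i : ℝ) ≤ P.k 0 := by exact_mod_cast hP.antitone_k (Nat.zero_le i)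
  have h3 : (16 : ℝ) ≤ P.m 0 := by exact_mod_cast hP.sixteen_le_m
  have h4 : (32 : ℝ) * P.k i ≤ P.B 0 := by
    rw [B]
    push_cast
    nlinarith
  have h5 : (4 : ℝ) / P.B 0 ≤ 1 / (8 * P.k i) := by
    rw [div_le_div_iff₀ (P.B_pos 0) (by positivity)]
    linarith
  have h6 : (0 : ℝ) ≤ 4 / P.B i := by positivity
  linarith

end RCSchedule

namespace Pass

variable {U : Type u} [LinearOrder U]

/-- `1` if the pass compacts level `h`, and `0` otherwise. -/
def active (q : Pass U) (h : ℕ) : ℕ := if (q.rule h (q.mid h)).isSome then 1 else 0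

theorem state_post (q : Pass U) (h : ℕ) :
    (q.post h).state = (q.levels h).state + q.active h := by
  unfold active
  rw [post, postFrom]
  rcases hr : q.rule h (q.mid h) with _ | s <;> rfl

theorem removed_eq_zero {q : Pass U} {h : ℕ} (hr : q.rule h (q.mid h) = none) (y : U) :
    q.removed y h = 0 := by
  rw [removed, hr]

theorem removed_eq {q : Pass U} {h s : ℕ} (hr : q.rule h (q.mid h) = some s) (y : U) :
    q.removed y h = cnt y (q.mid h).buf - s := by
  rw [removed, hr]

theorem cnt_post {q : Pass U} {h s : ℕ} (hr : q.rule h (q.mid h) = some s) (y : U) :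
    cnt y (q.post h).buf = min s (cnt y (q.mid h).buf) := by
  rw [post, postFrom]
  have hr' : q.rule h (q.midFrom 0 h) = some s := hr
  rw [hr']
  exact cnt_compactKeep _ _ _

theorem active_eq_zero {q : Pass U} {h : ℕ} (hr : q.rule h (q.mid h) = none) :
    q.active h = 0 := by
  rw [active, hr]
  rfl

theorem active_le_one (q : Pass U) (h : ℕ) : q.active h ≤ 1 := by
  unfold active
  split_ifs <;> omega

theorem two_mul_arrivals_succ_le (q : Pass U) (y : U) (h : ℕ) :
    2 * q.arrivals y (h + 1) ≤ q.removed y h + q.active h := by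
  rw [q.arrivals_succ]
  rcases hr : q.rule h (q.mid h) with _ | s
  · rw [removed_eq_zero hr]
    simp
  · have : q.active h = 1 := by rw [active, hr]; rfl
    rw [this]
    split_ifs <;> omega

end Pass

namespace RCSketch

variable {U : Type u} [LinearOrder U]

theorem preparePass_rule_eq_some {U : Type u} {P : RCSchedule} {i h s : ℕ}
    {coin : ℕ → Bool} {S : RCSketch U}
    {c : RelCompactor U} (hr : (preparePass P i coin S).rule h c = some s) :
    P.stage S.n < i ∧ s = P.B (P.stage S.n) / 2 ∧ P.B (P.stage S.n) / 2 < c.buf.card := by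
  simp only [preparePass, prepareRule] at hr
  split_ifs at hr with hi
  · simp only [specialRule] at hr
    split_ifs at hr with h1
    · exact ⟨hi, (Option.some.inj hr).symm, h1.2⟩

theorem preparePass_arrivals {P : RCSchedule} {i : ℕ} {coin : ℕ → Bool} {S : RCSketch U}
    (hi : P.stage S.n = i) (y : U) (h : ℕ) : (preparePass P i coin S).arrivals y h = 0 := by
  cases h with
  | zero => exact Pass.arrivals_zero _ _
  | succ h =>
    have h1 := (preparePass P i coin S).arrivals_succ_le y h
    rcases hr : (preparePass P i coin S).rule h ((preparePass P i coin S).mid h) with _ | s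
    · rw [Pass.removed_eq_zero hr] at h1
      omega
    · have := (preparePass_rule_eq_some hr).1
      omega

theorem scheduledRule_eq_some {U : Type u} {P : RCSchedule} {i h s : ℕ} {c : RelCompactor U}
    (hr : scheduledRule P i h c = some s) : P.B i ≤ c.buf.card ∧ s = protect P i c.state := by
  unfold scheduledRule at hr
  split_ifs at hr with h1
  exact ⟨h1, (Option.some.inj hr).symm⟩

theorem nodePass_zero (P : RCSchedule) (ω : Coin → Bool) (ν : MergeNode U) :
    nodePass P ω ν 0 = preparePass P (P.stage (ν.left.size + ν.right.size))
      (fun h => ω (ν.path, 0, h)) (build P ω (false :: ν.path) ν.left) := by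
  rw [nodePass, mergePass, build_n, build_n]

theorem nodePass_one (P : RCSchedule) (ω : Coin → Bool) (ν : MergeNode U) :
    nodePass P ω ν 1 = preparePass P (P.stage (ν.left.size + ν.right.size))
      (fun h => ω (ν.path, 1, h)) (build P ω (true :: ν.path) ν.right) := by
  rw [nodePass, mergePass, build_n, build_n]

theorem nodePass_two_rule (P : RCSchedule) (ω : Coin → Bool) (ν : MergeNode U) :
    (nodePass P ω ν 2).rule = scheduledRule P (P.stage (ν.left.size + ν.right.size)) := by
  rw [nodePass, mergePass, build_n, build_n]

theorem nodePass_two_state (P : RCSchedule) (ω : Coin → Bool) (ν : MergeNode U) (h : ℕ) :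
    ((nodePass P ω ν 2).levels h).state =
      ((nodePass P ω ν 0).post h).state ||| ((nodePass P ω ν 1).post h).state := rfl

variable (P : RCSchedule) (ω : Coin → Bool)

/-- The number of compactions of level `h`. -/
def compactions (p : List Bool) (t : MergeTree U) (h : ℕ) : ℝ :=
  t.passSum p fun ν a => (nodePass P ω ν a).active h

theorem compactions_nonneg (p : List Bool) (t : MergeTree U) (h : ℕ) :
    0 ≤ compactions P ω p t h :=
  MergeTree.passSum_nonneg fun _ _ _ => Nat.cast_nonneg _

theorem or_le_add (a b : ℕ) : a ||| b ≤ a + b := by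
  induction a using Nat.strong_induction_on generalizing b with
  | _ a ih =>
    rcases Nat.eq_zero_or_pos a with rfl | ha
    · simp
    · have h1 := ih (a / 2) (by omega) (b / 2)
      rw [← Nat.or_div_two] at h1
      have h2 := Nat.or_mod_two_eq_one (a := a) (b := b)
      omega

theorem state_prepared_le (p : List Bool) (l r : MergeTree U) (h : ℕ)
    (hl : ((nth (build P ω (false :: p) l).levels h).state : ℝ) ≤ compactions P ω (false :: p) l h)
    (hr : ((nth (build P ω (true :: p) r).levels h).state : ℝ) ≤ compactions P ω (true :: p) r h) :
    (((nodePass P ω ⟨p, l, r⟩ 0).post h).state : ℝ) +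
      ((nodePass P ω ⟨p, l, r⟩ 1).post h).state + (nodePass P ω ⟨p, l, r⟩ 2).active h ≤
      compactions P ω p (.node l r) h := by
  rw [Pass.state_post, Pass.state_post, compactions, MergeTree.passSum_node]
  rw [compactions] at hl hr
  have h0 : (nodePass P ω ⟨p, l, r⟩ 0).levels h = nth (build P ω (false :: p) l).levels h := rfl
  have h1 : (nodePass P ω ⟨p, l, r⟩ 1).levels h = nth (build P ω (true :: p) r).levels h := rfl
  rw [h0, h1]
  push_cast
  linarith

theorem state_le_compactions (h : ℕ) : ∀ (t : MergeTree U) (p : List Bool),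
    ((nth (build P ω p t).levels h).state : ℝ) ≤ compactions P ω p t h
  | .leaf x, p => by
    have h0 := compactions_nonneg P ω p (.leaf x) h
    cases h with
    | zero => rw [nth_build_leaf_zero]; simpa using h0
    | succ h => rw [nth_build_leaf_succ]; simpa using h0
  | .node l r, p => by
    have h1 := state_prepared_le P ω p l r h (state_le_compactions h l _)
      (state_le_compactions h r _)
    rw [nth_build_node, Pass.state_post, nodePass_two_state]
    have h2 : ((((nodePass P ω ⟨p, l, r⟩ 0).post h).state |||
        ((nodePass P ω ⟨p, l, r⟩ 1).post h).state : ℕ) : ℝ) ≤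
        ((nodePass P ω ⟨p, l, r⟩ 0).post h).state + ((nodePass P ω ⟨p, l, r⟩ 1).post h).state := by
      exact_mod_cast or_le_add _ _
    push_cast
    linarith

variable {P} {J : ℕ → ℕ} (hP : P.Adequate J) {y : U}

theorem compactions_prepare_le (hP : P.Adequate J) {i : ℕ} {coin : ℕ → Bool} {S : RCSketch U}
    (hi : P.stage S.n ≤ i) {h : ℕ} {A R c : ℝ}
    (hy : ∀ x ∈ ((preparePass P i coin S).mid h).buf, x ≤ y)
    (hA : A = cnt y (nth S.levels h).buf + R) (hR : 0 ≤ R)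
    (hc : c ≤ P.specialRate (P.stage S.n) * A + R / P.k (P.stage S.n)) :
    c + (preparePass P i coin S).active h ≤
      P.specialRate i * (A + (preparePass P i coin S).arrivals y h) +
        (R + (preparePass P i coin S).removed y h) / P.k i := by
  set q := preparePass P i coin S with hq
  have hk : (0 : ℝ) < P.k i := by exact_mod_cast P.k_pos i
  have hk2 : (P.k i : ℝ) ≤ P.k (P.stage S.n) := by exact_mod_cast hP.antitone_k hi
  have hA0 : 0 ≤ A := by rw [hA]; positivity
  have hs := P.specialRate_mono hi
  have h1 : R / P.k (P.stage S.n) ≤ R / P.k i := by gcongr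
  have h2 : R / P.k i ≤ (R + q.removed y h) / P.k i := by
    gcongr
    linarith [Nat.cast_nonneg (α := ℝ) (q.removed y h)]
  have h3 : (0 : ℝ) ≤ q.arrivals y h := Nat.cast_nonneg _
  have h4 := P.specialRate_nonneg i
  rcases hr : q.rule h (q.mid h) with _ | s
  · rw [Pass.active_eq_zero hr, Nat.cast_zero, add_zero]
    nlinarith
  · obtain ⟨hlt, rfl, hcard⟩ := preparePass_rule_eq_some hr
    have h5 := P.specialRate_add_le hlt
    have h6 : (q.active h : ℝ) ≤ 1 := by exact_mod_cast q.active_le_one h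
    have hB := P.B_pos (P.stage S.n)
    rw [← cnt_eq_card hy, Pass.cnt_mid] at hcard
    -- the compacted buffer is more than half full
    have h7 : (P.B (P.stage S.n) : ℝ) / 2 ≤ A + q.arrivals y h := by
      rw [← P.half_B_real, hA]
      have : ((P.B (P.stage S.n) / 2 : ℕ) : ℝ) ≤
          cnt y (nth S.levels h).buf + q.arrivals y h := by exact_mod_cast hcard.le
      linarith
    have h8 : 1 ≤ 2 / (P.B (P.stage S.n) : ℝ) * (A + q.arrivals y h) := by
      rw [div_mul_eq_mul_div, le_div_iff₀ hB]
      linarith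
    have h9 := P.specialRate_nonneg (P.stage S.n)
    nlinarith

/-- A special compaction is paid for by the items that have arrived at the level, at least half a
buffer in every subtree that leaves a stage; a scheduled one by the `k` items that it removes. -/
theorem compactions_le (hP : P.Adequate J) (h : ℕ) : ∀ (t : MergeTree U) (p : List Bool),
    (∀ x ∈ t.items, x ≤ y) →
    compactions P ω p t h ≤ P.specialRate (P.stage t.size) * arrived P ω p t y h +
      removedTotal P ω p t y h / P.k (P.stage t.size)
  | .leaf x, p, _ => by
    have h1 := mul_nonneg (P.specialRate_nonneg (P.stage (MergeTree.leaf x).size))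
      (arrived_nonneg P ω y h (.leaf x) p)
    have h2 := removedTotal_nonneg P ω y h p (.leaf x)
    have h3 : (0 : ℝ) ≤ removedTotal P ω p (.leaf x) y h / P.k (P.stage (MergeTree.leaf x).size) :=
      by positivity
    rw [compactions, MergeTree.passSum_leaf]
    linarith
  | .node l r, p, hy => by
    have hyl : ∀ x ∈ l.items, x ≤ y := fun x hx => hy x (List.mem_append_left _ hx)
    have hyr : ∀ x ∈ r.items, x ≤ y := fun x hx => hy x (List.mem_append_right _ hx)
    have hmid : ∀ a, ∀ x ∈ ((nodePass P ω ⟨p, l, r⟩ a).mid h).buf, x ≤ y := fun a x hx =>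
      hy x (mem_mid_nodePass P ω ⟨p, l, r⟩ a h x hx)
    have el := arrived_eq P ω y h l (false :: p)
    have er := arrived_eq P ω y h r (true :: p)
    have il := compactions_le hP h l (false :: p) hyl
    have ir := compactions_le hP h r (true :: p) hyr
    rw [← build_n P ω l (false :: p)] at il
    rw [← build_n P ω r (true :: p)] at ir
    have h0 := compactions_prepare_le hP (i := P.stage (l.size + r.size))
      (coin := fun h => ω (p, 0, h)) (by rw [build_n]; exact P.stage_mono (Nat.le_add_right _ _))
      (by have := hmid 0; rwa [nodePass_zero] at this) el (removedTotal_nonneg P ω y h _ _) il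
    have h1 := compactions_prepare_le hP (i := P.stage (l.size + r.size))
      (coin := fun h => ω (p, 1, h)) (by rw [build_n]; exact P.stage_mono (Nat.le_add_left _ _))
      (by have := hmid 1; rwa [nodePass_one] at this) er (removedTotal_nonneg P ω y h _ _) ir
    have e0 := nodePass_zero P ω ⟨p, l, r⟩
    have e1 := nodePass_one P ω ⟨p, l, r⟩
    simp only at e0 e1
    rw [← e0] at h0
    rw [← e1] at h1
    have hk : (0 : ℝ) < P.k (P.stage (l.size + r.size)) := by exact_mod_cast P.k_pos _
    have h2 : ((nodePass P ω ⟨p, l, r⟩ 2).active h : ℝ) ≤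
        (nodePass P ω ⟨p, l, r⟩ 2).removed y h / P.k (P.stage (l.size + r.size)) := by
      rcases hr : (nodePass P ω ⟨p, l, r⟩ 2).rule h ((nodePass P ω ⟨p, l, r⟩ 2).mid h) with _ | s
      · rw [Pass.active_eq_zero hr, Nat.cast_zero]
        positivity
      · have h6 := (nodePass P ω ⟨p, l, r⟩ 2).active_le_one h
        rw [Pass.removed_eq hr, le_div_iff₀ hk]
        rw [nodePass_two_rule] at hr
        dsimp only at hr
        obtain ⟨hB, rfl⟩ := scheduledRule_eq_some hr
        rw [cnt_eq_card (hmid 2)]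
        -- a scheduled compaction removes at least one section
        have h7 : P.k (P.stage (l.size + r.size)) + protect P (P.stage (l.size + r.size))
            ((nodePass P ω ⟨p, l, r⟩ 2).mid h).state ≤
            ((nodePass P ω ⟨p, l, r⟩ 2).mid h).buf.card := by
          refine le_trans ?_ hB
          have h8 : P.k (P.stage (l.size + r.size)) ≤ P.B (P.stage (l.size + r.size)) := by
            have := P.m_pos (P.stage (l.size + r.size))
            unfold RCSchedule.B
            nlinarith
          have h9 : ∀ z, P.k (P.stage (l.size + r.size)) ≤
              (z + 1) * P.k (P.stage (l.size + r.size)) := fun z =>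
            Nat.le_mul_of_pos_left _ (Nat.succ_pos _)
          have := h9 (trailingOnes ((nodePass P ω ⟨p, l, r⟩ 2).mid h).state)
          unfold protect
          omega
        have h8 : (nodePass P ω ⟨p, l, r⟩ 2).active h * P.k (P.stage (l.size + r.size)) ≤
            P.k (P.stage (l.size + r.size)) := by nlinarith
        exact_mod_cast (by omega)
    rw [compactions, removedTotal, MergeTree.passSum_node, MergeTree.passSum_node, arrived_node,
      MergeTree.size_node, ← compactions, ← compactions, ← removedTotal, ← removedTotal]
    have hs := mul_nonneg (P.specialRate_nonneg (P.stage (l.size + r.size)))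
      (Nat.cast_nonneg (α := ℝ) ((nodePass P ω ⟨p, l, r⟩ 2).arrivals y h))
    have h3 := add_le_add (add_le_add h0 h1) h2
    refine le_trans (le_of_eq ?_) (h3.trans (le_trans (le_add_of_nonneg_right hs) (le_of_eq ?_)))
    · ring
    · ring

theorem compactions_le_arrived (hP : P.Adequate J) (h : ℕ) (t : MergeTree U) (p : List Bool)
    (hy : ∀ x ∈ t.items, x ≤ y) :
    compactions P ω p t h ≤ 9 / (8 * P.k (P.stage t.size)) * arrived P ω p t y h := by
  have h1 := compactions_le ω hP h t p hy
  have h2 := hP.specialRate_le (P.stage t.size)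
  have h3 := arrived_nonneg P ω y h t p
  have h4 := arrived_eq P ω y h t p
  have h5 : (0 : ℝ) ≤ stored P ω p t y h := Nat.cast_nonneg _
  have hk : (0 : ℝ) < P.k (P.stage t.size) := by exact_mod_cast P.k_pos _
  have h6 : removedTotal P ω p t y h / P.k (P.stage t.size) ≤
      arrived P ω p t y h / P.k (P.stage t.size) := by
    gcongr
    linarith
  have h7 : (9 : ℝ) / (8 * P.k (P.stage t.size)) * arrived P ω p t y h =
      1 / (8 * P.k (P.stage t.size)) * arrived P ω p t y h +
        arrived P ω p t y h / P.k (P.stage t.size) := by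
    field_simp
    ring
  have h8 := mul_le_mul_of_nonneg_right h2 h3
  linarith

theorem exists_max_item : ∀ t : MergeTree U, ∃ y, ∀ x ∈ t.items, x ≤ y
  | .leaf x => ⟨x, fun z hz => by simp [MergeTree.items] at hz; exact hz.le⟩
  | .node l r => by
    obtain ⟨a, ha⟩ := exists_max_item l
    obtain ⟨b, hb⟩ := exists_max_item r
    refine ⟨max a b, fun x hx => ?_⟩
    rcases List.mem_append.1 hx with hx | hx
    · exact (ha x hx).trans (le_max_left _ _)
    · exact (hb x hx).trans (le_max_right _ _)

theorem arrived_le_size (h : ℕ) (t : MergeTree U) (p : List Bool) :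
    arrived P ω p t y h ≤ t.size := by
  refine (arrived_antitone P ω y t p (Nat.zero_le h)).trans ?_
  rw [arrived_zero]
  exact_mod_cast t.rank_le_size y

theorem compactions_le_size (hP : P.Adequate J) (h : ℕ) (t : MergeTree U) (p : List Bool) :
    compactions P ω p t h ≤ 9 / (8 * P.k (P.stage t.size)) * t.size := by
  obtain ⟨y, hy⟩ := exists_max_item t
  refine (compactions_le_arrived ω hP h t p hy).trans ?_
  have := arrived_le_size (P := P) ω (y := y) h t p
  gcongr

/-- Combined states have few bits. -/
theorem compactions_lt_two_pow (hP : P.Adequate J) (h : ℕ) (t : MergeTree U) (p : List Bool) :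
    compactions P ω p t h < 2 ^ J (P.stage t.size) := by
  refine (compactions_le_size ω hP h t p).trans_lt ?_
  have hk : (0 : ℝ) < P.k (P.stage t.size) := by exact_mod_cast P.k_pos _
  have h1 : (t.size : ℝ) ≤ P.N (P.stage t.size) := by exact_mod_cast P.le_N_stage t.size
  have h2 : (9 : ℝ) * P.N (P.stage t.size) < 8 * P.k (P.stage t.size) * 2 ^ J (P.stage t.size) := by
    exact_mod_cast hP.N_lt (P.stage t.size)
  rw [div_mul_eq_mul_div, div_lt_iff₀ (by positivity)]
  linarith

theorem state_le_size (hP : P.Adequate J) (h : ℕ) (t : MergeTree U) (p : List Bool) :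
    (nth (build P ω p t).levels h).state ≤ t.size := by
  have h1 := (state_le_compactions P ω h t p).trans (compactions_le_size ω hP h t p)
  have hk : (2 : ℝ) ≤ P.k (P.stage t.size) := by exact_mod_cast P.two_le_k _
  have h2 : 9 / (8 * P.k (P.stage t.size)) * (t.size : ℝ) ≤ 1 * t.size := by
    gcongr
    rw [div_le_one (by positivity)]
    linarith
  rw [one_mul] at h2
  exact_mod_cast h1.trans h2

theorem arrived_succ_le_mul (hP : P.Adequate J) (h : ℕ) (t : MergeTree U) (p : List Bool)
    (hy : ∀ x ∈ t.items, x ≤ y) :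
    arrived P ω p t y (h + 1) ≤ 25 / 32 * arrived P ω p t y h := by
  have h1 : 2 * arrived P ω p t y (h + 1) ≤
      removedTotal P ω p t y h + compactions P ω p t h := by
    rw [arrived, if_neg (Nat.succ_ne_zero h), zero_add, removedTotal, compactions,
      ← MergeTree.passSum_mul_left, ← MergeTree.passSum_add]
    exact MergeTree.passSum_le fun ν _ a => by
      exact_mod_cast (nodePass P ω ν a).two_mul_arrivals_succ_le y h
  have h2 := compactions_le_arrived ω hP h t p hy
  have h3 := arrived_nonneg P ω y h t p
  have h4 := arrived_eq P ω y h t p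
  have h5 : (0 : ℝ) ≤ stored P ω p t y h := Nat.cast_nonneg _
  have hk : (2 : ℝ) ≤ P.k (P.stage t.size) := by exact_mod_cast P.two_le_k _
  have h6 : 9 / (8 * P.k (P.stage t.size)) * arrived P ω p t y h ≤
      9 / 16 * arrived P ω p t y h := by
    gcongr
    linarith
  linarith

theorem arrived_le_pow (hP : P.Adequate J) (h : ℕ) (t : MergeTree U) (p : List Bool)
    (hy : ∀ x ∈ t.items, x ≤ y) :
    arrived P ω p t y h ≤ (25 / 32) ^ h * t.size := by
  induction h with
  | zero => simpa using arrived_le_size (P := P) ω (y := y) 0 t p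
  | succ h ih =>
    have := arrived_succ_le_mul ω hP h t p hy
    rw [pow_succ]
    linarith

/-- A level above level `h` is opened only after level `h` has been full. -/
theorem B_le_arrived (hP : P.Adequate J) (h : ℕ) : ∀ (t : MergeTree U) (p : List Bool),
    (∀ x ∈ t.items, x ≤ y) → h + 1 < (build P ω p t).levels.length →
    (P.B 0 : ℝ) ≤ arrived P ω p t y h
  | .leaf x, p, _, hlen => by simp [build, single] at hlen
  | .node l r, p, hy, hlen => by
    obtain ⟨a1, a2⟩ := arrived_le_node P ω y h p l r
    rw [build, lt_length_merge] at hlen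
    rcases hlen with (hlen | hlen) | hlen
    · exact (B_le_arrived hP h l _ (fun x hx => hy x (List.mem_append_left _ hx)) hlen).trans a1
    · exact (B_le_arrived hP h r _ (fun x hx => hy x (List.mem_append_right _ hx)) hlen).trans a2
    · change P.B _ ≤ ((nodePass P ω ⟨p, l, r⟩ 2).mid h).buf.card at hlen
      rw [← cnt_eq_card (y := y)
        (fun x hx => hy x (mem_mid_nodePass P ω ⟨p, l, r⟩ 2 h x hx))] at hlen
      have h1 : (P.B 0 : ℝ) ≤ cnt y ((nodePass P ω ⟨p, l, r⟩ 2).mid h).buf := by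
        exact_mod_cast (hP.strictMono_B.monotone (Nat.zero_le _)).trans hlen
      have h2 := stored_node P ω y h p l r
      have h3 := arrived_eq P ω y h (.node l r) p
      rw [removedTotal, MergeTree.passSum_node, ← removedTotal, ← removedTotal] at h3
      have h4 := removedTotal_nonneg P ω y h (false :: p) l
      have h5 := removedTotal_nonneg P ω y h (true :: p) r
      linarith [Nat.cast_nonneg (α := ℝ) ((nodePass P ω ⟨p, l, r⟩ 0).removed y h),
        Nat.cast_nonneg (α := ℝ) ((nodePass P ω ⟨p, l, r⟩ 1).removed y h)]

theorem card_buf_lt (h : ℕ) : ∀ (t : MergeTree U) (p : List Bool),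
    (nth (build P ω p t).levels h).buf.card < P.B (P.stage t.size)
  | .leaf x, p => by
    have := P.four_le_B (P.stage (MergeTree.leaf x).size)
    cases h with
    | zero => rw [nth_build_leaf_zero, Multiset.card_singleton]; omega
    | succ h => rw [nth_build_leaf_succ, Multiset.card_zero]; omega
  | .node l r, p => by
    rw [nth_build_node, MergeTree.size_node, Pass.post, Pass.postFrom]
    set c := (nodePass P ω ⟨p, l, r⟩ 2).midFrom 0 h
    rw [nodePass_two_rule]
    rcases hr : scheduledRule P (P.stage (l.size + r.size)) h c with _ | s
    · unfold scheduledRule at hr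
      split_ifs at hr with h1
      exact not_le.1 h1
    · have h1 := protect_add_two_le P (P.stage (l.size + r.size)) c.state
      obtain ⟨_, rfl⟩ := scheduledRule_eq_some hr
      change (compactKeep _ _).card < _
      rw [card_compactKeep]
      omega

end RCSketch

/-! ### The schedule of the compactions -/

section Schedule

theorem testBit_of_lt_trailingOnes {s b : ℕ} (h : b < trailingOnes s) : s.testBit b = true := by
  have := Nat.find_min (exists_testBit_eq_false s) h
  simpa using this

theorem testBit_trailingOnes (s : ℕ) : s.testBit (trailingOnes s) = false :=
  Nat.find_spec (exists_testBit_eq_false s)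

theorem trailingOnes_le_of_lt {s j : ℕ} (h : s < 2 ^ j) : trailingOnes s ≤ j :=
  Nat.find_min' _ (Nat.testBit_lt_two_pow h)

/-- Adding `1` clears the trailing ones and sets the bit above them. -/
theorem testBit_succ (s b : ℕ) : (s + 1).testBit b =
    if b < trailingOnes s then false else if b = trailingOnes s then true else s.testBit b := by
  set z := trailingOnes s with hz
  have h1 : s % 2 ^ (z + 1) = 2 ^ z - 1 := by
    apply Nat.eq_of_testBit_eq
    intro i
    rw [Nat.testBit_mod_two_pow, Nat.testBit_two_pow_sub_one]
    rcases lt_trichotomy i z with h | h | h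
    · rw [testBit_of_lt_trailingOnes (hz ▸ h)]
      simp [h, h.trans (Nat.lt_succ_self z)]
    · rw [h, hz, testBit_trailingOnes]
      simp
    · have h2 : ¬ i < z + 1 := by omega
      have h3 : ¬ i < z := by omega
      simp [h2, h3]
  have hpos : 0 < 2 ^ z := by positivity
  have hlt : 2 ^ z < 2 ^ (z + 1) := Nat.pow_lt_pow_right (by norm_num) (Nat.lt_succ_self z)
  have h2 : s = 2 ^ (z + 1) * (s / 2 ^ (z + 1)) + (2 ^ z - 1) := by
    rw [← h1, Nat.div_add_mod]
  have h3 : s + 1 = 2 ^ (z + 1) * (s / 2 ^ (z + 1)) + 2 ^ z := by omega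
  rw [h3, Nat.testBit_two_pow_mul_add _ hlt]
  rcases lt_trichotomy b z with h | h | h
  · rw [if_pos (by omega), if_pos h, Nat.testBit_two_pow_of_ne (by omega)]
  · rw [if_pos (by omega), if_neg (by omega), if_pos h, h, Nat.testBit_two_pow_self]
  · rw [if_neg (by omega), if_neg (by omega), if_neg (by omega)]
    conv_rhs => rw [h2]
    rw [Nat.testBit_two_pow_mul_add _ (by omega), if_neg (by omega)]

/-- The marked bits of the state `s` of a level that stores `I` items at most `y`: those bits `b <
q` that are set and for which the `B - (b + 1) k` items that a compaction of `b + 1` sections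
protects are all at most `y`. A bit `b` that is set remembers a compaction of exactly `b + 1`
sections with no larger one after it; it is marked if that compaction may have removed items at most
`y`, in which case its rounding has still to be paid for. -/
def marked (B k q s I : ℕ) : Finset ℕ :=
  (Finset.range q).filter fun b => s.testBit b = true ∧ B ≤ I + (b + 1) * k

theorem card_marked_le (B k q s I : ℕ) : (marked B k q s I).card ≤ q :=
  (Finset.card_filter_le _ _).trans (by rw [Finset.card_range])

theorem le_add_mul_of_marked_pos {B k q s I : ℕ} (h : 0 < (marked B k q s I).card) :
    B ≤ I + q * k := by
  obtain ⟨b, hb⟩ := Finset.card_pos.1 h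
  simp only [marked, Finset.mem_filter, Finset.mem_range] at hb
  have : (b + 1) * k ≤ q * k := Nat.mul_le_mul_right _ hb.1
  omega

/-- A bit that is marked in both sketches to be merged is lost by the bitwise OR, but then there
are more than `B` items at most `y` in the united buffer, and the excess pays for the loss. -/
theorem card_marked_add_le {B k q s₀ s₁ I₀ I₁ I : ℕ} (hq : 3 * (q * k) ≤ B) (hI : I₀ + I₁ ≤ I) :
    (marked B k q s₀ I₀).card + (marked B k q s₁ I₁).card ≤
        (marked B k q (s₀ ||| s₁) I).card ∨
      k * ((marked B k q s₀ I₀).card + (marked B k q s₁ I₁).card) + B ≤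
        k * (marked B k q (s₀ ||| s₁) I).card + I := by
  set D := marked B k q s₀ I₀ ∩ marked B k q s₁ I₁ with hD
  have h1 : marked B k q s₀ I₀ ∪ marked B k q s₁ I₁ ⊆ marked B k q (s₀ ||| s₁) I := by
    intro b hb
    simp only [marked, Finset.mem_union, Finset.mem_filter, Nat.testBit_or] at hb ⊢
    rcases hb with hb | hb
    · refine ⟨hb.1, by rw [hb.2.1, Bool.true_or], by omega⟩
    · refine ⟨hb.1, by rw [hb.2.1, Bool.or_true], by omega⟩
  have h2 := Finset.card_le_card h1
  have h3 := Finset.card_union_add_card_inter (marked B k q s₀ I₀) (marked B k q s₁ I₁)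
  rw [← hD] at h3
  rcases Finset.eq_empty_or_nonempty D with h | ⟨b, hb⟩
  · rw [h, Finset.card_empty] at h3
    left
    omega
  · right
    have hb0 := Finset.card_pos.2 ⟨b, Finset.mem_of_mem_inter_left hb⟩
    have hb1 := Finset.card_pos.2 ⟨b, Finset.mem_of_mem_inter_right hb⟩
    have h4 := le_add_mul_of_marked_pos hb0
    have h5 := le_add_mul_of_marked_pos hb1
    have h6 : D.card ≤ q :=
      (Finset.card_le_card Finset.inter_subset_left).trans (card_marked_le _ _ _ _ _)
    have h7 : k * D.card ≤ q * k := by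
      rw [mul_comm]
      exact Nat.mul_le_mul_right _ h6
    have h8 : k * ((marked B k q s₀ I₀).card + (marked B k q s₁ I₁).card) ≤
        k * (marked B k q (s₀ ||| s₁) I).card + k * D.card := by
      rw [← mul_add, ← h3]
      exact Nat.mul_le_mul_left _ (by omega)
    omega

/-- A scheduled compaction that removes items at most `y` marks one new bit. The marked bits that
it clears are paid for by one section of removed items each. -/
theorem card_marked_compact {B k j s I : ℕ} (hk : 0 < k) (hq : (j + 1) * k ≤ B)
    (hs : s < 2 ^ j) :
    k * ((if 0 < I - (B - (trailingOnes s + 1) * k) then 1 else 0) +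
        (marked B k (j + 1) s I).card) ≤
      (I - (B - (trailingOnes s + 1) * k)) +
        k * (marked B k (j + 1) (s + 1) (min (B - (trailingOnes s + 1) * k) I)).card := by
  have hz := trailingOnes_le_of_lt hs
  have hlow := @testBit_of_lt_trailingOnes s
  have hzb := testBit_trailingOnes s
  have hsucc := testBit_succ s
  set z := trailingOnes s
  have hzB : (z + 1) * k ≤ B := (Nat.mul_le_mul_right _ (by omega)).trans hq
  by_cases hI : 0 < I - (B - (z + 1) * k)
  · rw [if_pos hI, min_eq_left (by omega)]
    set M' := marked B k (j + 1) (s + 1) (B - (z + 1) * k) with hM'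
    set low := (marked B k (j + 1) s I).filter fun b => b < z
    set high := (marked B k (j + 1) s I).filter fun b => ¬ b < z
    have h1 : low.card + high.card = (marked B k (j + 1) s I).card :=
      Finset.card_filter_add_card_filter_not _
    have h2 : high.card + 1 ≤ M'.card := by
      have hzh : z ∉ high := by
        simp only [high, marked, Finset.mem_filter]
        intro h
        rw [hzb] at h
        exact Bool.false_ne_true h.1.2.1
      rw [← Finset.card_insert_of_notMem hzh]
      apply Finset.card_le_card
      intro b hb
      rcases Finset.mem_insert.1 hb with rfl | hb
      · simp only [hM', marked, Finset.mem_filter, Finset.mem_range]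
        refine ⟨by omega, ?_, by omega⟩
        rw [hsucc, if_neg (lt_irrefl _), if_pos rfl]
      · have hne : b ≠ z := fun h => hzh (h ▸ hb)
        simp only [high, marked, Finset.mem_filter] at hb
        simp only [hM', marked, Finset.mem_filter]
        refine ⟨hb.1.1, ?_, ?_⟩
        · rw [hsucc, if_neg hb.2, if_neg hne]
          exact hb.1.2.1
        · have : (z + 1) * k ≤ (b + 1) * k := Nat.mul_le_mul_right _ (by omega)
          omega
    have h3 : k * low.card ≤ I - (B - (z + 1) * k) := by
      rcases Finset.eq_empty_or_nonempty low with h | h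
      · rw [h, Finset.card_empty, mul_zero]
        exact Nat.zero_le _
      · -- the smallest marked bit below `z` decides how many items are removed
        set b := low.min' h
        have hb := Finset.min'_mem low h
        have hsub : low ⊆ Finset.Ico b z := by
          intro c hc
          have h4 := Finset.min'_le low c hc
          simp only [low, Finset.mem_filter] at hc
          exact Finset.mem_Ico.2 ⟨h4, hc.2⟩
        have h5 := Finset.card_le_card hsub
        rw [Nat.card_Ico] at h5
        simp only [low, marked, Finset.mem_filter] at hb
        have hbz : b < z := hb.2
        have hbB : B ≤ I + (b + 1) * k := hb.1.2.2
        have h6 : (z + 1) * k = (b + 1) * k + (z - b) * k := by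
          rw [← add_mul]
          congr 1
          omega
        have h7 : k * low.card ≤ (z - b) * k := by
          rw [mul_comm]
          exact Nat.mul_le_mul_right _ h5
        omega
    calc k * (1 + (marked B k (j + 1) s I).card)
        = k * low.card + k * (high.card + 1) := by rw [← h1]; ring
      _ ≤ _ := add_le_add h3 (Nat.mul_le_mul_left _ h2)
  · rw [if_neg hI, zero_add, min_eq_right (by omega)]
    refine le_add_left (Nat.mul_le_mul_left _ (Finset.card_le_card ?_))
    intro b hb
    simp only [marked, Finset.mem_filter] at hb ⊢
    have hbz : ¬ b < z := by
      intro h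
      have h6 : (z + 1) * k = (b + 1) * k + (z - b) * k := by
        rw [← add_mul]
        congr 1
        omega
      have h7 : 0 < (z - b) * k := Nat.mul_pos (by omega) hk
      omega
    have hne : b ≠ z := by
      rintro rfl
      rw [hzb] at hb
      exact Bool.false_ne_true hb.2.1
    refine ⟨hb.1, ?_, hb.2.2⟩
    rw [hsucc, if_neg hbz, if_neg hne]
    exact hb.2.1

end Schedule

/-! ### The credit of an item -/

namespace RCSketch

/-- The weight `2 ^ h` of an item of level `h` times the buffer capacity in stage `j`, capped at
eight times the rank `R`. -/
noncomputable def cap (P : RCSchedule) (R : ℝ) (h j : ℕ) : ℝ := min (2 ^ h * P.B j) (8 * R)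

/-- The credit of an item at level `h` in stage `j`. Doubling the weight of the item by moving it
up, or the capacity by a change of the stage, frees a multiple of `cap`, which pays for compactions.
As `cap` is at most `8 R`, the credit is never less than `cap`. -/
noncomputable def credit (P : RCSchedule) (R : ℝ) (h j : ℕ) : ℝ := 32 * R - 3 * cap P R h j

variable {P : RCSchedule} {R : ℝ} {h j : ℕ}

theorem cap_nonneg (hR : 0 ≤ R) : 0 ≤ cap P R h j :=
  le_min (by positivity) (by positivity)

theorem cap_le_credit : cap P R h j ≤ credit P R h j := by
  have : cap P R h j ≤ 8 * R := min_le_right _ _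
  unfold credit
  linarith

theorem credit_nonneg (hR : 0 ≤ R) : 0 ≤ credit P R h j := (cap_nonneg hR).trans cap_le_credit

theorem credit_le (hR : 0 ≤ R) : credit P R h j ≤ 32 * R := by
  have := cap_nonneg (P := P) (h := h) (j := j) hR
  unfold credit
  linarith

theorem cap_eq (hR : 0 ≤ R) (hreg : 2 ^ h * (P.B j : ℝ) ≤ 4 * R) :
    cap P R h j = 2 ^ h * P.B j := min_eq_left (by linarith)

theorem credit_succ (hR : 0 ≤ R) (hreg : 2 ^ h * (P.B j : ℝ) ≤ 4 * R) :
    credit P R (h + 1) j = credit P R h j - 3 * cap P R h j := by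
  have h1 : cap P R (h + 1) j = 2 * (2 ^ h * P.B j) := by
    rw [cap, pow_succ, min_eq_left (by linarith)]
    ring
  rw [credit, credit, h1, cap_eq hR hreg]
  ring

theorem cap_mono {J : ℕ → ℕ} (hP : P.Adequate J) {i : ℕ} (hij : j ≤ i) :
    cap P R h j ≤ cap P R h i := by
  have : (P.B j : ℝ) ≤ P.B i := by exact_mod_cast hP.strictMono_B.monotone hij
  unfold cap
  gcongr

theorem two_mul_cap_le {J : ℕ → ℕ} (hP : P.Adequate J) (hR : 0 ≤ R) {i : ℕ} (hij : j < i)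
    (hreg : 2 ^ h * (P.B j : ℝ) ≤ 4 * R) : 2 * cap P R h j ≤ cap P R h i := by
  have h1 : (2 * P.B j : ℝ) ≤ P.B i := by exact_mod_cast hP.two_mul_B_le_of_lt hij
  have h2 : (0 : ℝ) < 2 ^ h := by positivity
  rw [cap_eq hR hreg]
  refine le_min ?_ (by linarith)
  nlinarith

/-- The price of the marked bits of a state: `cap` for each of `k` items for each marked bit.
Nothing is charged at the levels that are too high for items at most `y` to be compacted. -/
noncomputable def markedWeight (P : RCSchedule) (J : ℕ → ℕ) (R : ℝ) (h j s I : ℕ) : ℝ :=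
  if 2 ^ h * (P.B j : ℝ) ≤ 4 * R then
    cap P R h j * (P.k j * (marked (P.B j) (P.k j) (J j + 1) s I).card) else 0

theorem markedWeight_nonneg {J : ℕ → ℕ} (hR : 0 ≤ R) (s I : ℕ) :
    0 ≤ markedWeight P J R h j s I := by
  have := cap_nonneg (P := P) (h := h) (j := j) hR
  unfold markedWeight
  split_ifs <;> positivity

theorem mul_k_le {J : ℕ → ℕ} (hP : P.Adequate J) (j : ℕ) :
    4 * ((J j + 1) * P.k j) ≤ P.B j / 2 := by
  rw [P.half_B, ← mul_assoc, mul_comm]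
  exact Nat.mul_le_mul_left _ (hP.four_mul_J_le j)

theorem markedWeight_le {J : ℕ → ℕ} (hP : P.Adequate J) (hR : 0 ≤ R) (s I : ℕ) :
    markedWeight P J R h j s I ≤ I * credit P R h j := by
  have h0 := cap_nonneg (P := P) (h := h) (j := j) hR
  have h1 := cap_le_credit (P := P) (R := R) (h := h) (j := j)
  have h2 := credit_nonneg (P := P) (h := h) (j := j) hR
  unfold markedWeight
  split_ifs
  · rcases Nat.eq_zero_or_pos (marked (P.B j) (P.k j) (J j + 1) s I).card with hm | hm
    · rw [hm, Nat.cast_zero, mul_zero, mul_zero]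
      positivity
    · have h3 := le_add_mul_of_marked_pos hm
      have h4 := card_marked_le (P.B j) (P.k j) (J j + 1) s I
      have h5 := mul_k_le hP j
      have h6 : P.k j * (marked (P.B j) (P.k j) (J j + 1) s I).card ≤ (J j + 1) * P.k j := by
        rw [mul_comm]
        exact Nat.mul_le_mul_right _ h4
      have h7 : (P.k j * (marked (P.B j) (P.k j) (J j + 1) s I).card : ℝ) ≤ I := by
        exact_mod_cast (by omega)
      calc _ ≤ credit P R h j * I := by gcongr
        _ = _ := mul_comm _ _
  · positivity

end RCSketch

namespace RCSketch

variable {U : Type u} [LinearOrder U]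

/-- The charge for a compaction in stage `j` that removes items at most `y` from level `h`. If `K ≤
k B`, it is at least `K 2 ^ h`, so that `2 ^ h` times the charge dominates `K` times the squared
weight of the rounding. -/
noncomputable def charge (P : RCSchedule) (y : U) (h j : ℕ) (q : Pass U) : ℝ :=
  if 0 < q.removed y h then P.k j * (2 ^ h * P.B j) else 0

variable {P : RCSchedule} {J : ℕ → ℕ} {R : ℝ} {y : U} {h : ℕ}

theorem credit_prepare (hP : P.Adequate J) (hR : 0 ≤ R) {i : ℕ} {coin : ℕ → Bool} {S : RCSketch U}
    (hi : P.stage S.n ≤ i)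
    (hgood : 2 ^ h * (cnt y ((preparePass P i coin S).mid h).buf : ℝ) ≤ 2 * R) :
    charge P y h (P.stage S.n) (preparePass P i coin S) +
        (preparePass P i coin S).removed y h * credit P R (h + 1) (P.stage S.n) +
        cnt y ((preparePass P i coin S).post h).buf * credit P R h i +
        markedWeight P J R h (P.stage S.n) (nth S.levels h).state (cnt y (nth S.levels h).buf) ≤
      (cnt y (nth S.levels h).buf + (preparePass P i coin S).arrivals y h) *
          credit P R h (P.stage S.n) +
        markedWeight P J R h i ((preparePass P i coin S).post h).state
          (cnt y ((preparePass P i coin S).post h).buf) := by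
  set q := preparePass P i coin S with hq
  set j := P.stage S.n with hj
  have hmid := q.cnt_mid y h
  have hpost := q.cnt_post_add_removed y h
  have hlev : q.levels h = nth S.levels h := rfl
  rw [hlev] at hmid
  rcases hi.eq_or_lt with hji | hji
  · -- the stage does not change
    have harr : q.arrivals y h = 0 := preparePass_arrivals hji y h
    have hr : q.rule h (q.mid h) = none := by
      rcases hr : q.rule h (q.mid h) with _ | s
      · rfl
      · exact absurd (preparePass_rule_eq_some hr).1 (by omega)
    have hrem := Pass.removed_eq_zero hr y
    have hst := q.state_post h
    rw [Pass.active_eq_zero hr, add_zero, hlev] at hst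
    have hcnt : cnt y (q.post h).buf = cnt y (nth S.levels h).buf := by omega
    rw [charge, hrem, harr, hst, hcnt, hji]
    simp
  · have hcap := cap_nonneg (P := P) (h := h) (j := j) hR
    have hmono := cap_mono (h := h) (R := R) hP hi
    have hmw := markedWeight_nonneg (P := P) (J := J) (h := h) (j := i) hR (q.post h).state
      (cnt y (q.post h).buf)
    have h2 : (0 : ℝ) < 2 ^ h := by positivity
    have hsum : (cnt y (nth S.levels h).buf : ℝ) + q.arrivals y h =
        cnt y (q.post h).buf + q.removed y h := by exact_mod_cast (by omega)
    have hpn : (0 : ℝ) ≤ cnt y (q.post h).buf := Nat.cast_nonneg _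
    have hhalf := P.half_B_real j
    -- a compaction that removes items at most `y` finds more than half a buffer of them
    have hrem : 0 < q.removed y h → P.B j / 2 < cnt y (q.mid h).buf := by
      intro h0
      rcases hr : q.rule h (q.mid h) with _ | s
      · rw [Pass.removed_eq_zero hr] at h0
        omega
      · have h3 : s = P.B j / 2 := (preparePass_rule_eq_some hr).2.1
        rw [Pass.removed_eq hr, h3] at h0
        omega
    rw [hsum]
    by_cases hreg : 2 ^ h * (P.B j : ℝ) ≤ 4 * R
    · have hc2 := two_mul_cap_le hP hR hji hreg
      have hB := mul_k_le hP j
      have hk : P.k j ≤ (J j + 1) * P.k j := Nat.le_mul_of_pos_left _ (Nat.succ_pos _)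
      have hmk : P.k j * (marked (P.B j) (P.k j) (J j + 1) (nth S.levels h).state
          (cnt y (nth S.levels h).buf)).card ≤ (J j + 1) * P.k j := by
        rw [mul_comm]
        exact Nat.mul_le_mul_right _ (card_marked_le _ _ _ _ _)
      have hpay : (if 0 < q.removed y h then P.k j else 0) +
          P.k j * (marked (P.B j) (P.k j) (J j + 1) (nth S.levels h).state
            (cnt y (nth S.levels h).buf)).card ≤ cnt y (q.mid h).buf := by
        rcases Nat.eq_zero_or_pos (marked (P.B j) (P.k j) (J j + 1) (nth S.levels h).state
            (cnt y (nth S.levels h).buf)).card with hm | hm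
        · rw [hm, mul_zero, add_zero]
          split_ifs with h0
          · have := hrem h0
            omega
          · omega
        · have := le_add_mul_of_marked_pos hm
          split_ifs <;> omega
      have hpay' : ((if 0 < q.removed y h then (P.k j : ℝ) else 0) +
          P.k j * (marked (P.B j) (P.k j) (J j + 1) (nth S.levels h).state
            (cnt y (nth S.levels h).buf)).card) ≤ cnt y (q.post h).buf + q.removed y h := by
        rw [← hsum]
        have : ((if 0 < q.removed y h then (P.k j : ℝ) else 0)) =
          ((if 0 < q.removed y h then P.k j else 0 : ℕ) : ℝ) := by split_ifs <;> simp
        rw [this]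
        exact_mod_cast hpay.trans hmid.le
      have hch : charge P y h j q =
          cap P R h j * (if 0 < q.removed y h then (P.k j : ℝ) else 0) := by
        rw [charge, cap_eq hR hreg]
        split_ifs <;> ring
      have hcr : credit P R h i ≤ credit P R h j - 3 * cap P R h j := by
        unfold credit
        linarith
      rw [hch, credit_succ hR hreg, markedWeight, if_pos hreg]
      have h3 := mul_le_mul_of_nonneg_left hpay' hcap
      have h4 := mul_le_mul_of_nonneg_left hcr hpn
      have h5 : 0 ≤ cap P R h j * (cnt y (q.post h).buf + q.removed y h) := by positivity
      rw [mul_add] at h3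
      nlinarith
    · -- the level is too high for a compaction to remove items at most `y`
      have hrem0 : q.removed y h = 0 := by
        by_contra h0
        have h3 := hrem (Nat.pos_of_ne_zero h0)
        have h4 : ((P.B j / 2 : ℕ) : ℝ) ≤ cnt y (q.mid h).buf := by exact_mod_cast h3.le
        rw [hhalf] at h4
        apply hreg
        nlinarith
      have hcr : credit P R h i ≤ credit P R h j := by
        unfold credit
        linarith
      rw [charge, hrem0, markedWeight, if_neg hreg]
      simp only [lt_irrefl, if_false, Nat.cast_zero, zero_mul, add_zero, zero_add]
      have := mul_le_mul_of_nonneg_left hcr hpn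
      linarith

theorem half_B_le_protect (hP : P.Adequate J) {i s : ℕ} (hs : s < 2 ^ J i) :
    P.B i / 2 ≤ protect P i s := by
  have h1 := mul_k_le hP i
  have h2 : (trailingOnes s + 1) * P.k i ≤ (J i + 1) * P.k i :=
    Nat.mul_le_mul_right _ (by have := trailingOnes_le_of_lt hs; omega)
  unfold protect
  omega

theorem credit_scheduled (hP : P.Adequate J) (hR : 0 ≤ R) {i : ℕ} {q : Pass U}
    (hq : q.rule = scheduledRule P i) {s₀ s₁ I₀ I₁ : ℕ} (hs : (q.levels h).state = s₀ ||| s₁)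
    (hs₀ : s₀ < 2 ^ J i) (hs₁ : s₁ < 2 ^ J i) (hI : I₀ + I₁ ≤ cnt y (q.mid h).buf)
    (hgood : 2 ^ h * (cnt y (q.mid h).buf : ℝ) ≤ 2 * R) :
    charge P y h i q + q.removed y h * credit P R (h + 1) i +
        cnt y (q.post h).buf * credit P R h i +
        (markedWeight P J R h i s₀ I₀ + markedWeight P J R h i s₁ I₁) ≤
      cnt y (q.mid h).buf * credit P R h i +
        markedWeight P J R h i (q.post h).state (cnt y (q.post h).buf) := by
  have hcap := cap_nonneg (P := P) (h := h) (j := i) hR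
  have hpost := q.cnt_post_add_removed y h
  have hsum : (cnt y (q.mid h).buf : ℝ) = cnt y (q.post h).buf + q.removed y h := by
    exact_mod_cast hpost.symm
  have hslt : s₀ ||| s₁ < 2 ^ J i := Nat.or_lt_two_pow hs₀ hs₁
  have hms : (q.mid h).state = s₀ ||| s₁ := hs
  have hst := q.state_post h
  rw [hs] at hst
  have hB := mul_k_le hP i
  by_cases hreg : 2 ^ h * (P.B i : ℝ) ≤ 4 * R
  · have hmarks : P.k i * ((if 0 < q.removed y h then 1 else 0) +
        ((marked (P.B i) (P.k i) (J i + 1) s₀ I₀).card +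
          (marked (P.B i) (P.k i) (J i + 1) s₁ I₁).card)) ≤
        2 * q.removed y h + P.k i * (marked (P.B i) (P.k i) (J i + 1) (q.post h).state
          (cnt y (q.post h).buf)).card := by
      have hmerge := card_marked_add_le (k := P.k i) (q := J i + 1) (B := P.B i) (s₀ := s₀)
        (s₁ := s₁) (by omega) hI
      have hle := cnt_le_card y (q.mid h).buf
      rcases hr : q.rule h (q.mid h) with _ | s
      · have hcard : (q.mid h).buf.card < P.B i := by
          rw [hq] at hr
          unfold scheduledRule at hr
          split_ifs at hr with h1
          exact not_le.1 h1
        have hcnt : cnt y (q.post h).buf = cnt y (q.mid h).buf := by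
          rw [Pass.removed_eq_zero hr] at hpost
          omega
        rw [Pass.active_eq_zero hr, add_zero] at hst
        rw [Pass.removed_eq_zero hr, hcnt, hst, if_neg (lt_irrefl _), zero_add, mul_zero, zero_add]
        rcases hmerge with hm | hm
        · exact Nat.mul_le_mul_left _ hm
        · omega
      · have hact : q.active h = 1 := by rw [Pass.active, hr]; rfl
        have hrem := Pass.removed_eq hr y
        have hcp := Pass.cnt_post hr y
        rw [hact] at hst
        rw [hq] at hr
        obtain ⟨hcard, rfl⟩ := scheduledRule_eq_some hr
        rw [hms, protect] at hrem hcp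
        have hcomp := card_marked_compact (I := cnt y (q.mid h).buf) (P.k_pos i)
          (by omega : (J i + 1) * P.k i ≤ P.B i) hslt
        rw [← hrem, ← hcp, ← hst, mul_add] at hcomp
        rw [mul_add]
        rcases hmerge with hm | hm
        · have := Nat.mul_le_mul_left (P.k i) hm
          omega
        · -- the items beyond the capacity of the buffer are removed
          have : cnt y (q.mid h).buf ≤ P.B i + q.removed y h := by omega
          omega
    have hmarks' : (P.k i : ℝ) * ((if 0 < q.removed y h then 1 else 0) +
        ((marked (P.B i) (P.k i) (J i + 1) s₀ I₀).card +
          (marked (P.B i) (P.k i) (J i + 1) s₁ I₁).card)) ≤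
        2 * q.removed y h + P.k i * (marked (P.B i) (P.k i) (J i + 1) (q.post h).state
          (cnt y (q.post h).buf)).card := by
      have : ((if 0 < q.removed y h then (1 : ℝ) else 0)) =
        ((if 0 < q.removed y h then 1 else 0 : ℕ) : ℝ) := by split_ifs <;> simp
      rw [this]
      exact_mod_cast hmarks
    have hch : charge P y h i q =
        cap P R h i * (P.k i * (if 0 < q.removed y h then 1 else 0)) := by
      rw [charge, cap_eq hR hreg]
      split_ifs <;> ring
    rw [hch, credit_succ hR hreg, hsum]
    simp only [markedWeight, if_pos hreg]
    have h3 := mul_le_mul_of_nonneg_left hmarks' hcap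
    have h4 : 0 ≤ cap P R h i * q.removed y h := by positivity
    nlinarith
  · have hrem0 : q.removed y h = 0 := by
      rcases hr : q.rule h (q.mid h) with _ | s
      · exact Pass.removed_eq_zero hr y
      · rw [Pass.removed_eq hr]
        rw [hq] at hr
        obtain ⟨_, rfl⟩ := scheduledRule_eq_some hr
        rw [hms]
        have h1 := half_B_le_protect hP hslt
        by_contra h0
        have h4 : ((P.B i / 2 : ℕ) : ℝ) ≤ cnt y (q.mid h).buf := by exact_mod_cast (by omega)
        rw [P.half_B_real] at h4
        have h2 : (0 : ℝ) < 2 ^ h := by positivity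
        apply hreg
        nlinarith
    rw [hsum, charge, hrem0]
    simp only [markedWeight, if_neg hreg, lt_irrefl, if_false, Nat.cast_zero, zero_mul, add_zero,
      zero_add, le_refl]

/-- The total credit of the items at most `y` that arrive at level `h`. -/
noncomputable def creditArrived (P : RCSchedule) (R : ℝ) (ω : Coin → Bool) (p : List Bool)
    (t : MergeTree U) (y : U) (h : ℕ) : ℝ :=
  (if h = 0 then t.rank y * (32 * R) else 0) +
    t.passSum p fun ν a => (nodePass P ω ν a).arrivals y h * credit P R h (nodeStage P ν a)

variable (ω : Coin → Bool)

theorem cnt_mid_le_arrived (p : List Bool) (l r : MergeTree U) (a : Fin 3) :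
    (cnt y ((nodePass P ω ⟨p, l, r⟩ a).mid h).buf : ℝ) ≤ arrived P ω p (.node l r) y h := by
  have hn : ∀ a, (0 : ℝ) ≤ (nodePass P ω ⟨p, l, r⟩ a).arrivals y h := fun a => Nat.cast_nonneg _
  have el := arrived_eq P ω y h l (false :: p)
  have er := arrived_eq P ω y h r (true :: p)
  have rl := removedTotal_nonneg P ω y h (false :: p) l
  have rr := removedTotal_nonneg P ω y h (true :: p) r
  have al := arrived_nonneg P ω y h l (false :: p)
  have ar := arrived_nonneg P ω y h r (true :: p)
  have hm : ∀ a, (cnt y ((nodePass P ω ⟨p, l, r⟩ a).mid h).buf : ℝ) =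
      cnt y ((nodePass P ω ⟨p, l, r⟩ a).levels h).buf +
        (nodePass P ω ⟨p, l, r⟩ a).arrivals y h := by
    intro a
    exact_mod_cast (nodePass P ω ⟨p, l, r⟩ a).cnt_mid y h
  match a with
  | 0 =>
    have h0 : (cnt y ((nodePass P ω ⟨p, l, r⟩ 0).levels h).buf : ℝ) =
      stored P ω (false :: p) l y h := rfl
    rw [hm 0, h0, arrived_node]
    linarith [hn 0, hn 1, hn 2]
  | 1 =>
    have h0 : (cnt y ((nodePass P ω ⟨p, l, r⟩ 1).levels h).buf : ℝ) =
      stored P ω (true :: p) r y h := rfl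
    rw [hm 1, h0, arrived_node]
    linarith [hn 0, hn 1, hn 2]
  | 2 =>
    have h2 := stored_node P ω y h p l r
    have h3 := arrived_eq P ω y h (.node l r) p
    rw [removedTotal, MergeTree.passSum_node, ← removedTotal, ← removedTotal] at h3
    linarith [Nat.cast_nonneg (α := ℝ) ((nodePass P ω ⟨p, l, r⟩ 0).removed y h),
      Nat.cast_nonneg (α := ℝ) ((nodePass P ω ⟨p, l, r⟩ 1).removed y h)]

/-- At a fixed level, the charges are paid from the difference of the credit of the arriving items
and the credit that the removed items need at the next level. The items that are stored keep their
credit, and pay for the compactions behind the marked bits when the stage changes. -/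
theorem credit_invariant (hP : P.Adequate J) (hR : 0 ≤ R) : ∀ (t : MergeTree U) (p : List Bool),
    2 ^ h * arrived P ω p t y h ≤ 2 * R →
    (t.passSum p fun ν a => charge P y h (nodeStage P ν a) (nodePass P ω ν a) +
          (nodePass P ω ν a).removed y h * credit P R (h + 1) (nodeStage P ν a)) +
        stored P ω p t y h * credit P R h (P.stage t.size) ≤
      creditArrived P R ω p t y h +
        markedWeight P J R h (P.stage t.size) (nth (build P ω p t).levels h).state
          (stored P ω p t y h)
  | .leaf x, p, _ => by
    have h1 := markedWeight_nonneg (P := P) (J := J) (h := h)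
      (j := P.stage (MergeTree.leaf x).size) hR (nth (build P ω p (.leaf x)).levels h).state
      (stored P ω p (.leaf x) y h)
    have h2 := credit_le (P := P) (h := h) (j := P.stage (MergeTree.leaf x).size) hR
    rw [creditArrived, MergeTree.passSum_leaf, MergeTree.passSum_leaf]
    have h3 : (stored P ω p (.leaf x) y h : ℝ) * credit P R h (P.stage (MergeTree.leaf x).size) ≤
        (if h = 0 then ((MergeTree.leaf x).rank y : ℝ) * (32 * R) else 0) := by
      rw [stored_leaf]
      split_ifs
      · gcongr
      · rw [zero_mul]
    linarith
  | .node l r, p, hgood => by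
    obtain ⟨al, ar⟩ := arrived_le_node P ω y h p l r
    have h2 : (0 : ℝ) < 2 ^ h := by positivity
    have il := credit_invariant hP hR l (false :: p) (by nlinarith)
    have ir := credit_invariant hP hR r (true :: p) (by nlinarith)
    have hmid : ∀ a, 2 ^ h * (cnt y ((nodePass P ω ⟨p, l, r⟩ a).mid h).buf : ℝ) ≤ 2 * R := fun a =>
      (mul_le_mul_of_nonneg_left (cnt_mid_le_arrived ω p l r a) h2.le).trans hgood
    have e0 := nodePass_zero P ω ⟨p, l, r⟩
    have e1 := nodePass_one P ω ⟨p, l, r⟩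
    simp only at e0 e1
    have c0 := credit_prepare (i := P.stage (l.size + r.size)) (coin := fun h => ω (p, 0, h))
      (S := build P ω (false :: p) l) hP hR
      (by rw [build_n]; exact P.stage_mono (Nat.le_add_right _ _))
      (by have := hmid 0; rwa [e0] at this)
    have c1 := credit_prepare (i := P.stage (l.size + r.size)) (coin := fun h => ω (p, 1, h))
      (S := build P ω (true :: p) r) hP hR
      (by rw [build_n]; exact P.stage_mono (Nat.le_add_left _ _))
      (by have := hmid 1; rwa [e1] at this)
    rw [build_n, ← e0] at c0
    rw [build_n, ← e1] at c1
    have hstate := state_prepared_le P ω p l r h (state_le_compactions P ω h l _)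
      (state_le_compactions P ω h r _)
    have hlt := compactions_lt_two_pow ω hP h (.node l r) p
    rw [MergeTree.size_node] at hlt
    have hs0 : ((nodePass P ω ⟨p, l, r⟩ 0).post h).state < 2 ^ J (P.stage (l.size + r.size)) := by
      have h3 : (((nodePass P ω ⟨p, l, r⟩ 0).post h).state : ℝ) <
          2 ^ J (P.stage (l.size + r.size)) := by
        linarith [Nat.cast_nonneg (α := ℝ) ((nodePass P ω ⟨p, l, r⟩ 1).post h).state,
          Nat.cast_nonneg (α := ℝ) ((nodePass P ω ⟨p, l, r⟩ 2).active h)]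
      exact_mod_cast h3
    have hs1 : ((nodePass P ω ⟨p, l, r⟩ 1).post h).state < 2 ^ J (P.stage (l.size + r.size)) := by
      have h3 : (((nodePass P ω ⟨p, l, r⟩ 1).post h).state : ℝ) <
          2 ^ J (P.stage (l.size + r.size)) := by
        linarith [Nat.cast_nonneg (α := ℝ) ((nodePass P ω ⟨p, l, r⟩ 0).post h).state,
          Nat.cast_nonneg (α := ℝ) ((nodePass P ω ⟨p, l, r⟩ 2).active h)]
      exact_mod_cast h3
    have hmm := cnt_mid_merged P ω y h p l r
    have c2 := credit_scheduled (h := h) (y := y)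
      (I₀ := cnt y ((nodePass P ω ⟨p, l, r⟩ 0).post h).buf)
      (I₁ := cnt y ((nodePass P ω ⟨p, l, r⟩ 1).post h).buf) (q := nodePass P ω ⟨p, l, r⟩ 2) hP hR
      (nodePass_two_rule P ω ⟨p, l, r⟩) (nodePass_two_state P ω ⟨p, l, r⟩ h) hs0 hs1
      (by rw [hmm]; exact Nat.le_add_right _ _) (hmid 2)
    have hmmr : (cnt y ((nodePass P ω ⟨p, l, r⟩ 2).mid h).buf : ℝ) =
      cnt y ((nodePass P ω ⟨p, l, r⟩ 0).post h).buf +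
      cnt y ((nodePass P ω ⟨p, l, r⟩ 1).post h).buf +
        (nodePass P ω ⟨p, l, r⟩ 2).arrivals y h := by exact_mod_cast hmm
    rw [hmmr] at c2
    have hst : stored P ω p (.node l r) y h =
        cnt y ((nodePass P ω ⟨p, l, r⟩ 2).post h).buf := by
      rw [stored, nth_build_node]
    have hca : creditArrived P R ω p (.node l r) y h =
        creditArrived P R ω (false :: p) l y h + creditArrived P R ω (true :: p) r y h +
        (nodePass P ω ⟨p, l, r⟩ 0).arrivals y h * credit P R h (P.stage l.size) +
        (nodePass P ω ⟨p, l, r⟩ 1).arrivals y h * credit P R h (P.stage r.size) +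
        (nodePass P ω ⟨p, l, r⟩ 2).arrivals y h * credit P R h (P.stage (l.size + r.size)) := by
      simp only [creditArrived, MergeTree.passSum_node, MergeTree.rank_node, nodeStage]
      push_cast
      split_ifs <;> ring
    rw [MergeTree.passSum_node, hca, hst, nth_build_node, MergeTree.size_node]
    have n0 : nodeStage P ⟨p, l, r⟩ 0 = P.stage l.size := rfl
    have n1 : nodeStage P ⟨p, l, r⟩ 1 = P.stage r.size := rfl
    have n2 : nodeStage P ⟨p, l, r⟩ 2 = P.stage (l.size + r.size) := rfl
    rw [n0, n1, n2]
    simp only [stored] at il ir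
    dsimp only at c2
    linarith

/-- The sum of the charges at a level in terms of the credit that arrives there and at the next
level. -/
theorem charge_add_le (hP : P.Adequate J) (hR : 0 ≤ R) (t : MergeTree U) (p : List Bool)
    (hgood : 2 ^ h * arrived P ω p t y h ≤ 2 * R) :
    (t.passSum p fun ν a => charge P y h (nodeStage P ν a) (nodePass P ω ν a)) +
        2 * creditArrived P R ω p t y (h + 1) ≤
      creditArrived P R ω p t y h + t.passSum p fun ν a =>
        sgn (ω (ν.path, a, h)) * oddInd ((nodePass P ω ν a).removed y h) *
          credit P R (h + 1) (nodeStage P ν a) := by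
  have h1 := credit_invariant ω hP hR t p hgood
  have h2 := markedWeight_le (P := P) (h := h) (j := P.stage t.size) hP hR
    (nth (build P ω p t).levels h).state (stored P ω p t y h)
  have h3 : 2 * creditArrived P R ω p t y (h + 1) = (t.passSum p fun ν a =>
      (nodePass P ω ν a).removed y h * credit P R (h + 1) (nodeStage P ν a)) +
      t.passSum p fun ν a => sgn (ω (ν.path, a, h)) * oddInd ((nodePass P ω ν a).removed y h) *
          credit P R (h + 1) (nodeStage P ν a) := by
    rw [creditArrived, if_neg (Nat.succ_ne_zero h), zero_add, ← MergeTree.passSum_mul_left,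
      ← MergeTree.passSum_add]
    refine MergeTree.passSum_congr fun ν _ a => ?_
    rw [← mul_assoc, Pass.two_mul_arrivals_succ, nodePass_coin]
    ring
  rw [MergeTree.passSum_add] at h1
  linarith

/-- The number of passes that round at level `h`. -/
def roundings (P : RCSchedule) (ω : Coin → Bool) (p : List Bool) (t : MergeTree U) (y : U)
    (h : ℕ) : ℝ := t.passSum p fun ν a => oddInd ((nodePass P ω ν a).removed y h)

/-- The rounding errors at level `h`, weighted with the relative credit of the items. -/
noncomputable def creditNoise (P : RCSchedule) (R : ℝ) (ω : Coin → Bool) (p : List Bool)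
    (t : MergeTree U) (y : U) (h : ℕ) : ℝ := t.passSum p fun ν a =>
  sgn (ω (ν.path, a, h)) * (oddInd ((nodePass P ω ν a).removed y h) *
    (credit P R (h + 1) (nodeStage P ν a) / (32 * R)))

/-- As long as no level receives more than twice the expected number of items at most `y`, the
variance of the estimate is at most proportional to `R ^ 2`, up to a martingale. -/
theorem sum_roundings_le (hP : P.Adequate J) {K : ℝ} (hK : ∀ i, K ≤ P.k i * P.B i)
    (t : MergeTree U) (p : List Bool) (hpos : 0 < t.rank y) {H : ℕ}
    (hgood : ∀ h < H, 2 ^ h * arrived P ω p t y h ≤ 2 * t.rank y) :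
    K * ∑ h ∈ Finset.range H, (2 ^ h) ^ 2 * roundings P ω p t y h ≤
      32 * t.rank y * (t.rank y +
        ∑ h ∈ Finset.range H, 2 ^ h * creditNoise P (t.rank y) ω p t y h) := by
  set R : ℝ := (t.rank y : ℝ) with hRdef
  have hR : 0 < R := Nat.cast_pos.2 hpos
  have key : ∀ H : ℕ, (∀ h < H, 2 ^ h * arrived P ω p t y h ≤ 2 * R) →
      K * ∑ h ∈ Finset.range H, (2 ^ h) ^ 2 * roundings P ω p t y h +
        2 ^ H * creditArrived P R ω p t y H ≤ 32 * R * (R +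
        ∑ h ∈ Finset.range H, 2 ^ h * creditNoise P R ω p t y h) := by
    intro H
    induction H with
    | zero =>
      intro _
      have h0 : (t.passSum p fun ν a =>
          ((nodePass P ω ν a).arrivals y 0 : ℝ) * credit P R 0 (nodeStage P ν a)) = 0 :=
        (MergeTree.passSum_congr fun ν _ a => by
          rw [Pass.arrivals_zero, Nat.cast_zero, zero_mul]).trans (by simp [MergeTree.passSum])
      rw [creditArrived, if_pos rfl, h0]
      simp only [Finset.range_zero, Finset.sum_empty, ← hRdef]
      linarith
    | succ H ih =>
      intro hg
      have ih' := ih fun h hh => hg h (hh.trans (Nat.lt_succ_self H))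
      have hc := charge_add_le ω hP hR.le t p (hg H (Nat.lt_succ_self H))
      have hnoise : (t.passSum p fun ν a =>
          sgn (ω (ν.path, a, H)) * oddInd ((nodePass P ω ν a).removed y H) *
            credit P R (H + 1) (nodeStage P ν a)) = 32 * R * creditNoise P R ω p t y H := by
        rw [creditNoise, ← MergeTree.passSum_mul_left]
        refine MergeTree.passSum_congr fun ν _ a => ?_
        field_simp
      have hch : K * 2 ^ H * roundings P ω p t y H ≤
          t.passSum p fun ν a => charge P y H (nodeStage P ν a) (nodePass P ω ν a) := by
        rw [roundings, ← MergeTree.passSum_mul_left]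
        refine MergeTree.passSum_le fun ν _ a => ?_
        have h2 : (0 : ℝ) < 2 ^ H := by positivity
        unfold charge oddInd
        split_ifs with h3 h4 h4
        · have := hK (nodeStage P ν a)
          nlinarith
        · exact absurd (Odd.pos h3) h4
        · rw [mul_zero]
          positivity
        · rw [mul_zero]
      rw [hnoise] at hc
      have h2 : (0 : ℝ) < 2 ^ H := by positivity
      have h3 := mul_le_mul_of_nonneg_left ((add_le_add_left hch _).trans hc) h2.le
      rw [Finset.sum_range_succ, Finset.sum_range_succ, pow_succ (2 : ℝ) H]
      linarith
  have h1 := key H hgood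
  have h2 : 0 ≤ creditArrived P R ω p t y H := by
    unfold creditArrived
    refine add_nonneg (by split_ifs <;> positivity) (MergeTree.passSum_nonneg fun ν _ a => ?_)
    exact mul_nonneg (Nat.cast_nonneg _) (credit_nonneg hR.le)
  have h3 : 0 ≤ 2 ^ H * creditArrived P R ω p t y H := by positivity
  linarith

end RCSketch

/-! ### Sums of coins that are weighted by lower coins -/

section Coins

open MeasureTheory

/-- The outcomes of the coins with the outcome of the coin `c` reversed. -/
def flipCoin (c : Coin) (ω : Coin → Bool) : Coin → Bool := Function.update ω c (!ω c)

theorem flipCoin_self (c : Coin) (ω : Coin → Bool) : flipCoin c ω c = !ω c := by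
  simp [flipCoin]

theorem flipCoin_of_ne {c c' : Coin} (h : c' ≠ c) (ω : Coin → Bool) : flipCoin c ω c' = ω c' := by
  simp [flipCoin, h]

theorem flipCoin_flipCoin (c : Coin) (ω : Coin → Bool) : flipCoin c (flipCoin c ω) = ω := by
  funext c'
  by_cases h : c' = c
  · rw [h, flipCoin_self, flipCoin_self, Bool.not_not]
  · rw [flipCoin_of_ne h, flipCoin_of_ne h]

theorem measurable_flipCoin (c : Coin) : Measurable (flipCoin c) := by
  refine measurable_pi_lambda _ fun c' => ?_
  by_cases h : c' = c
  · subst h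
    simp only [flipCoin_self]
    exact (measurable_of_finite Bool.not).comp (measurable_pi_apply c')
  · simp only [flipCoin_of_ne h]
    exact measurable_pi_apply c'

instance : IsProbabilityMeasure coinMeasure := by
  unfold coinMeasure
  infer_instance

theorem map_not_uniform : (PMF.uniformOfFintype Bool).toMeasure.map Bool.not =
    (PMF.uniformOfFintype Bool).toMeasure := by
  have hm : Measurable Bool.not := measurable_of_finite _
  refine Measure.ext_of_singleton fun b => ?_
  rw [Measure.map_apply hm (measurableSet_singleton b)]
  have : Bool.not ⁻¹' {b} = {!b} := by
    ext x
    cases x <;> cases b <;> simp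
  rw [this, PMF.toMeasure_apply_singleton _ _ (measurableSet_singleton _),
    PMF.toMeasure_apply_singleton _ _ (measurableSet_singleton _)]
  simp

theorem map_flipCoin (c : Coin) : coinMeasure.map (flipCoin c) = coinMeasure := by
  classical
  have h1 := Measure.infinitePi_map_pi (μ := fun _ : Coin => (PMF.uniformOfFintype Bool).toMeasure)
    (f := fun i => if i = c then Bool.not else id) (fun i => measurable_of_finite _)
  have h2 : (fun (x : Coin → Bool) i => (if i = c then Bool.not else id) (x i)) = flipCoin c := by
    funext x i
    by_cases h : i = c
    · subst h
      simp [flipCoin_self]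
    · simp [flipCoin_of_ne h, h]
  rw [h2] at h1
  unfold coinMeasure
  rw [h1]
  congr 1
  funext i
  split_ifs
  · exact map_not_uniform
  · exact Measure.map_id

/-- The outcomes of the coins with one coin reversed, as an equivalence. -/
def flipEquiv (c : Coin) : (Coin → Bool) ≃ᵐ (Coin → Bool) where
  toFun := flipCoin c
  invFun := flipCoin c
  left_inv := flipCoin_flipCoin c
  right_inv := flipCoin_flipCoin c
  measurable_toFun := measurable_flipCoin c
  measurable_invFun := measurable_flipCoin c

theorem lintegral_flipCoin (c : Coin) (f : (Coin → Bool) → ENNReal) :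
    ∫⁻ ω, f (flipCoin c ω) ∂coinMeasure = ∫⁻ ω, f ω ∂coinMeasure := by
  conv_rhs => rw [← map_flipCoin c]
  exact (lintegral_map_equiv f (flipEquiv c)).symm

theorem exp_add_exp_le (T a : ℝ) (b : Bool) :
    Real.exp (sgn b * a - a ^ 2 / 2 + T) + Real.exp (sgn (!b) * a - a ^ 2 / 2 + T) ≤
      2 * Real.exp T := by
  have h1 := Real.cosh_le_exp_half_sq a
  have h2 : Real.exp (a - a ^ 2 / 2 + T) + Real.exp (-a - a ^ 2 / 2 + T) =
      2 * Real.cosh a * (Real.exp (-(a ^ 2 / 2)) * Real.exp T) := by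
    rw [Real.cosh_eq, ← Real.exp_add]
    have e1 : Real.exp (a - a ^ 2 / 2 + T) = Real.exp a * Real.exp (-(a ^ 2 / 2) + T) := by
      rw [← Real.exp_add]
      ring_nf
    have e2 : Real.exp (-a - a ^ 2 / 2 + T) = Real.exp (-a) * Real.exp (-(a ^ 2 / 2) + T) := by
      rw [← Real.exp_add]
      ring_nf
    rw [e1, e2]
    ring
  have h3 : 2 * Real.cosh a * (Real.exp (-(a ^ 2 / 2)) * Real.exp T) ≤ 2 * Real.exp T := by
    calc 2 * Real.cosh a * (Real.exp (-(a ^ 2 / 2)) * Real.exp T)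
        ≤ 2 * Real.exp (a ^ 2 / 2) * (Real.exp (-(a ^ 2 / 2)) * Real.exp T) := by gcongr
      _ = 2 * Real.exp T := by
        rw [Real.exp_neg]
        field_simp
  cases b
  · simp only [sgn, Bool.not_false, Bool.false_eq_true, if_false, if_true, one_mul, neg_mul]
    linarith
  · simp only [sgn, Bool.not_true, Bool.false_eq_true, if_false, if_true, one_mul, neg_mul]
    linarith

/-- The exponential supermartingale of a sum of coins, each with a weight that depends only on
coins of lower levels. Averaging over a coin of the highest level and its reversal removes this
coin from the sum. -/
theorem lintegral_exp_sum_le_one {ι : Type*} (coin : ι → Coin)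
    (a : ι → (Coin → Bool) → ℝ) (F : Finset ι) (hinj : Set.InjOn coin F)
    (ha : ∀ i ∈ F, ∀ ω ω', (∀ c : Coin, c.2.2 < (coin i).2.2 → ω c = ω' c) → a i ω = a i ω') :
    ∫⁻ ω, ENNReal.ofReal (Real.exp (∑ i ∈ F, (sgn (ω (coin i)) * a i ω - a i ω ^ 2 / 2)))
      ∂coinMeasure ≤ 1 := by
  classical
  induction F using Finset.induction_on_max_value (fun i => (coin i).2.2) with
  | empty => simp
  | insert j s hj hmax ih =>
    have hjF : j ∈ insert j s := Finset.mem_insert_self _ _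
    have ih' := ih (hinj.mono (by simp))
      (fun i hi => ha i (Finset.mem_insert_of_mem hi))
    have hne : ∀ i ∈ s, coin i ≠ coin j := by
      intro i hi h
      exact hj (hinj (Finset.mem_insert_of_mem hi) hjF h ▸ hi)
    -- no weight depends on the coin of `j`
    have hinv : ∀ i ∈ insert j s, ∀ ω, a i (flipCoin (coin j) ω) = a i ω := by
      intro i hi ω
      refine ha i hi _ _ fun c hc => flipCoin_of_ne ?_ ω
      rintro rfl
      rcases Finset.mem_insert.1 hi with rfl | hi
      · exact lt_irrefl _ hc
      · exact absurd (hmax i hi) (not_le.2 hc)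
    set T : (Coin → Bool) → ℝ :=
      fun ω => ∑ i ∈ s, (sgn (ω (coin i)) * a i ω - a i ω ^ 2 / 2) with hT
    have hTf : ∀ ω, T (flipCoin (coin j) ω) = T ω := by
      intro ω
      refine Finset.sum_congr rfl fun i hi => ?_
      rw [hinv i (Finset.mem_insert_of_mem hi), flipCoin_of_ne (hne i hi)]
    set G : (Coin → Bool) → ENNReal := fun ω =>
      ENNReal.ofReal (Real.exp (∑ i ∈ insert j s, (sgn (ω (coin i)) * a i ω - a i ω ^ 2 / 2)))
      with hG
    have hGT : ∀ ω, G ω =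
        ENNReal.ofReal (Real.exp (sgn (ω (coin j)) * a j ω - a j ω ^ 2 / 2 + T ω)) := by
      intro ω
      rw [hG]
      simp only [Finset.sum_insert hj]
      rfl
    have hpt : ∀ ω, G ω + G (flipCoin (coin j) ω) ≤ 2 * ENNReal.ofReal (Real.exp (T ω)) := by
      intro ω
      rw [hGT, hGT, hTf, hinv j hjF, flipCoin_self, ← ENNReal.ofReal_add (by positivity)
        (by positivity)]
      have h2 : (2 : ENNReal) = ENNReal.ofReal 2 := by simp
      rw [h2, ← ENNReal.ofReal_mul (by norm_num)]
      exact ENNReal.ofReal_le_ofReal (exp_add_exp_le _ _ _)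
    have h2 : 2 * ∫⁻ ω, G ω ∂coinMeasure ≤ 2 * 1 := by
      calc 2 * ∫⁻ ω, G ω ∂coinMeasure
          = ∫⁻ ω, G ω ∂coinMeasure + ∫⁻ ω, G (flipCoin (coin j) ω) ∂coinMeasure := by
            rw [lintegral_flipCoin, two_mul]
        _ ≤ ∫⁻ ω, (G ω + G (flipCoin (coin j) ω)) ∂coinMeasure := le_lintegral_add _ _
        _ ≤ ∫⁻ ω, 2 * ENNReal.ofReal (Real.exp (T ω)) ∂coinMeasure := lintegral_mono hpt
        _ = 2 * ∫⁻ ω, ENNReal.ofReal (Real.exp (T ω)) ∂coinMeasure :=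
            lintegral_const_mul' _ _ (by simp)
        _ ≤ 2 * 1 := by gcongr
    exact (ENNReal.mul_le_mul_iff_right (by simp) (by simp)).1 h2

theorem measurable_of_finitely_many_coins {f : (Coin → Bool) → ℝ} (F : Finset Coin)
    (hf : ∀ ω ω', (∀ c ∈ F, ω c = ω' c) → f ω = f ω') : Measurable f := by
  classical
  set g : (F → Bool) → ℝ := fun v => f fun c => if h : c ∈ F then v ⟨c, h⟩ else false with hg
  have h1 : f = g ∘ fun ω (c : F) => ω c := by
    funext ω
    refine hf _ _ fun c hc => ?_
    simp [hc]
  rw [h1]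
  exact (measurable_of_finite g).comp (measurable_pi_lambda _ fun c => measurable_pi_apply _)

theorem coinMeasure_le_exp_neg {X : (Coin → Bool) → ℝ} (hX : Measurable X)
    (h : ∫⁻ ω, ENNReal.ofReal (Real.exp (X ω)) ∂coinMeasure ≤ 1) (x : ℝ) :
    coinMeasure {ω | x ≤ X ω} ≤ ENNReal.ofReal (Real.exp (-x)) := by
  have h1 := mul_meas_ge_le_lintegral (μ := coinMeasure)
    (f := fun ω => ENNReal.ofReal (Real.exp (X ω))) (by fun_prop) (ENNReal.ofReal (Real.exp x))
  have h2 : {ω | ENNReal.ofReal (Real.exp x) ≤ ENNReal.ofReal (Real.exp (X ω))} =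
      {ω | x ≤ X ω} := by
    ext ω
    simp only [Set.mem_ofPred_eq]
    rw [ENNReal.ofReal_le_ofReal_iff (Real.exp_pos _).le, Real.exp_le_exp]
  rw [h2] at h1
  have h3 := h1.trans h
  have h4 : ENNReal.ofReal (Real.exp (-x)) * ENNReal.ofReal (Real.exp x) = 1 := by
    rw [← ENNReal.ofReal_mul (Real.exp_pos _).le, ← Real.exp_add]
    simp
  calc coinMeasure {ω | x ≤ X ω}
      = ENNReal.ofReal (Real.exp (-x)) *
          (ENNReal.ofReal (Real.exp x) * coinMeasure {ω | x ≤ X ω}) := by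
        rw [← mul_assoc, h4, one_mul]
    _ ≤ ENNReal.ofReal (Real.exp (-x)) * 1 := by gcongr
    _ = _ := mul_one _

end Coins

namespace RCSketch

open MeasureTheory

variable {U : Type u} [LinearOrder U]

/-! ### Stopping at the first level that receives too many items -/

theorem arrived_eq_natCast (P : RCSchedule) (ω : Coin → Bool) (y : U) (h : ℕ) (t : MergeTree U)
    (p : List Bool) : ∃ m : ℕ, arrived P ω p t y h = m := by
  induction t generalizing p with
  | leaf x =>
    rw [arrived_leaf]
    split_ifs
    · exact ⟨_, rfl⟩
    · exact ⟨0, by simp⟩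
  | node l r ihl ihr =>
    obtain ⟨a, ha⟩ := ihl (false :: p)
    obtain ⟨b, hb⟩ := ihr (true :: p)
    rw [arrived_node, ha, hb]
    exact ⟨a + b + (nodePass P ω ⟨p, l, r⟩ 0).arrivals y h +
      (nodePass P ω ⟨p, l, r⟩ 1).arrivals y h + (nodePass P ω ⟨p, l, r⟩ 2).arrivals y h,
      by push_cast; rfl⟩

/-- No level up to `h` receives more than twice the expected number of items at most `y`. -/
def Calm (P : RCSchedule) (ω : Coin → Bool) (t : MergeTree U) (y : U) (h : ℕ) : Prop :=
  ∀ g ≤ h, 2 ^ g * arrived P ω [] t y g ≤ 2 * t.rank y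

open scoped Classical in
/-- The rounding errors up to the level where the sketch ceases to be calm, each multiplied by the
weight of an item of its level and by a factor `α`. -/
noncomputable def stoppedNoise (P : RCSchedule) (α : MergeNode U → Fin 3 → ℕ → ℝ) (ω : Coin → Bool)
    (t : MergeTree U) (y : U) (H : ℕ) : ℝ :=
  ∑ h ∈ Finset.range H, if Calm P ω t y h then 2 ^ h * t.passSum [] fun ν a =>
    sgn (ω (ν.path, a, h)) * (oddInd ((nodePass P ω ν a).removed y h) * α ν a h) else 0

open scoped Classical in
/-- The quadratic variation of the rounding errors up to the level where the sketch ceases to be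
calm. -/
noncomputable def stoppedVariation (P : RCSchedule) (ω : Coin → Bool)
    (t : MergeTree U) (y : U) (H : ℕ) : ℝ :=
  ∑ h ∈ Finset.range H, if Calm P ω t y h then (2 ^ h) ^ 2 * roundings P ω [] t y h else 0

variable {P : RCSchedule} {t : MergeTree U} {y : U}

theorem arrived_agree {h : ℕ} {ω ω' : Coin → Bool}
    (hω : ∀ ν ∈ t.nodes [], ∀ a, ∀ g < h, ω (ν.path, a, g) = ω' (ν.path, a, g)) {g : ℕ}
    (hg : g ≤ h) : arrived P ω [] t y g = arrived P ω' [] t y g := by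
  unfold arrived
  congr 1
  refine MergeTree.passSum_congr fun ν hν a => ?_
  rw [(nodePass_agree P h hω hν a).arrivals_eq hg]

theorem calm_agree {h : ℕ} {ω ω' : Coin → Bool}
    (hω : ∀ ν ∈ t.nodes [], ∀ a, ∀ g < h, ω (ν.path, a, g) = ω' (ν.path, a, g)) :
    Calm P ω t y h ↔ Calm P ω' t y h := by
  unfold Calm
  refine forall₂_congr fun g hg => ?_
  rw [arrived_agree hω hg]

open scoped Classical in
/-- The coins used at the levels below `H`. -/
noncomputable def coinsBelow (t : MergeTree U) (H : ℕ) : Finset Coin :=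
  ((t.nodes []).map MergeNode.path).toFinset ×ˢ Finset.univ ×ˢ Finset.range H

theorem mem_coinsBelow {U : Type u} {t : MergeTree U} {H : ℕ} {ν : MergeNode U}
    (hν : ν ∈ t.nodes []) (a : Fin 3) {h : ℕ}
    (hh : h < H) : (ν.path, a, h) ∈ coinsBelow t H := by
  simp only [coinsBelow, Finset.mem_product, List.mem_toFinset, Finset.mem_univ, Finset.mem_range]
  exact ⟨List.mem_map_of_mem hν, trivial, hh⟩

theorem measurable_stoppedNoise (P : RCSchedule) (α : MergeNode U → Fin 3 → ℕ → ℝ)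
    (t : MergeTree U) (y : U) (H : ℕ) : Measurable fun ω => stoppedNoise P α ω t y H := by
  classical
  refine measurable_of_finitely_many_coins (coinsBelow t H) fun ω ω' hω => ?_
  refine Finset.sum_congr rfl fun h hh => ?_
  have hh' := Finset.mem_range.1 hh
  have hω' : ∀ ν ∈ t.nodes [], ∀ a, ∀ g < h, ω (ν.path, a, g) = ω' (ν.path, a, g) :=
    fun ν hν a g hg => hω _ (mem_coinsBelow hν a (hg.trans hh'))
  refine if_congr (calm_agree hω') (congrArg ((2 : ℝ) ^ h * ·) ?_) rfl
  refine MergeTree.passSum_congr fun ν hν a => ?_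
  rw [(nodePass_agree P h hω' hν a).removed_eq le_rfl, hω _ (mem_coinsBelow hν a hh')]

theorem measurable_stoppedVariation (P : RCSchedule) (t : MergeTree U) (y : U) (H : ℕ) :
    Measurable fun ω => stoppedVariation P ω t y H := by
  classical
  refine measurable_of_finitely_many_coins (coinsBelow t H) fun ω ω' hω => ?_
  refine Finset.sum_congr rfl fun h hh => ?_
  have hh' := Finset.mem_range.1 hh
  have hω' : ∀ ν ∈ t.nodes [], ∀ a, ∀ g < h, ω (ν.path, a, g) = ω' (ν.path, a, g) :=
    fun ν hν a g hg => hω _ (mem_coinsBelow hν a (hg.trans hh'))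
  refine if_congr (calm_agree hω') (congrArg (((2 : ℝ) ^ h) ^ 2 * ·) ?_) rfl
  refine MergeTree.passSum_congr fun ν hν a => ?_
  rw [(nodePass_agree P h hω' hν a).removed_eq le_rfl]

/-- The exponential tail bound for the stopped rounding errors. The weight of a coin of level `h`
depends only on the coins of the levels below, because what happens at level `h` does. -/
theorem stoppedNoise_tail (P : RCSchedule) {α : MergeNode U → Fin 3 → ℕ → ℝ}
    (hα : ∀ ν a h, |α ν a h| ≤ 1) (t : MergeTree U) (y : U) (H : ℕ) (l x : ℝ) :
    coinMeasure {ω | x ≤ l * stoppedNoise P α ω t y H -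
      l ^ 2 / 2 * stoppedVariation P ω t y H} ≤ ENNReal.ofReal (Real.exp (-x)) := by
  classical
  set F : Finset (MergeNode U × Fin 3 × ℕ) :=
    (t.nodes []).toFinset ×ˢ Finset.univ ×ˢ Finset.range H with hF
  set coin : MergeNode U × Fin 3 × ℕ → Coin := fun i => (i.1.path, i.2.1, i.2.2) with hcoin
  set w : MergeNode U × Fin 3 × ℕ → (Coin → Bool) → ℝ := fun i ω =>
    if Calm P ω t y i.2.2 then
      l * (2 ^ i.2.2 * (oddInd ((nodePass P ω i.1 i.2.1).removed y i.2.2) * α i.1 i.2.1 i.2.2))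
    else 0 with hw
  have hinj : Set.InjOn coin F := by
    rintro ⟨ν, a, h⟩ hi ⟨ν', a', h'⟩ hi' he
    simp only [hcoin, Prod.mk.injEq] at he
    simp only [hF, Finset.coe_product, Set.mem_prod, Finset.mem_coe, List.mem_toFinset] at hi hi'
    obtain ⟨h1, rfl, rfl⟩ := he
    rw [List.inj_on_of_nodup_map (t.nodup_paths []) hi.1 hi'.1 h1]
  have hwa : ∀ i ∈ F, ∀ ω ω', (∀ c : Coin, c.2.2 < (coin i).2.2 → ω c = ω' c) →
      w i ω = w i ω' := by
    rintro ⟨ν, a, h⟩ hi ω ω' hω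
    simp only [hF, Finset.mem_product, List.mem_toFinset] at hi
    have hω' : ∀ ν ∈ t.nodes [], ∀ a, ∀ g < h, ω (ν.path, a, g) = ω' (ν.path, a, g) :=
      fun ν hν a g hg => hω _ hg
    simp only [hw, calm_agree hω', (nodePass_agree P h hω' hi.1 a).removed_eq le_rfl]
  have hexp := lintegral_exp_sum_le_one coin w F hinj hwa
  have hle : ∀ ω, l * stoppedNoise P α ω t y H - l ^ 2 / 2 * stoppedVariation P ω t y H ≤
      ∑ i ∈ F, (sgn (ω (coin i)) * w i ω - w i ω ^ 2 / 2) := by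
    intro ω
    have hsum : ∑ i ∈ F, (sgn (ω (coin i)) * w i ω - w i ω ^ 2 / 2) =
        ∑ h ∈ Finset.range H, ∑ ν ∈ (t.nodes []).toFinset, ∑ a,
          (sgn (ω (coin (ν, a, h))) * w (ν, a, h) ω - w (ν, a, h) ω ^ 2 / 2) := by
      simp only [hF, Finset.sum_product]
      rw [Finset.sum_comm (s := Finset.range H)]
      exact Finset.sum_congr rfl fun ν _ => Finset.sum_comm
    rw [hsum, stoppedNoise, stoppedVariation, Finset.mul_sum, Finset.mul_sum,
      ← Finset.sum_sub_distrib]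
    refine Finset.sum_le_sum fun h _ => ?_
    by_cases hc : Calm P ω t y h
    · simp only [hw, hcoin, if_pos hc, roundings, MergeTree.passSum_eq_sum, Finset.mul_sum]
      rw [← Finset.sum_sub_distrib]
      refine Finset.sum_le_sum fun ν _ => ?_
      rw [← Finset.sum_sub_distrib]
      refine Finset.sum_le_sum fun a _ => ?_
      have h1 : (oddInd ((nodePass P ω ν a).removed y h) * α ν a h) ^ 2 ≤
          oddInd ((nodePass P ω ν a).removed y h) := by
        have h2 : α ν a h ^ 2 ≤ 1 := by
          rw [← sq_abs]
          exact pow_le_one₀ (abs_nonneg _) (hα ν a h)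
        unfold oddInd
        split_ifs
        · simpa using h2
        · simp
      have h3 : 0 ≤ l ^ 2 / 2 * (2 ^ h) ^ 2 := by positivity
      have h4 := mul_le_mul_of_nonneg_left h1 h3
      nlinarith
    · simp [hw, hcoin, if_neg hc]
  -- the exponent is bounded from below, so that only this bound has to be measurable
  have hle' : ∫⁻ ω, ENNReal.ofReal (Real.exp (l * stoppedNoise P α ω t y H -
      l ^ 2 / 2 * stoppedVariation P ω t y H)) ∂coinMeasure ≤ 1 :=
    (lintegral_mono fun ω => ENNReal.ofReal_le_ofReal (Real.exp_le_exp.2 (hle ω))).trans hexp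
  have hmeas : Measurable fun ω => l * stoppedNoise P α ω t y H -
      l ^ 2 / 2 * stoppedVariation P ω t y H := by
    have h1 := measurable_stoppedNoise P α t y H
    have h2 := measurable_stoppedVariation P t y H
    fun_prop
  exact coinMeasure_le_exp_neg hmeas hle' x

/-- The relative credit that an item removed in a pass keeps. -/
noncomputable def creditFactor (P : RCSchedule) (R : ℝ) (ν : MergeNode U) (a : Fin 3) (h : ℕ) : ℝ :=
  credit P R (h + 1) (nodeStage P ν a) / (32 * R)

theorem abs_creditFactor_le {U : Type u} {P : RCSchedule} {R : ℝ} (hR : 0 ≤ R)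
    (ν : MergeNode U) (a : Fin 3) (h : ℕ) :
    |creditFactor P R ν a h| ≤ 1 := by
  have h1 := credit_nonneg (P := P) (h := h + 1) (j := nodeStage P ν a) hR
  have h2 := credit_le (P := P) (h := h + 1) (j := nodeStage P ν a) hR
  rw [creditFactor, abs_of_nonneg (div_nonneg h1 (by positivity))]
  exact div_le_one_of_le₀ h2 (by positivity)

/-- The levels below `τ` are those up to which the sketch is calm; `τ` is less than `H` only if too
many items arrive at level `τ`. -/
theorem exists_stopping_level (P : RCSchedule) (ω : Coin → Bool) (t : MergeTree U) (y : U)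
    (H : ℕ) : ∃ τ ≤ H, (∀ h < H, Calm P ω t y h ↔ h < τ) ∧
      (2 ^ τ * arrived P ω [] t y τ ≤ 2 * t.rank y → τ = H) := by
  classical
  by_cases hall : ∀ h < H, 2 ^ h * arrived P ω [] t y h ≤ 2 * t.rank y
  · exact ⟨H, le_rfl, fun h hh => ⟨fun _ => hh, fun _ g hg => hall g (hg.trans_lt hh)⟩,
      fun _ => rfl⟩
  · push Not at hall
    have hspec := Nat.find_spec hall
    have hmin := fun h (hh : h < Nat.find hall) => Nat.find_min hall hh
    set τ := Nat.find hall
    refine ⟨τ, hspec.1.le, fun h hh => ⟨fun hc => ?_, fun hlt g hg => ?_⟩, fun h1 => ?_⟩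
    · by_contra hlt
      exact absurd (hc τ (not_lt.1 hlt)) (not_le.2 hspec.2)
    · have := hmin g (hg.trans_lt hlt)
      by_contra hg'
      exact this ⟨(hg.trans_lt hlt).trans hspec.1, not_le.1 hg'⟩
    · exact absurd h1 (not_le.2 hspec.2)

theorem sum_ite_calm {ω : Coin → Bool} {H τ : ℕ} (hτ : τ ≤ H) [DecidablePred (Calm P ω t y)]
    (hcalm : ∀ h < H, Calm P ω t y h ↔ h < τ) (f : ℕ → ℝ) :
    (∑ h ∈ Finset.range H, if Calm P ω t y h then f h else 0) = ∑ h ∈ Finset.range τ, f h := by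
  rw [← Finset.sum_filter]
  congr 1
  ext h
  simp only [Finset.mem_filter, Finset.mem_range]
  constructor
  · rintro ⟨h1, h2⟩
    exact (hcalm h h1).1 h2
  · intro h1
    exact ⟨h1.trans_le hτ, (hcalm h (h1.trans_le hτ)).2 h1⟩

variable {J : ℕ → ℕ}

theorem stoppedVariation_le (hP : P.Adequate J) {K : ℝ} (hK : ∀ i, K ≤ P.k i * P.B i)
    (ω : Coin → Bool) (hpos : 0 < t.rank y) (H : ℕ) :
    K * stoppedVariation P ω t y H ≤ 32 * t.rank y *
      (t.rank y + stoppedNoise P (creditFactor P (t.rank y)) ω t y H) := by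
  classical
  obtain ⟨τ, hτ, hcalm, _⟩ := exists_stopping_level P ω t y H
  have h1 := sum_roundings_le (H := τ) ω hP hK t [] hpos
    fun h hh => (hcalm h (hh.trans_le hτ)).2 hh h le_rfl
  rw [stoppedVariation, stoppedNoise, sum_ite_calm hτ hcalm, sum_ite_calm hτ hcalm]
  exact h1

/-- If the stopped error is less than `R`, then the sketch has been calm at all levels, and the
stopped error is the error of the estimate. -/
theorem estimate_sub_eq (ω : Coin → Bool) {H : ℕ} (hH : 2 * t.rank y < 2 ^ H)
    (hlt : stoppedNoise P (fun _ _ _ => 1) ω t y H ≤ t.rank y) :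
    ((build P ω [] t).estimate y : ℝ) - t.rank y = stoppedNoise P (fun _ _ _ => 1) ω t y H := by
  classical
  obtain ⟨τ, hτ, hcalm, hhalt⟩ := exists_stopping_level P ω t y H
  have h1 : stoppedNoise P (fun _ _ _ => 1) ω t y H =
      ∑ h ∈ Finset.range τ, (2 : ℝ) ^ h * noise P ω [] t y h := by
    rw [stoppedNoise, sum_ite_calm hτ hcalm]
    simp only [mul_one, noise]
  rw [h1] at hlt ⊢
  have h2 := sum_stored_add P ω y t [] τ
  have h3 : 0 ≤ ∑ h ∈ Finset.range τ, (2 : ℝ) ^ h * stored P ω [] t y h :=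
    Finset.sum_nonneg fun h _ => by positivity
  have h4 : 2 ^ τ * arrived P ω [] t y τ ≤ 2 * t.rank y := by linarith
  have h5 := hhalt h4
  subst h5
  obtain ⟨m, hm⟩ := arrived_eq_natCast P ω y τ t []
  have h6 : arrived P ω [] t y τ ≤ 0 := by
    rw [hm] at h4 ⊢
    have h7 : 2 ^ τ * m ≤ 2 * t.rank y := by exact_mod_cast h4
    have h8 : m = 0 := by
      by_contra hm0
      have : 2 ^ τ ≤ 2 ^ τ * m := Nat.le_mul_of_pos_right _ (Nat.pos_of_ne_zero hm0)
      omega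
    rw [h8, Nat.cast_zero]
  rw [estimate_eq P ω y t [] h6]
  ring

/-- Outside of three events of small probability, the credit noise is at most `R`, hence the
quadratic variation at most `64 R ^ 2 / K`, and the stopped error is small in both directions. -/
theorem measure_error_le (hP : P.Adequate J) {K ε : ℝ} (hK : ∀ i, K ≤ P.k i * P.B i) (hK0 : 0 < K)
    (hε : 0 < ε) (hε1 : ε ≤ 1) (hpos : 0 < t.rank y) :
    coinMeasure.real {ω | ε * (t.rank y : ℝ) ≤
      |((build P ω [] t).estimate y : ℝ) - (t.rank y : ℝ)|} ≤
        3 * Real.exp (-(ε ^ 2 * K / 128)) := by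
  obtain ⟨H, hH⟩ : ∃ H, 2 * t.rank y < 2 ^ H := ⟨_, Nat.lt_two_pow_self⟩
  set R : ℝ := (t.rank y : ℝ) with hRdef
  have hR : 0 < R := Nat.cast_pos.2 hpos
  set x := ε ^ 2 * K / 128 with hx
  have t1 := stoppedNoise_tail P (abs_creditFactor_le (P := P) hR.le) t y H (K / (64 * R)) x
  have t2 := stoppedNoise_tail P (α := fun _ _ _ => 1) (by simp) t y H (ε * K / (64 * R)) x
  have t3 := stoppedNoise_tail P (α := fun _ _ _ => 1) (by simp) t y H (-(ε * K / (64 * R))) x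
  set E1 := {ω | x ≤ K / (64 * R) * stoppedNoise P (creditFactor P R) ω t y H -
      (K / (64 * R)) ^ 2 / 2 * stoppedVariation P ω t y H}
  set E2 := {ω | x ≤ ε * K / (64 * R) * stoppedNoise P (fun _ _ _ => 1) ω t y H -
      (ε * K / (64 * R)) ^ 2 / 2 * stoppedVariation P ω t y H}
  set E3 := {ω | x ≤ -(ε * K / (64 * R)) * stoppedNoise P (fun _ _ _ => 1) ω t y H -
      (-(ε * K / (64 * R))) ^ 2 / 2 * stoppedVariation P ω t y H}
  have hsub : {ω | ε * R ≤ |((build P ω [] t).estimate y : ℝ) - R|} ⊆ E1 ∪ (E2 ∪ E3) := by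
    intro ω hω
    have hv := stoppedVariation_le hP hK ω hpos H
    rw [← hRdef] at hv
    set V := stoppedVariation P ω t y H with hV
    set M' := stoppedNoise P (creditFactor P R) ω t y H with hM'
    set M := stoppedNoise P (fun _ _ _ => 1) ω t y H with hM
    have hω' : ε * R ≤ |((build P ω [] t).estimate y : ℝ) - R| := hω
    have hε2 : ε ^ 2 ≤ 1 := pow_le_one₀ hε.le hε1
    by_cases h1 : R ≤ M'
    · left
      change x ≤ K / (64 * R) * M' - (K / (64 * R)) ^ 2 / 2 * V
      have e1 : (K / (64 * R)) ^ 2 / 2 * V = K / (64 * R) ^ 2 / 2 * (K * V) := by ring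
      have e2 : K / (64 * R) ^ 2 / 2 * (K * V) ≤
          K / (64 * R) ^ 2 / 2 * (32 * R * (R + M')) := by gcongr
      have e3 : K / (64 * R) ^ 2 / 2 * (32 * R * (R + M')) = K / (64 * R) * ((R + M') / 4) := by
        field_simp
        ring
      have e4 : x ≤ K / (64 * R) * (R / 2) := by
        have : K / (64 * R) * (R / 2) = K / 128 := by
          field_simp
          ring
        rw [this, hx]
        nlinarith
      have e5 : K / (64 * R) * (R / 2) ≤ K / (64 * R) * (M' - (R + M') / 4) := by
        gcongr
        linarith
      rw [mul_sub] at e5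
      linarith
    · right
      have hV2 : K * V ≤ 64 * R ^ 2 := by nlinarith
      have e1 : (ε * K / (64 * R)) ^ 2 / 2 * V ≤ x := by
        have e2 : (ε * K / (64 * R)) ^ 2 / 2 * V = ε ^ 2 * K / (64 * R) ^ 2 / 2 * (K * V) := by
          ring
        have e3 : ε ^ 2 * K / (64 * R) ^ 2 / 2 * (K * V) ≤
            ε ^ 2 * K / (64 * R) ^ 2 / 2 * (64 * R ^ 2) := by gcongr
        have e4 : ε ^ 2 * K / (64 * R) ^ 2 / 2 * (64 * R ^ 2) = x := by
          rw [hx]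
          field_simp
          ring
        linarith
      have e5 : ε * K / (64 * R) * (ε * R) = 2 * x := by
        rw [hx]
        field_simp
        ring
      have hcase : ε * R ≤ M ∨ ε * R ≤ -M := by
        by_cases h2 : M ≤ R
        · have h3 := estimate_sub_eq (P := P) ω hH h2
          rw [← hRdef, ← hM] at h3
          rw [h3] at hω'
          exact le_abs.1 hω'
        · left
          nlinarith
      have hl : 0 < ε * K / (64 * R) := by positivity
      rcases hcase with h2 | h2
      · left
        change x ≤ ε * K / (64 * R) * M - (ε * K / (64 * R)) ^ 2 / 2 * V
        have := mul_le_mul_of_nonneg_left h2 hl.le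
        linarith
      · right
        change x ≤ -(ε * K / (64 * R)) * M - (-(ε * K / (64 * R))) ^ 2 / 2 * V
        have := mul_le_mul_of_nonneg_left h2 hl.le
        rw [neg_sq]
        linarith
  have hfin : coinMeasure {ω | ε * R ≤ |((build P ω [] t).estimate y : ℝ) - R|} ≤
      ENNReal.ofReal (3 * Real.exp (-x)) := by
    calc _ ≤ coinMeasure (E1 ∪ (E2 ∪ E3)) := measure_mono hsub
      _ ≤ coinMeasure E1 + (coinMeasure E2 + coinMeasure E3) :=
        (measure_union_le _ _).trans (add_le_add_right (measure_union_le _ _) _)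
      _ ≤ ENNReal.ofReal (Real.exp (-x)) + (ENNReal.ofReal (Real.exp (-x)) +
          ENNReal.ofReal (Real.exp (-x))) := by gcongr
      _ = _ := by
        rw [← ENNReal.ofReal_add (by positivity) (by positivity),
          ← ENNReal.ofReal_add (by positivity) (by positivity)]
        congr 1
        ring
  exact ENNReal.toReal_le_of_le_ofReal (by positivity) hfin

end RCSketch

/-! ### The parameters -/

namespace RCSchedule

/-- The parameters in which the section size halves from stage to stage, starting with `2 ⌈κ⌉`, the
number of sections grows by a factor of `4`, and the bound on the input size, in units of `q`, is
raised to the fourth power. The capacity of a buffer at least doubles. -/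
noncomputable def geometric (κ : ℝ) (hκ : 0 < κ) (q : ℕ) (hq : 0 < q) : RCSchedule where
  N i := q * 2 ^ 4 ^ i
  k i := 2 * ⌈κ / 2 ^ i⌉₊
  m i := 16 * 4 ^ i
  strictMono_N := fun i j hij => by
    have h1 : 4 ^ i < 4 ^ j := Nat.pow_lt_pow_right (by norm_num) hij
    exact Nat.mul_lt_mul_of_pos_left (Nat.pow_lt_pow_right (by norm_num) h1) hq
  k_pos i := Nat.mul_pos (by norm_num) (Nat.ceil_pos.2 (by positivity))
  k_even i := even_two_mul _
  m_pos i := by positivity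

variable {κ : ℝ} {hκ : 0 < κ} {q : ℕ} {hq : 0 < q}

theorem geometric_B (i : ℕ) : (geometric κ hκ q hq).B i = 64 * 4 ^ i * ⌈κ / 2 ^ i⌉₊ := by
  simp only [B, geometric]
  ring

theorem le_ceil_mul_two_pow (κ : ℝ) (i : ℕ) : κ ≤ ⌈κ / 2 ^ i⌉₊ * 2 ^ i := by
  rw [← div_le_iff₀ (by positivity)]
  exact Nat.le_ceil _

theorem geometric_adequate (h : (3 * q : ℝ) ≤ κ) :
    (geometric κ hκ q hq).Adequate fun i => 2 * 4 ^ i where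
  antitone_k := fun i j hij => Nat.mul_le_mul_left _ <| Nat.ceil_mono <|
    div_le_div_of_nonneg_left hκ.le (by positivity) (pow_le_pow_right₀ (by norm_num) hij)
  two_mul_B_le i := by
    have h1 : ⌈κ / 2 ^ i⌉₊ ≤ 2 * ⌈κ / 2 ^ (i + 1)⌉₊ := by
      refine Nat.ceil_le.2 ?_
      have h2 := Nat.le_ceil (κ / 2 ^ (i + 1))
      have h3 : κ / 2 ^ i = 2 * (κ / 2 ^ (i + 1)) := by
        rw [pow_succ]
        field_simp
      push_cast
      linarith
    rw [geometric_B, geometric_B]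
    calc _ ≤ 2 * (64 * 4 ^ i * (2 * ⌈κ / 2 ^ (i + 1)⌉₊)) := by gcongr
      _ = _ := by ring
  sixteen_le_m := le_rfl
  four_mul_J_le i := by
    have : 1 ≤ 4 ^ i := Nat.one_le_pow _ _ (by norm_num)
    simp only [geometric]
    omega
  N_lt i := by
    have h1 : 3 * q ≤ ⌈κ / 2 ^ i⌉₊ * 2 ^ i := by
      exact_mod_cast h.trans (le_ceil_mul_two_pow κ i)
    have h2 : 2 ^ i ≤ 2 ^ 4 ^ i :=
      Nat.pow_le_pow_right (by norm_num) (Nat.lt_pow_self (by norm_num)).le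
    have h3 : 3 * q ≤ ⌈κ / 2 ^ i⌉₊ * 2 ^ 4 ^ i := h1.trans (Nat.mul_le_mul_left _ h2)
    have h4 : 0 < 2 ^ 4 ^ i := by positivity
    simp only [geometric]
    calc 9 * (q * 2 ^ 4 ^ i) < 16 * (3 * q) * 2 ^ 4 ^ i := by nlinarith [Nat.mul_pos hq h4]
      _ ≤ 16 * (⌈κ / 2 ^ i⌉₊ * 2 ^ 4 ^ i) * 2 ^ 4 ^ i := by gcongr
      _ = _ := by ring

theorem geometric_k_mul_B (i : ℕ) :
    128 * κ ^ 2 ≤ (geometric κ hκ q hq).k i * (geometric κ hκ q hq).B i := by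
  have h1 := le_ceil_mul_two_pow κ i
  have h2 : ((geometric κ hκ q hq).k i * (geometric κ hκ q hq).B i : ℝ) =
      128 * (⌈κ / 2 ^ i⌉₊ * 2 ^ i) ^ 2 := by
    rw [geometric_B]
    simp only [geometric]
    push_cast
    rw [show (4 : ℝ) ^ i = (2 ^ i) ^ 2 by rw [← pow_mul, mul_comm, pow_mul]; norm_num]
    ring
  rw [h2]
  gcongr

theorem geometric_B_le (i : ℕ) :
    ((geometric κ hκ q hq).B i : ℝ) ≤ 64 * (κ * 2 ^ i + 4 ^ i) := by
  have h1 := (Nat.ceil_lt_add_one (a := κ / 2 ^ i) (by positivity)).le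
  rw [geometric_B]
  push_cast
  have h4 : (4 : ℝ) ^ i = 2 ^ i * 2 ^ i := by rw [← mul_pow]; norm_num
  calc (64 * 4 ^ i * ⌈κ / 2 ^ i⌉₊ : ℝ) ≤ 64 * 4 ^ i * (κ / 2 ^ i + 1) := by gcongr
    _ = _ := by
      rw [h4]
      field_simp

end RCSchedule

/-! ### The size of the sketch -/

theorem one_le_logEps (ε : ℝ) (n : ℕ) : 1 ≤ logEps ε n := le_max_left _ _

theorem logb_le_logEps (ε : ℝ) (n : ℕ) : Real.logb 2 (ε * n) ≤ logEps ε n := le_max_right _ _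

namespace RCSchedule

variable {κ : ℝ} {hκ : 0 < κ} {q : ℕ} {hq : 0 < q}

/-- The stage before the one of `n` items was left because `ε n` exceeds `2 ^ 4 ^ i`. -/
theorem four_pow_stage_le {ε : ℝ} (h : 1 ≤ ε * q) (n : ℕ) :
    (4 : ℝ) ^ (geometric κ hκ q hq).stage n ≤ 4 * logEps ε n := by
  have h1 := one_le_logEps ε n
  rcases hi : (geometric κ hκ q hq).stage n with _ | j
  · rw [pow_zero]
    linarith
  · have h2 : q * 2 ^ 4 ^ j < n :=
      (geometric κ hκ q hq).lt_of_lt_stage (n := n) (i := j) (by omega)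
    have hε : 0 < ε := by
      by_contra hε
      have : ε * q ≤ 0 := mul_nonpos_of_nonpos_of_nonneg (not_lt.1 hε) (by positivity)
      linarith
    have h3 : (2 : ℝ) ^ 4 ^ j ≤ ε * n := by
      have h4 : ((q : ℝ) * 2 ^ 4 ^ j) ≤ n := by exact_mod_cast h2.le
      calc (2 : ℝ) ^ 4 ^ j ≤ (ε * q) * 2 ^ 4 ^ j := le_mul_of_one_le_left (by positivity) h
        _ = ε * (q * 2 ^ 4 ^ j) := by ring
        _ ≤ ε * n := by gcongr
    have h4 : ((4 ^ j : ℕ) : ℝ) ≤ Real.logb 2 (ε * n) := by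
      have h5 := Real.logb_le_logb_of_le (b := 2) (by norm_num) (by positivity) h3
      rwa [Real.logb_pow, Real.logb_self_eq_one (by norm_num), mul_one] at h5
    have h5 := logb_le_logEps ε n
    push_cast at h4
    rw [pow_succ]
    linarith

end RCSchedule

namespace RCSketch

variable {U : Type u} [LinearOrder U] {P : RCSchedule} {J : ℕ → ℕ}

/-- The numbers of items that arrive at the levels decrease geometrically, and no level is opened
before `B 0` items have arrived at the level below. -/
theorem length_levels_le (hP : P.Adequate J) {ε : ℝ} (hε : 0 < ε) (h : 1 ≤ ε * P.B 0)
    (ω : Coin → Bool) (t : MergeTree U) :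
    ((build P ω [] t).levels.length : ℝ) ≤ 3 * logEps ε t.size + 2 := by
  have h1 := one_le_logEps ε t.size
  rcases hl : (build P ω [] t).levels.length with _ | _ | g
  · push_cast
    linarith
  · push_cast
    linarith
  · obtain ⟨y, hy⟩ := exists_max_item t
    have h2 := B_le_arrived ω hP g t [] hy (by omega)
    have h3 := arrived_le_pow ω hP g t [] hy
    have h4 : (32 / 25 : ℝ) ^ g ≤ ε * t.size := by
      have h5 : (P.B 0 : ℝ) ≤ (25 / 32) ^ g * t.size := h2.trans h3
      have h6 : (32 / 25 : ℝ) ^ g * (25 / 32) ^ g = 1 := by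
        rw [← mul_pow]
        norm_num
      calc (32 / 25 : ℝ) ^ g ≤ (32 / 25) ^ g * (ε * P.B 0) :=
            le_mul_of_one_le_right (by positivity) h
        _ ≤ (32 / 25) ^ g * (ε * ((25 / 32) ^ g * t.size)) := by gcongr
        _ = ((32 / 25) ^ g * (25 / 32) ^ g) * (ε * t.size) := by ring
        _ = ε * t.size := by rw [h6, one_mul]
    have h5 : (2 : ℝ) ^ g ≤ (ε * t.size) ^ 3 := by
      calc (2 : ℝ) ^ g ≤ ((32 / 25) ^ 3) ^ g := by gcongr; norm_num
        _ = ((32 / 25) ^ g) ^ 3 := by rw [← pow_mul, ← pow_mul, mul_comm]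
        _ ≤ (ε * t.size) ^ 3 := by gcongr
    have h6 := Real.logb_le_logb_of_le (b := 2) (by norm_num) (by positivity) h5
    rw [Real.logb_pow, Real.logb_pow, Real.logb_self_eq_one (by norm_num), mul_one] at h6
    have h7 := logb_le_logEps ε t.size
    push_cast at h6 ⊢
    linarith

theorem size_le_length_mul (P : RCSchedule) (ω : Coin → Bool) (t : MergeTree U) :
    (build P ω [] t).size ≤ 2 + (build P ω [] t).levels.length * (P.B (P.stage t.size) + 1) := by
  unfold size
  refine Nat.add_le_add_left ?_ _
  have h1 : ∀ c ∈ (build P ω [] t).levels, c.buf.card + 2 ≤ P.B (P.stage t.size) + 1 := by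
    intro c hc
    obtain ⟨h, _, rfl⟩ := exists_nth_of_mem hc
    have := card_buf_lt (P := P) ω h t []
    omega
  have h2 := List.sum_le_card_nsmul ((build P ω [] t).levels.map fun c => c.buf.card + 2)
    (P.B (P.stage t.size) + 1) (by simpa using h1)
  simpa using h2

/-- There are at most `5 L` levels, each with at most `2 B` words. -/
theorem size_le (hP : P.Adequate J) {ε : ℝ} (hε : 0 < ε) (h : 1 ≤ ε * P.B 0)
    (ω : Coin → Bool) (t : MergeTree U) :
    ((build P ω [] t).size : ℝ) ≤ 11 * logEps ε t.size * P.B (P.stage t.size) := by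
  have h1 := one_le_logEps ε t.size
  have h2 := length_levels_le hP hε h ω t
  have h3 : ((build P ω [] t).size : ℝ) ≤
      2 + (build P ω [] t).levels.length * (P.B (P.stage t.size) + 1) := by
    exact_mod_cast size_le_length_mul P ω t
  have h4 : (4 : ℝ) ≤ P.B (P.stage t.size) := by exact_mod_cast P.four_le_B _
  set L := logEps ε t.size
  set B : ℝ := (P.B (P.stage t.size) : ℝ)
  have h5 : ((build P ω [] t).levels.length : ℝ) * (B + 1) ≤ (5 * L) * (2 * B) :=
    mul_le_mul (by linarith) (by linarith) (by linarith) (by linarith)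
  nlinarith

end RCSketch

namespace RCSchedule

variable {κ : ℝ} {hκ : 0 < κ} {q : ℕ} {hq : 0 < q}

theorem geometric_B_stage_le {ε : ℝ} (h : 1 ≤ ε * q) (n : ℕ) :
    ((geometric κ hκ q hq).B ((geometric κ hκ q hq).stage n) : ℝ) ≤
      128 * κ * √(logEps ε n) + 256 * logEps ε n := by
  have h1 := four_pow_stage_le (κ := κ) (hκ := hκ) (hq := hq) h n
  have h2 := geometric_B_le (κ := κ) (hκ := hκ) (hq := hq) ((geometric κ hκ q hq).stage n)
  set i := (geometric κ hκ q hq).stage n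
  have h3 : (2 : ℝ) ^ i ≤ 2 * √(logEps ε n) := by
    have h4 : ((2 : ℝ) ^ i) ^ 2 ≤ (2 * √(logEps ε n)) ^ 2 := by
      rw [mul_pow, Real.sq_sqrt (zero_le_one.trans (one_le_logEps ε n)), ← pow_mul, mul_comm i,
        pow_mul]
      norm_num
      exact h1
    exact (pow_le_pow_iff_left₀ (by positivity) (by positivity) two_ne_zero).1 h4
  nlinarith [mul_le_mul_of_nonneg_left h3 hκ.le]

end RCSchedule

theorem theorem1 :
    ∃ C : ℝ, 0 < C ∧ ∀ δ ε : ℝ, 0 < δ → δ ≤ 1 / 2 → 0 < ε → ε ≤ 1 →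
      ∃ P : RCSchedule, ∀ (U : Type u) [LinearOrder U] (t : MergeTree U),
        ε * (2 * Real.logb 2 t.size) ^ (1 / 4 : ℝ) ≤ 4 →
        -- accuracy, for every fixed `y`
        (∀ y : U, 0 < t.rank y →
          coinMeasure.real {ω | ε * (t.rank y : ℝ) ≤
            |((RCSketch.build P ω [] t).estimate y : ℝ) - (t.rank y : ℝ)|} < δ) ∧
        (∀ y : U, t.rank y = 0 → ∀ ω, (RCSketch.build P ω [] t).estimate y = 0) ∧
        -- size in memory words; the integers stored are at most the input size
        (ε ≤ 4 * √(Real.log (1 / δ) / logEps ε t.size) → ∀ ω,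
          ((RCSketch.build P ω [] t).size : ℝ) ≤
            C * (ε⁻¹ * logEps ε t.size ^ (3 / 2 : ℝ) * √(Real.log (1 / δ)))) ∧
        (4 * √(Real.log (1 / δ) / logEps ε t.size) < ε → ∀ ω,
          ((RCSketch.build P ω [] t).size : ℝ) ≤ C * logEps ε t.size ^ 2) ∧
        (∀ ω, (RCSketch.build P ω [] t).n = t.size ∧
          ∀ c ∈ (RCSketch.build P ω [] t).levels, c.state ≤ t.size) ∧
        -- comparison-based: only input items are stored, and only their order matters
        (∀ ω, ∀ c ∈ (RCSketch.build P ω [] t).levels, ∀ x ∈ c.buf, x ∈ t.items) ∧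
        (∀ (V : Type u) [LinearOrder V] (f : U → V), StrictMono f → ∀ ω,
          RCSketch.build P ω [] (t.map f) = (RCSketch.build P ω [] t).map f) := by
  refine ⟨22528, by norm_num, fun δ ε hδ hδ2 hε hε1 => ?_⟩
  have hlog : Real.log 2 ≤ Real.log (1 / δ) :=
    Real.log_le_log (by norm_num) (by rw [le_div_iff₀ hδ]; linarith)
  have hlog2 := Real.log_two_gt_d9
  set l := √(Real.log (1 / δ)) with hl
  have hlsq : l ^ 2 = Real.log (1 / δ) := Real.sq_sqrt (by linarith)
  have hl1 : 3 / 4 ≤ l := Real.le_sqrt_of_sq_le (by linarith)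
  have hεi : 1 ≤ ε⁻¹ := (one_le_inv₀ hε).2 hε1
  -- `k B ≥ 128 κ ^ 2` then makes the exponent of `measure_error_le` equal to `-64 log (1 / δ)`, and
  -- `3 ⌈ε⁻¹⌉ ≤ κ` holds because of `3 / 4 ≤ l`
  set κ := 8 * ε⁻¹ * l with hκdef
  have hκ : 0 < κ := by positivity
  set q := ⌈ε⁻¹⌉₊ with hqdef
  have hq : 0 < q := Nat.ceil_pos.2 (by positivity)
  have hqε : 1 ≤ ε * q := by
    rw [← inv_le_iff_one_le_mul₀' hε]
    exact Nat.le_ceil _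
  have hqκ : (3 * q : ℝ) ≤ κ := by
    have := (Nat.ceil_lt_add_one (a := ε⁻¹) (by positivity)).le
    rw [← hqdef] at this
    nlinarith
  have hP := RCSchedule.geometric_adequate (hκ := hκ) (hq := hq) hqκ
  have hB : 1 ≤ ε * (RCSchedule.geometric κ hκ q hq).B 0 := by
    have h1 : (q : ℝ) ≤ (RCSchedule.geometric κ hκ q hq).B 0 := by
      have h2 := RCSchedule.le_ceil_mul_two_pow κ 0
      rw [RCSchedule.geometric_B]
      push_cast
      have : (0 : ℝ) < q := Nat.cast_pos.2 hq
      linarith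
    exact hqε.trans (mul_le_mul_of_nonneg_left h1 hε.le)
  have hwords : ∀ (U : Type u) [LinearOrder U] (t : MergeTree U) ω, 0 < logEps ε t.size ∧
      0 < √(logEps ε t.size) ∧
      ((RCSketch.build (RCSchedule.geometric κ hκ q hq) ω [] t).size : ℝ) ≤
        11264 * (ε⁻¹ * l) * (logEps ε t.size * √(logEps ε t.size)) +
          2816 * logEps ε t.size ^ 2 := by
    intro U _ t ω
    have hL : 0 < logEps ε t.size := zero_lt_one.trans_le (one_le_logEps ε t.size)
    refine ⟨hL, Real.sqrt_pos.2 hL, (RCSketch.size_le hP hε hB ω t).trans ?_⟩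
    have h1 := mul_le_mul_of_nonneg_left
      (RCSchedule.geometric_B_stage_le (κ := κ) (hκ := hκ) (hq := hq) hqε t.size) hL.le
    have h2 : logEps ε t.size * (128 * κ * √(logEps ε t.size) + 256 * logEps ε t.size) =
        1024 * (ε⁻¹ * l) * (logEps ε t.size * √(logEps ε t.size)) +
          256 * logEps ε t.size ^ 2 := by
      rw [hκdef]
      ring
    linarith
  refine ⟨RCSchedule.geometric κ hκ q hq, fun U _ t _ => ⟨fun y hy => ?_,
    fun y hy ω => RCSketch.estimate_eq_zero _ ω y t [] hy, ?_, ?_,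
    fun ω => ⟨RCSketch.build_n _ ω t [], fun c hc => ?_⟩, fun ω c hc x hx => ?_,
    fun V _ f hf ω => build_map hf _ ω t []⟩⟩
  · have h1 := RCSketch.measure_error_le hP RCSchedule.geometric_k_mul_B (by positivity) hε hε1 hy
    refine h1.trans_lt ?_
    have h2 : ε ^ 2 * (128 * κ ^ 2) / 128 = 64 * Real.log (1 / δ) := by
      rw [hκdef, ← hlsq]
      field_simp
      norm_num
    have h3 : Real.exp (-(3 * Real.log (1 / δ))) = δ ^ 3 := by
      rw [one_div, Real.log_inv, mul_neg, neg_neg, mul_comm, Real.exp_mul, Real.exp_log hδ]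
      norm_num
    have h4 : Real.exp (-(64 * Real.log (1 / δ))) ≤ δ ^ 3 := by
      rw [← h3]
      exact Real.exp_le_exp.2 (by linarith)
    rw [h2]
    have h5 : δ ^ 2 ≤ 1 / 4 := by nlinarith
    nlinarith
  · intro hcase ω
    obtain ⟨hL, hs, hsize⟩ := hwords U t ω
    rw [Real.sqrt_div (by linarith), ← hl, ← mul_div_assoc, le_div_iff₀ hs] at hcase
    have h1 : √(logEps ε t.size) ≤ 4 * (ε⁻¹ * l) := by
      rw [mul_left_comm, ← div_eq_inv_mul, le_div_iff₀ hε]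
      linarith
    have h2 : logEps ε t.size ^ (3 / 2 : ℝ) = logEps ε t.size * √(logEps ε t.size) := by
      rw [Real.sqrt_eq_rpow, ← Real.rpow_one_add' (by linarith) (by norm_num)]
      norm_num
    have h3 := mul_le_mul_of_nonneg_left h1
      (show 0 ≤ logEps ε t.size * √(logEps ε t.size) by positivity)
    have h4 : logEps ε t.size * √(logEps ε t.size) * √(logEps ε t.size) = logEps ε t.size ^ 2 := by
      rw [mul_assoc, Real.mul_self_sqrt (by linarith), sq]
    rw [h2]
    linarith
  · intro hcase ω
    obtain ⟨hL, hs, hsize⟩ := hwords U t ω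
    rw [Real.sqrt_div (by linarith), ← hl, ← mul_div_assoc, div_lt_iff₀ hs] at hcase
    have h1 : 4 * (ε⁻¹ * l) ≤ √(logEps ε t.size) := by
      rw [mul_left_comm, ← div_eq_inv_mul, div_le_iff₀ hε]
      linarith
    have h3 := mul_le_mul_of_nonneg_left h1
      (show 0 ≤ logEps ε t.size * √(logEps ε t.size) by positivity)
    have h4 : logEps ε t.size * √(logEps ε t.size) * √(logEps ε t.size) = logEps ε t.size ^ 2 := by
      rw [mul_assoc, Real.mul_self_sqrt (by linarith), sq]
    have h5 := sq_nonneg (logEps ε t.size)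
    linarith
  · obtain ⟨h, _, rfl⟩ := RCSketch.exists_nth_of_mem hc
    exact RCSketch.state_le_size ω hP h t []
  · obtain ⟨h, _, rfl⟩ := RCSketch.exists_nth_of_mem hc
    exact RCSketch.mem_build _ ω t [] h x hx
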